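/- **Theorem.** Let $\{W(x)\}_{x\in\mathbb R}$ be a Brownian motion on the real line, on a probability space $(\Omega,\mathcal F,\mathbb P)$, i.e. a centered Gaussian process with $\mathbb E[W(x)W(y)]=\tfrac12(|x|+|y|-|x-y|)$. For $f\in L^2(\mathbb R)$ let $\int_{\mathbb R} f\,dW$ be the Wiener integral, and let $\{B(t,\theta)\}_{(t,\theta)\in\mathbb R\times(0,1)}$ be the centered Gaussian field $$B(t,\theta)=\int_{\mathbb R}\Big\{(t-x)_+^{\theta-1/2}-(-x)_+^{\theta-1/2}\Big\}\,dW(x),$$ where $(u)_+^{\theta-1/2}=u^{\theta-1/2}$ if $u>0$ and $(u)_+^{\theta-1/2}=0$ otherwise. Then there exist a real-valued Lemarié–Meyer mother wavelet $\psi$ (a Schwartz function such that $\widehat\psi(\xi)=\int_{\mathbb R}e^{-i\xi x}\psi(x)\,dx$ vanishes outside $\{2\pi/3\le|\xi|\le 8\pi/3\}$ and $\{2^{j/2}\psi(2^j\cdot-k):(j,k)\in\mathbb Z^2\}$ is an orthonormal basis of $L^2(\mathbb R)$), an event $\Omega^*$ of probability $1$, and a modification $\{\widetilde B(t,\theta)\}_{(t,\theta)\in\mathbb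 R\times(0,1)}$ of $\{B(t,\theta)\}$ such that, for each $\omega\in\Omega^*$, one has for all $(t,\theta)\in\mathbb R\times(0,1)$ the absolutely convergent series representation $$\widetilde B(t,\theta,\omega)=\sum_{(j,k)\in\mathbb Z^2}2^{-j\theta}\varepsilon_{j,k}(\omega)\big[\Psi(2^jt-k,\theta)-\Psi(-k,\theta)\big],$$ with $\varepsilon_{j,k}=2^{j/2}\int_{\mathbb R}\psi(2^jx-k)\,dW(x)$ and $\Psi(y,\theta)=\int_{\mathbb R}(y-x)_+^{\theta-1/2}\psi(x)\,dx$, and the following four results hold. 1. The function $(t,\theta)\mapsto\widetilde B(t,\theta,\omega)$ is continuous over $\mathbb R\times(0,1)$. 2. For every $\varepsilon>0$ and $(s,\theta)\in\mathbb R\times(0,1)$, $$\limsup_{h\to0}\frac{|\widetilde B(s+h,\theta,\omega)-\widetilde B(s,\theta,\omega)|}{|h|^{\theta-\varepsilon}}=0\quad\text{and}\quad\limsup_{h\to0}\frac{|\widetilde B(s+h,\theta,\omega)-\widetilde B(s,\theta,\omega)|}{|h|^{\theta+\varepsilon}}=+\infty.$$ 3. For each $t\in\mathbb R$, the function $\theta\mapsto\widetilde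 B(t,\theta,\omega)$ is $C^\infty$ over $(0,1)$; its derivative of order $n\in\mathbb Z_+$ at $\theta$ is denoted by $(\partial_\theta^n\widetilde B)(t,\theta,\omega)$. 4. For every $n\in\mathbb Z_+$, $\varepsilon>0$ and real numbers $M,a,b$ with $M>0$ and $0<a<b<1$, there is a constant $C(\omega)>0$, depending only on $\omega,n,\varepsilon,M,a,b$, such that $$\big|(\partial_\theta^n\widetilde B)(t_1,\theta_1,\omega)-(\partial_\theta^n\widetilde B)(t_2,\theta_2,\omega)\big|\le C(\omega)\Big(|t_1-t_2|^{\max\{\theta_1,\theta_2\}-\varepsilon}+|\theta_1-\theta_2|\Big)$$ for all $(t_1,\theta_1),(t_2,\theta_2)\in[-M,M]\times[a,b]$ (with the convention $0^x=0$ for $x\neq 0$ and $0^0=1$). -/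

import Mathlib

open MeasureTheory ProbabilityTheory Filter Set
open scoped Topology ENNReal SchwartzMap

noncomputable section

/-! ### Brownian motion on the line and the Wiener integral -/

/-- `W` has the law of a Brownian motion indexed by the real line (normalised by `W 0 = 0` a.s.):
a centered Gaussian process with covariance `(|x| + |y| - |x - y|) / 2`.
Path regularity is not required, since it plays no role for the Wiener integral. -/
structure IsBrownianOnLine {Ω : Type*} [MeasurableSpace Ω] (W : ℝ → Ω → ℝ) (P : Measure Ω) :
    Prop where
  isGaussianProcess : IsGaussianProcess W P
  centered : ∀ x, ∫ ω, W x ω ∂P = 0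
  covariance : ∀ x y, ∫ ω, W x ω * W y ω ∂P = (|x| + |y| - |x - y|) / 2

theorem IsBrownianOnLine.memLp {Ω : Type*} [MeasurableSpace Ω] {W : ℝ → Ω → ℝ} {P : Measure Ω}
    (hW : IsBrownianOnLine W P) (x : ℝ) : MemLp (W x) 2 P :=
  (hW.isGaussianProcess.hasGaussianLaw_eval x).memLp_two

/-- The value `W x` as an element of `L²(Ω)`. -/
def IsBrownianOnLine.val {Ω : Type*} [MeasurableSpace Ω] {W : ℝ → Ω → ℝ} {P : Measure Ω}
    (hW : IsBrownianOnLine W P) (x : ℝ) : Lp ℝ 2 P :=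
  (hW.memLp x).toLp (W x)

/-- The indices `(a, b)`, `a ≤ b`, of the half-open intervals `(a, b]`. -/
abbrev LineInterval : Type := {p : ℝ × ℝ // p.1 ≤ p.2}

/-- The indicator function of `(a, b]` as an element of `L²(ℝ)`. -/
def intervalIndicator (p : LineInterval) : Lp ℝ 2 (volume : Measure ℝ) :=
  indicatorConstLp 2 (measurableSet_Ioc (a := p.1.1) (b := p.1.2)) measure_Ioc_lt_top.ne (1 : ℝ)

/-- The step function `∑ cᵢ 1_{(aᵢ, bᵢ]}` in `L²(ℝ)`, for a finite family of coefficients. -/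
def stepFunction : (LineInterval →₀ ℝ) →ₗ[ℝ] Lp ℝ 2 (volume : Measure ℝ) :=
  Finsupp.linearCombination ℝ intervalIndicator

/-- The elementary integral `∑ cᵢ (W bᵢ - W aᵢ)` in `L²(Ω)`. -/
def IsBrownianOnLine.stepIntegral {Ω : Type*} [MeasurableSpace Ω] {W : ℝ → Ω → ℝ} {P : Measure Ω}
    (hW : IsBrownianOnLine W P) : (LineInterval →₀ ℝ) →ₗ[ℝ] Lp ℝ 2 P :=
  Finsupp.linearCombination ℝ fun p : LineInterval => hW.val p.1.2 - hW.val p.1.1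

/-- The Wiener integral `f ↦ ∫ f dW`: the continuous linear extension to `L²(ℝ)` of the
elementary integral `∑ cᵢ 1_{(aᵢ, bᵢ]} ↦ ∑ cᵢ (W bᵢ - W aᵢ)` of step functions
(see `wienerIntegral_stepFunction` and `norm_wienerIntegral`). -/
def IsBrownianOnLine.wienerIntegral {Ω : Type*} [MeasurableSpace Ω] {W : ℝ → Ω → ℝ}
    {P : Measure Ω} (hW : IsBrownianOnLine W P) :
    Lp ℝ 2 (volume : Measure ℝ) →L[ℝ] Lp ℝ 2 P :=
  hW.stepIntegral.extendOfNorm stepFunction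

theorem denseRange_stepFunction : DenseRange stepFunction := by
  have hr : Set.range stepFunction = ((LinearMap.range stepFunction :
      Submodule ℝ (Lp ℝ 2 (volume : Measure ℝ))) : Set (Lp ℝ 2 (volume : Measure ℝ))) := rfl
  rw [DenseRange, hr, Submodule.dense_iff_topologicalClosure_eq_top,
    Submodule.topologicalClosure_eq_top_iff, Submodule.eq_bot_iff]
  intro f hf
  have h0 : ∀ a b : ℝ, a ≤ b → ∫ x in Ioc a b, f x = 0 := by
    intro a b hab
    have h1 := (Submodule.mem_orthogonal _ _).1 hf (intervalIndicator ⟨(a, b), hab⟩)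
      ⟨Finsupp.single ⟨(a, b), hab⟩ 1, by simp [stepFunction]⟩
    rwa [intervalIndicator, L2.inner_indicatorConstLp_one] at h1
  have hloc : LocallyIntegrable f (volume : Measure ℝ) :=
    (Lp.memLp f).locallyIntegrable (by norm_num)
  have hae := LocallyIntegrable.ae_hasDerivAt_integral hloc
  rw [Lp.eq_zero_iff_ae_eq_zero]
  filter_upwards [hae] with x hx
  have h2 := hx 0
  have h3 : (fun y => ∫ z in (0 : ℝ)..y, f z) = fun _ => (0 : ℝ) := by
    funext y
    rcases le_total 0 y with h | h
    · rw [intervalIntegral.integral_of_le h, h0 _ _ h]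
    · rw [intervalIntegral.integral_of_ge h, h0 _ _ h, neg_zero]
  rw [h3] at h2
  exact (h2.unique (hasDerivAt_const x (0 : ℝ)))

theorem inner_intervalIndicator (p q : LineInterval) :
    inner ℝ (intervalIndicator p) (intervalIndicator q) =
      (|p.1.2 - q.1.1| + |p.1.1 - q.1.2| - |p.1.2 - q.1.2| - |p.1.1 - q.1.1|) / 2 := by
  obtain ⟨⟨a, b⟩, hab⟩ := p
  obtain ⟨⟨c, d⟩, hcd⟩ := q
  simp only at hab hcd ⊢
  rw [intervalIndicator, intervalIndicator,
    L2.real_inner_indicatorConstLp_one_indicatorConstLp_one measurableSet_Ioc measurableSet_Ioc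
      measure_Ioc_lt_top.ne measure_Ioc_lt_top.ne, Ioc_inter_Ioc, Real.volume_real_Ioc]
  grind

theorem IsBrownianOnLine.inner_val {Ω : Type*} [MeasurableSpace Ω] {W : ℝ → Ω → ℝ} {P : Measure Ω}
    (hW : IsBrownianOnLine W P) (x y : ℝ) :
    inner ℝ (hW.val x) (hW.val y) = (|x| + |y| - |x - y|) / 2 := by
  rw [← hW.covariance, L2.inner_def]
  refine integral_congr_ae ?_
  filter_upwards [(hW.memLp x).coeFn_toLp, (hW.memLp y).coeFn_toLp] with ω h1 h2
  simp only [IsBrownianOnLine.val]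
  rw [h1, h2]
  simp [mul_comm]

theorem IsBrownianOnLine.inner_stepIntegral {Ω : Type*} [MeasurableSpace Ω] {W : ℝ → Ω → ℝ}
    {P : Measure Ω} (hW : IsBrownianOnLine W P) (c d : LineInterval →₀ ℝ) :
    inner ℝ (hW.stepIntegral c) (hW.stepIntegral d) =
      inner ℝ (stepFunction c) (stepFunction d) := by
  simp only [IsBrownianOnLine.stepIntegral, stepFunction, Finsupp.linearCombination_apply,
    Finsupp.sum, sum_inner, inner_sum, real_inner_smul_left, real_inner_smul_right,
    inner_intervalIndicator, inner_sub_left, inner_sub_right, hW.inner_val]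
  refine Finset.sum_congr rfl fun p _ => Finset.sum_congr rfl fun q _ => ?_
  ring

theorem IsBrownianOnLine.norm_stepIntegral {Ω : Type*} [MeasurableSpace Ω] {W : ℝ → Ω → ℝ}
    {P : Measure Ω} (hW : IsBrownianOnLine W P) (c : LineInterval →₀ ℝ) :
    ‖hW.stepIntegral c‖ = ‖stepFunction c‖ := by
  rw [norm_eq_sqrt_real_inner, norm_eq_sqrt_real_inner, hW.inner_stepIntegral]

theorem IsBrownianOnLine.wienerIntegral_stepFunction {Ω : Type*} [MeasurableSpace Ω]
    {W : ℝ → Ω → ℝ} {P : Measure Ω} (hW : IsBrownianOnLine W P) (c : LineInterval →₀ ℝ) :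
    hW.wienerIntegral (stepFunction c) = hW.stepIntegral c :=
  LinearMap.extendOfNorm_eq denseRange_stepFunction
    ⟨1, fun c => by rw [one_mul, hW.norm_stepIntegral]⟩ c

theorem IsBrownianOnLine.norm_wienerIntegral {Ω : Type*} [MeasurableSpace Ω]
    {W : ℝ → Ω → ℝ} {P : Measure Ω} (hW : IsBrownianOnLine W P)
    (f : Lp ℝ 2 (volume : Measure ℝ)) : ‖hW.wienerIntegral f‖ = ‖f‖ := by
  refine denseRange_stepFunction.induction_on f (isClosed_eq (by fun_prop) (by fun_prop)) ?_
  intro c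
  rw [hW.wienerIntegral_stepFunction, hW.norm_stepIntegral]

/-! ### The field `B` -/

/-- `(u)₊ ^ a`, with value `u ^ a` if `u > 0` and `0` otherwise (also for `a ≤ 0`). -/
def posPow (u a : ℝ) : ℝ := if 0 < u then u ^ a else 0

/-- The kernel `x ↦ (t - x)₊ ^ (θ - 1/2) - (-x)₊ ^ (θ - 1/2)`. -/
def fieldKernel (t θ x : ℝ) : ℝ := posPow (t - x) (θ - 1 / 2) - posPow (-x) (θ - 1 / 2)

theorem measurable_posPow (a : ℝ) : Measurable fun u => posPow u a :=
  Measurable.ite measurableSet_Ioi (by fun_prop) measurable_const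

theorem measurable_fieldKernel (t θ : ℝ) : Measurable (fieldKernel t θ) :=
  ((measurable_posPow _).comp (measurable_const.sub measurable_id)).sub
    ((measurable_posPow _).comp measurable_neg)

theorem posPow_sq (u a : ℝ) : posPow u a ^ 2 = posPow u (2 * a) := by
  unfold posPow
  split_ifs with h
  · rw [mul_comm, Real.rpow_mul h.le]; norm_cast
  · simp

theorem intervalIntegrable_posPow {a : ℝ} (ha : -1 < a) (c d : ℝ) :
    IntervalIntegrable (fun u => posPow u a) volume c d := by
  have h := (intervalIntegral.intervalIntegrable_rpow' (a := c) (b := d) ha)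
  rw [intervalIntegrable_iff] at h ⊢
  have := h.indicator (measurableSet_Ioi (a := (0 : ℝ)))
  refine this.congr (Eventually.of_forall fun x => ?_)
  simp [posPow, Set.indicator]

theorem memLp_fieldKernel (t : ℝ) {θ : ℝ} (hθ : θ ∈ Ioo (0 : ℝ) 1) :
    MemLp (fieldKernel t θ) 2 (volume : Measure ℝ) := by
  obtain ⟨h0, h1⟩ := hθ
  rw [memLp_two_iff_integrable_sq (measurable_fieldKernel t θ).aestronglyMeasurable]
  set R : ℝ := |t| + 1 with hR
  have htR : |t| = R - 1 := by linarith
  have ht := abs_nonneg t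
  have hle := le_abs_self t
  have hge := neg_abs_le t
  have hm : Measurable fun x => fieldKernel t θ x ^ 2 := (measurable_fieldKernel t θ).pow_const 2
  have hright : IntegrableOn (fun x => fieldKernel t θ x ^ 2) (Ioi R) := by
    refine integrableOn_zero.congr_fun (fun x hx => ?_) measurableSet_Ioi
    have hx : R < x := hx
    simp only [fieldKernel, posPow]
    rw [if_neg (by linarith), if_neg (by linarith)]
    simp
  have hmid : IntegrableOn (fun x => fieldKernel t θ x ^ 2) (Ioc (-R) R) := by
    have hi : ∀ s : ℝ, IntegrableOn (fun x => posPow (s - x) (2 * (θ - 1 / 2))) (Ioc (-R) R) := by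
      intro s
      have h := (intervalIntegrable_posPow (a := 2 * (θ - 1 / 2)) (by linarith)
        (s + R) (s - R)).comp_sub_left s
      simp only [sub_add_cancel_left, sub_sub_cancel] at h
      exact (intervalIntegrable_iff_integrableOn_Ioc_of_le (by linarith)).1 h
    refine (((hi t).const_mul 2).add ((hi 0).const_mul 2)).mono' hm.aestronglyMeasurable
      (Eventually.of_forall fun x => ?_)
    rw [Real.norm_of_nonneg (sq_nonneg _)]
    simp only [Pi.add_apply, ← posPow_sq, fieldKernel, zero_sub]
    nlinarith [sq_nonneg (posPow (t - x) (θ - 1 / 2) + posPow (-x) (θ - 1 / 2))]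
  have hleft : IntegrableOn (fun x => fieldKernel t θ x ^ 2) (Iic (-R)) := by
    have hg : IntegrableOn (fun x : ℝ => (-x - |t|) ^ (2 * (θ - 1 / 2 - 1))) (Iic (-R)) := by
      have h2 := integrableOn_Ioi_rpow_of_lt (a := 2 * (θ - 1 / 2 - 1)) (by linarith)
        (one_half_pos (α := ℝ))
      have h3 : Integrable ((Ioi (1 / 2 : ℝ)).indicator
          fun y : ℝ => y ^ (2 * (θ - 1 / 2 - 1))) := (integrable_indicator_iff measurableSet_Ioi).2 h2
      have h4 := (h3.comp_sub_left (-|t|)).integrableOn (s := Iic (-R))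
      refine h4.congr_fun (fun x hx => ?_) measurableSet_Iic
      have hx : x ≤ -R := hx
      simp only
      rw [Set.indicator_of_mem (by rw [mem_Ioi]; linarith)]
      congr 1
      ring
    refine (hg.const_mul ((|θ - 1 / 2| * |t|) ^ 2)).mono' hm.aestronglyMeasurable
      ((ae_restrict_iff' measurableSet_Iic).2 (Eventually.of_forall fun x hx => ?_))
    have hx : x ≤ -R := hx
    have hpos : 0 < -x - |t| := by linarith
    rw [Real.norm_of_nonneg (sq_nonneg _), ← sq_abs]
    have hmv := (convex_Ici (-x - |t|)).norm_image_sub_le_of_norm_hasDerivWithin_le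
      (f := fun y : ℝ => y ^ (θ - 1 / 2)) (f' := fun y => (θ - 1 / 2) * y ^ (θ - 1 / 2 - 1))
      (C := |θ - 1 / 2| * (-x - |t|) ^ (θ - 1 / 2 - 1)) (x := -x) (y := t - x)
      (fun y hy => by
        have hy : -x - |t| ≤ y := hy
        exact (Real.hasDerivAt_rpow_const (Or.inl (by linarith))).hasDerivWithinAt)
      (fun y hy => by
        have hy : -x - |t| ≤ y := hy
        rw [norm_mul, Real.norm_eq_abs, Real.norm_of_nonneg (Real.rpow_nonneg (by linarith) _)]
        exact mul_le_mul_of_nonneg_left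
          (Real.rpow_le_rpow_of_nonpos hpos hy (by linarith)) (abs_nonneg _))
      (by rw [mem_Ici]; linarith) (by rw [mem_Ici]; linarith)
    have hk : |fieldKernel t θ x| ≤ |θ - 1 / 2| * |t| * (-x - |t|) ^ (θ - 1 / 2 - 1) := by
      simp only [fieldKernel, posPow]
      rw [if_pos (by linarith), if_pos (by linarith)]
      simp only [Real.norm_eq_abs] at hmv
      rw [show t - x - -x = t by ring] at hmv
      linarith
    calc |fieldKernel t θ x| ^ 2
        ≤ (|θ - 1 / 2| * |t| * (-x - |t|) ^ (θ - 1 / 2 - 1)) ^ 2 :=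
          pow_le_pow_left₀ (abs_nonneg _) hk 2
      _ = _ := by
          rw [mul_pow, mul_comm 2 (θ - 1 / 2 - 1), Real.rpow_mul hpos.le]
          norm_cast
  have hall := (hleft.union hmid).union hright
  rw [Iic_union_Ioc_eq_Iic (by linarith), Iic_union_Ioi] at hall
  exact integrableOn_univ.1 hall

/-- The Gaussian field `B(t, θ) = ∫ ((t - x)₊ ^ (θ - 1/2) - (-x)₊ ^ (θ - 1/2)) dW(x)`, for
`0 < θ < 1`. -/
def fieldB {Ω : Type*} [MeasurableSpace Ω] {W : ℝ → Ω → ℝ} {P : Measure Ω}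
    (hW : IsBrownianOnLine W P) (t θ : ℝ) (hθ : θ ∈ Ioo (0 : ℝ) 1) : Ω → ℝ :=
  hW.wienerIntegral ((memLp_fieldKernel t hθ).toLp (fieldKernel t θ))

/-! ### Lemarié–Meyer wavelets and the wavelet series -/

/-- The function `x ↦ 2 ^ (j / 2) ψ (2 ^ j x - k)`. -/
def waveletFun (ψ : 𝓢(ℝ, ℝ)) (j k : ℤ) (x : ℝ) : ℝ :=
  (2 : ℝ) ^ ((j : ℝ) / 2) * ψ ((2 : ℝ) ^ j * x - k)

theorem memLp_waveletFun (ψ : 𝓢(ℝ, ℝ)) (j k : ℤ) :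
    MemLp (waveletFun ψ j k) 2 (volume : Measure ℝ) := by
  refine MemLp.const_mul ?_ _
  have hc : Continuous fun x : ℝ => ψ ((2 : ℝ) ^ j * x - k) := by fun_prop
  rw [memLp_two_iff_integrable_sq hc.aestronglyMeasurable]
  have h : Integrable (fun x => ψ x ^ 2) :=
    (memLp_two_iff_integrable_sq ψ.continuous.aestronglyMeasurable).1 (ψ.memLp 2)
  exact (h.comp_sub_right (k : ℝ)).comp_mul_left' (zpow_ne_zero j two_ne_zero)

/-- The function `x ↦ 2 ^ (j / 2) ψ (2 ^ j x - k)` as an element of `L²(ℝ)`. -/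
def waveletLp (ψ : 𝓢(ℝ, ℝ)) (jk : ℤ × ℤ) : Lp ℝ 2 (volume : Measure ℝ) :=
  (memLp_waveletFun ψ jk.1 jk.2).toLp (waveletFun ψ jk.1 jk.2)

/-- A real-valued Lemarié–Meyer mother wavelet: a function `ψ` of the Schwartz class whose Fourier
transform `ξ ↦ ∫ e ^ (-iξx) ψ(x) dx` vanishes outside `2π/3 ≤ |ξ| ≤ 8π/3` and such that the
functions `2 ^ (j / 2) ψ (2 ^ j · - k)`, `j, k ∈ ℤ`, form an orthonormal basis of `L²(ℝ)`. -/
structure IsLemarieMeyerWavelet (ψ : 𝓢(ℝ, ℝ)) : Prop where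
  fourier_support : ∀ ξ : ℝ,
    ∫ x : ℝ, Complex.exp (-(Complex.I * (ξ : ℂ) * (x : ℂ))) * ((ψ x : ℝ) : ℂ) ≠ 0 →
      2 * Real.pi / 3 ≤ |ξ| ∧ |ξ| ≤ 8 * Real.pi / 3
  orthonormal : Orthonormal ℝ (waveletLp ψ)
  complete : (Submodule.span ℝ (Set.range (waveletLp ψ))).topologicalClosure = ⊤

/-- `Ψ(y, θ) = ∫ (y - x)₊ ^ (θ - 1/2) ψ(x) dx`. -/
def fractionalPrimitive (ψ : 𝓢(ℝ, ℝ)) (y θ : ℝ) : ℝ :=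
  ∫ x : ℝ, posPow (y - x) (θ - 1 / 2) * ψ x

/-- The Gaussian random variable `ε_{j,k} = 2 ^ (j / 2) ∫ ψ(2 ^ j x - k) dW(x)`. -/
def waveletCoeff {Ω : Type*} [MeasurableSpace Ω] {W : ℝ → Ω → ℝ} {P : Measure Ω}
    (hW : IsBrownianOnLine W P) (ψ : 𝓢(ℝ, ℝ)) (jk : ℤ × ℤ) : Ω → ℝ :=
  hW.wienerIntegral (waveletLp ψ jk)

/-- The `(j, k)` term `2 ^ (-jθ) ε_{j,k}(ω) (Ψ(2 ^ j t - k, θ) - Ψ(-k, θ))` of the wavelet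
series. -/
def waveletTerm {Ω : Type*} [MeasurableSpace Ω] {W : ℝ → Ω → ℝ} {P : Measure Ω}
    (hW : IsBrownianOnLine W P) (ψ : 𝓢(ℝ, ℝ)) (t θ : ℝ) (ω : Ω) (jk : ℤ × ℤ) : ℝ :=
  (2 : ℝ) ^ (-(jk.1 : ℝ) * θ) * waveletCoeff hW ψ jk ω *
    (fractionalPrimitive ψ ((2 : ℝ) ^ jk.1 * t - jk.2) θ - fractionalPrimitive ψ (-jk.2) θ)

end

noncomputable section

/-! ### The Meyer window in frequency -/

/-! The Wiener integral is an isometry, so expanding the kernel of `B(t, θ)` in the wavelet basis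
gives the series in `L²(Ω)`; a change of variables identifies its coefficients
(`inner_waveletLp_fieldKernel`). The rest is deterministic, given two almost sure properties of the
i.i.d. standard Gaussian `ε_{j,k}`. They involve neither `t` nor `θ`, which is why a single event
serves all points.

Upper bounds. By `ae_growth`, the coefficients grow more slowly than any positive power of
`2^|j|(1+|k|)`. The Fourier transform of `ψ` vanishes near 0, so `ψ` has Schwartz antiderivatives of
every order; repeated integration by parts then makes `Ψ(y, z)` decay rapidly in `y`, uniformly for
complex `z` in a strip around `(0, 1)`, where it is holomorphic. The series therefore converges
absolutely to a function holomorphic in `z`, whose increments in time are controlled by `|t-s|^(Re z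
- 3δ) + |t-s|` (`exists_waveletSeries_sub_bound`). Cauchy's estimates carry this modulus to all
`θ`-derivatives at the cost of an arbitrarily small exponent.

Irregularity. A complementary fractional integral of `ψ''`, the function `dualPrimitive`, has zero
mean and is biorthogonal to the rescaled functions `Ψ`. Testing the increments from `s` against it
at scale `2^(-j)` recovers `2^(-jθ) ε_{j,k}`. An increment of order `|h|^γ` at `s` with `γ > θ`
would thus force `|ε_{j,k}| ≤ C 2^(j(θ-γ)) (1+|k-2^j s|)^3`. But by Borel–Cantelli
(`ae_exists_one_le`), every window of `Lj` consecutive `k` near `2^j s` contains a coefficient of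
modulus at least 1, for all large `j` and all `s` at once.

The Meyer wavelet has spectrum `e^(iπw) b(w)` for a smooth window `b`. Orthonormality and
completeness both follow by folding frequency integrals onto one period and using sine–cosine
relations between the values of `b`. -/

theorem smoothTransition_one_sub (x : ℝ) :
    Real.smoothTransition (1 - x) = 1 - Real.smoothTransition x := by
  have h := Real.smoothTransition.pos_denom x
  have h' : expNegInvGlue (1 - x) + expNegInvGlue x ≠ 0 := by rw [add_comm]; exact h.ne'
  simp only [Real.smoothTransition, sub_sub_cancel]
  rw [eq_sub_iff_add_eq, add_comm (expNegInvGlue (1 - x)), ← add_div, add_comm]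
  exact div_self h.ne'

/-- The modulus of the Fourier transform of the Meyer wavelet. -/
def meyerWindow (w : ℝ) : ℝ :=
  Real.sin (Real.pi / 2 * (Real.smoothTransition (3 * w - 1) + Real.smoothTransition (-3 * w - 1)))
  * Real.cos (Real.pi / 2 *
    (Real.smoothTransition (3 * w / 2 - 1) + Real.smoothTransition (-3 * w / 2 - 1)))

theorem contDiff_meyerWindow : ContDiff ℝ (⊤ : ℕ∞) meyerWindow := by
  have h : ContDiff ℝ (⊤ : ℕ∞) Real.smoothTransition := Real.smoothTransition.contDiff
  unfold meyerWindow
  refine ContDiff.mul (Real.contDiff_sin.comp (contDiff_const.mul ((h.comp ?_).add (h.comp ?_))))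
    (Real.contDiff_cos.comp (contDiff_const.mul ((h.comp ?_).add (h.comp ?_)))) <;> fun_prop

theorem meyerWindow_neg (w : ℝ) : meyerWindow (-w) = meyerWindow w := by
  unfold meyerWindow
  rw [add_comm, show 3 * -w - 1 = -3 * w - 1 by ring, show -3 * -w - 1 = 3 * w - 1 by ring,
    add_comm (Real.smoothTransition (3 * -w / 2 - 1)),
    show 3 * -w / 2 - 1 = -3 * w / 2 - 1 by ring, show -3 * -w / 2 - 1 = 3 * w / 2 - 1 by ring]

theorem meyerWindow_of_nonneg {w : ℝ} (hw : 0 ≤ w) :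
    meyerWindow w = Real.sin (Real.pi / 2 * Real.smoothTransition (3 * w - 1)) *
      Real.cos (Real.pi / 2 * Real.smoothTransition (3 * w / 2 - 1)) := by
  unfold meyerWindow
  rw [Real.smoothTransition.zero_of_nonpos (x := -3 * w - 1) (by linarith),
    Real.smoothTransition.zero_of_nonpos (x := -3 * w / 2 - 1) (by linarith), add_zero, add_zero]

theorem meyerWindow_abs (w : ℝ) : meyerWindow |w| = meyerWindow w := by
  rcases abs_choice w with h | h <;> rw [h]
  exact meyerWindow_neg w

theorem meyerWindow_eq_zero_of_abs_le {w : ℝ} (hw : |w| ≤ 1 / 3) : meyerWindow w = 0 := by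
  rw [← meyerWindow_abs, meyerWindow_of_nonneg (abs_nonneg w),
    Real.smoothTransition.zero_of_nonpos (x := 3 * |w| - 1) (by linarith)]
  simp

theorem meyerWindow_eq_zero_of_le_abs {w : ℝ} (hw : 4 / 3 ≤ |w|) : meyerWindow w = 0 := by
  rw [← meyerWindow_abs, meyerWindow_of_nonneg (abs_nonneg w),
    Real.smoothTransition.one_of_one_le (x := 3 * |w| / 2 - 1) (by linarith)]
  simp

/-- One angle governs all four values, because `smoothTransition (1 - x) = 1 - smoothTransition x`
exchanges sine and cosine. Together with the vanishing of the window outside `1/3 < |w| < 4/3`,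
these relations are all that orthonormality and completeness need to know about it. -/
theorem meyerWindow_of_mem {u : ℝ} (hu : u ∈ Icc (1 / 3 : ℝ) (2 / 3)) :
    meyerWindow u = Real.sin (Real.pi / 2 * Real.smoothTransition (3 * u - 1)) ∧
    meyerWindow (u - 1) = Real.cos (Real.pi / 2 * Real.smoothTransition (3 * u - 1)) ∧
    meyerWindow (2 * u) = Real.cos (Real.pi / 2 * Real.smoothTransition (3 * u - 1)) ∧
    meyerWindow (2 * u - 2) = Real.sin (Real.pi / 2 * Real.smoothTransition (3 * u - 1)) := by
  obtain ⟨h1, h2⟩ := hu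
  have e1 : Real.pi / 2 * (1 - Real.smoothTransition (3 * u - 1)) =
    Real.pi / 2 - Real.pi / 2 * Real.smoothTransition (3 * u - 1) := by ring
  refine ⟨?_, ?_, ?_, ?_⟩
  · rw [meyerWindow_of_nonneg (by linarith),
      Real.smoothTransition.zero_of_nonpos (x := 3 * u / 2 - 1) (by linarith)]
    simp
  · rw [← meyerWindow_neg, meyerWindow_of_nonneg (by linarith),
      Real.smoothTransition.zero_of_nonpos (x := 3 * -(u - 1) / 2 - 1) (by linarith),
      show 3 * -(u - 1) - 1 = 1 - (3 * u - 1) by ring, smoothTransition_one_sub, e1,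
      Real.sin_pi_div_two_sub]
    simp
  · rw [meyerWindow_of_nonneg (by linarith),
      Real.smoothTransition.one_of_one_le (x := 3 * (2 * u) - 1) (by linarith),
      show 3 * (2 * u) / 2 - 1 = 3 * u - 1 by ring]
    simp
  · rw [← meyerWindow_neg, meyerWindow_of_nonneg (by linarith),
      Real.smoothTransition.one_of_one_le (x := 3 * -(2 * u - 2) - 1) (by linarith),
      show 3 * -(2 * u - 2) / 2 - 1 = 1 - (3 * u - 1) by ring, smoothTransition_one_sub, e1,
      Real.cos_pi_div_two_sub]
    simp

/-- The function `e^{iπw} b(w) / (2πiw)^m`, where `b` is the Meyer window. -/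
def meyerSpectrumFun (m : ℕ) (w : ℝ) : ℂ :=
  Complex.exp (Complex.I * Real.pi * w) * (meyerWindow w : ℂ) *
    ((2 * Real.pi * Complex.I * w) ^ m)⁻¹

theorem meyerSpectrumFun_of_abs_le (m : ℕ) {w : ℝ} (hw : |w| ≤ 1 / 3) :
    meyerSpectrumFun m w = 0 := by
  simp [meyerSpectrumFun, meyerWindow_eq_zero_of_abs_le hw]

theorem meyerSpectrumFun_of_le_abs (m : ℕ) {w : ℝ} (hw : 4 / 3 ≤ |w|) :
    meyerSpectrumFun m w = 0 := by
  simp [meyerSpectrumFun, meyerWindow_eq_zero_of_le_abs hw]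

/-- The window is identically zero near the origin, so dividing it by any power of `w` creates no
singularity. This is the source of the antiderivatives of all orders. -/
theorem contDiff_meyerSpectrumFun (m : ℕ) : ContDiff ℝ (⊤ : ℕ∞) (meyerSpectrumFun m) := by
  rw [contDiff_iff_contDiffAt]
  intro w
  by_cases hw : w = 0
  · subst hw
    refine ContDiffAt.congr_of_eventuallyEq (contDiffAt_const (c := (0 : ℂ))) ?_
    filter_upwards [Metric.ball_mem_nhds (0 : ℝ) (by norm_num : (0 : ℝ) < 1 / 3)] with x hx
    refine meyerSpectrumFun_of_abs_le m ?_
    rw [Metric.mem_ball, dist_zero_right, Real.norm_eq_abs] at hx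
    exact hx.le
  · have hb : ContDiff ℝ (⊤ : ℕ∞) fun w => (meyerWindow w : ℂ) :=
      Complex.ofRealCLM.contDiff.comp contDiff_meyerWindow
    have hr : ContDiff ℝ (⊤ : ℕ∞) fun w : ℝ => (w : ℂ) := Complex.ofRealCLM.contDiff
    unfold meyerSpectrumFun
    refine ContDiffAt.mul (ContDiffAt.mul ?_ hb.contDiffAt) (ContDiffAt.inv ?_ ?_)
    · exact (contDiff_const.mul hr).cexp.contDiffAt
    · exact ((contDiff_const.mul hr).pow m).contDiffAt
    · refine pow_ne_zero _ ?_
      simp [hw, Real.pi_ne_zero]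

theorem hasCompactSupport_meyerSpectrumFun (m : ℕ) : HasCompactSupport (meyerSpectrumFun m) := by
  refine HasCompactSupport.of_support_subset_isCompact (isCompact_Icc (a := (-2 : ℝ)) (b := 2)) ?_
  intro w hw
  by_contra h
  refine hw (meyerSpectrumFun_of_le_abs m ?_)
  rw [mem_Icc, ← abs_le] at h
  linarith

/-- `meyerSpectrumFun` as a Schwartz function. -/
def meyerSpectrum (m : ℕ) : 𝓢(ℝ, ℂ) :=
  (hasCompactSupport_meyerSpectrumFun m).toSchwartzMap (contDiff_meyerSpectrumFun m)

theorem meyerSpectrum_apply (m : ℕ) (w : ℝ) : meyerSpectrum m w = meyerSpectrumFun m w := rfl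

/-- Hermitian symmetry: the inverse Fourier transform is real, so taking real parts in
`meyerPrimitive` loses nothing. -/
theorem meyerSpectrumFun_neg (m : ℕ) (w : ℝ) :
    meyerSpectrumFun m (-w) = (starRingEnd ℂ) (meyerSpectrumFun m w) := by
  simp only [meyerSpectrumFun, meyerWindow_neg, map_mul, map_inv₀, map_pow, Complex.conj_ofReal,
    Complex.conj_I, ← Complex.exp_conj, map_ofNat]
  push_cast
  rw [show Complex.I * Real.pi * -(w : ℂ) = -Complex.I * Real.pi * w by ring,
    show 2 * Real.pi * Complex.I * -(w : ℂ) = 2 * Real.pi * -Complex.I * w by ring]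

theorem meyerSpectrumFun_succ (m : ℕ) (w : ℝ) :
    2 * Real.pi * Complex.I * (w * meyerSpectrumFun (m + 1) w) = meyerSpectrumFun m w := by
  by_cases hw : w = 0
  · subst hw
    rw [meyerSpectrumFun_of_abs_le m (by simp)]
    simp
  · have h : (2 * Real.pi * Complex.I * w : ℂ) ≠ 0 := by simp [hw, Real.pi_ne_zero]
    unfold meyerSpectrumFun
    rw [pow_succ, mul_inv]
    calc _ = Complex.exp (Complex.I * Real.pi * w) * (meyerWindow w : ℂ) *
        ((2 * Real.pi * Complex.I * w) ^ m)⁻¹ *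
        ((2 * Real.pi * Complex.I * w) * (2 * Real.pi * Complex.I * w)⁻¹) := by ring
      _ = _ := by rw [mul_inv_cancel₀ h, mul_one]

open scoped FourierTransform in
/-- The `m`-th iterated antiderivative of the Meyer wavelet. -/
def meyerPrimitive (m : ℕ) : 𝓢(ℝ, ℝ) :=
  SchwartzMap.postcompCLM Complex.reCLM (𝓕⁻ (meyerSpectrum m))

open scoped FourierTransform in
theorem ofReal_meyerPrimitive (m : ℕ) (x : ℝ) :
    (meyerPrimitive m x : ℂ) = 𝓕⁻ (meyerSpectrum m) x := by
  rw [meyerPrimitive, SchwartzMap.postcompCLM_apply]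
  refine Complex.conj_eq_iff_re.1 ?_
  rw [SchwartzMap.fourierInv_coe, Real.fourierInv_eq', ← integral_conj, ← integral_neg_eq_self]
  refine integral_congr_ae (Eventually.of_forall fun w => ?_)
  simp only [smul_eq_mul, map_mul, meyerSpectrum_apply]
  rw [meyerSpectrumFun_neg, Complex.conj_conj, ← Complex.exp_conj]
  congr 2
  simp [Complex.conj_ofNat]

-- Differentiation is multiplication by `2πiw` on the Fourier side, which by `meyerSpectrumFun_succ`
-- cancels one factor of the denominator.
open scoped FourierTransform in
theorem deriv_meyerPrimitive (m : ℕ) :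
    SchwartzMap.derivCLM ℝ ℝ (meyerPrimitive (m + 1)) = meyerPrimitive m := by
  ext x
  have h1 := (meyerPrimitive (m + 1)).hasDerivAt x
  have h2 := h1.ofReal_comp
  have h3 := (𝓕⁻ (meyerSpectrum (m + 1))).hasDerivAt x
  have h4 : (fun y => ((meyerPrimitive (m + 1) y : ℝ) : ℂ)) = 𝓕⁻ (meyerSpectrum (m + 1)) :=
    funext fun y => ofReal_meyerPrimitive (m + 1) y
  rw [h4] at h2
  have h5 := h2.unique h3
  have h6 := congrArg (fun f : 𝓢(ℝ, ℂ) => f x)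
    (SchwartzMap.lineDerivOp_fourierInv_eq (meyerSpectrum (m + 1)) (1 : ℝ))
  have h7 : (2 * (Real.pi : ℂ) * Complex.I) •
      (SchwartzMap.smulLeftCLM ℂ fun x : ℝ => inner ℝ x 1) (meyerSpectrum (m + 1)) =
      meyerSpectrum m := by
    ext w
    rw [smul_apply, SchwartzMap.smulLeftCLM_apply_apply (by fun_prop),
      meyerSpectrum_apply, meyerSpectrum_apply, ← meyerSpectrumFun_succ m]
    simp
  rw [h7, SchwartzMap.lineDerivOp_apply_eq_fderiv, fderiv_apply_one_eq_deriv, ← h5,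
    ← ofReal_meyerPrimitive] at h6
  exact Complex.ofReal_injective h6
  

/-! ### The Meyer wavelet basis -/

open scoped FourierTransform in
theorem fourier_meyerPrimitive (m : ℕ) (ξ : ℝ) :
    ∫ x : ℝ, Complex.exp (-(Complex.I * (ξ : ℂ) * (x : ℂ))) * ((meyerPrimitive m x : ℝ) : ℂ) =
      meyerSpectrumFun m (ξ / (2 * Real.pi)) := by
  have h : 𝓕 (𝓕⁻ (meyerSpectrum m)) = meyerSpectrum m := FourierTransform.fourier_fourierInv_eq _
  have h1 := congrArg (fun f : 𝓢(ℝ, ℂ) => f (ξ / (2 * Real.pi))) h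
  simp only [meyerSpectrum_apply] at h1
  rw [← h1, SchwartzMap.fourier_coe, Real.fourier_eq']
  refine integral_congr_ae (Eventually.of_forall fun x => ?_)
  simp only [smul_eq_mul]
  rw [ofReal_meyerPrimitive]
  congr 2
  have : (Real.pi : ℂ) ≠ 0 := by simp [Real.pi_ne_zero]
  simp
  field_simp

/-- The Fourier transform of `2 ^ (j / 2) ψ (2 ^ j · - k)`. -/
def dilatedSpectrumFun (j k : ℤ) (w : ℝ) : ℂ :=
  ((2 : ℝ) ^ (-(j : ℝ) / 2) : ℝ) *
    (Complex.exp (-(2 * Real.pi * Complex.I * k * ((2 : ℝ) ^ (-j) * w : ℝ))) *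
      meyerSpectrumFun 0 ((2 : ℝ) ^ (-j) * w))

theorem contDiff_dilatedSpectrumFun (j k : ℤ) :
    ContDiff ℝ (⊤ : ℕ∞) (dilatedSpectrumFun j k) := by
  have hl : ContDiff ℝ (⊤ : ℕ∞) fun w : ℝ => (2 : ℝ) ^ (-j) * w := by fun_prop
  have hr : ContDiff ℝ (⊤ : ℕ∞) fun w : ℝ => ((2 : ℝ) ^ (-j) * w : ℝ) :=
    contDiff_const.mul contDiff_id
  have hr' : ContDiff ℝ (⊤ : ℕ∞) fun w : ℝ => (((2 : ℝ) ^ (-j) * w : ℝ) : ℂ) :=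
    Complex.ofRealCLM.contDiff.comp hr
  exact contDiff_const.mul ((contDiff_const.mul hr').neg.cexp.mul
    ((contDiff_meyerSpectrumFun 0).comp hl))

theorem hasCompactSupport_dilatedSpectrumFun (j k : ℤ) :
    HasCompactSupport (dilatedSpectrumFun j k) := by
  refine HasCompactSupport.of_support_subset_isCompact
    (isCompact_Icc (a := -((2 : ℝ) ^ j * 2)) (b := (2 : ℝ) ^ j * 2)) ?_
  intro w hw
  by_contra h
  refine hw ?_
  have h2 : (0 : ℝ) < 2 ^ j := by positivity
  rw [mem_Icc, ← abs_le, not_le] at h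
  rw [dilatedSpectrumFun, meyerSpectrumFun_of_le_abs 0, mul_zero, mul_zero]
  rw [abs_mul, zpow_neg, abs_inv, abs_of_pos h2, inv_mul_eq_div, le_div_iff₀ h2]
  linarith

/-- `dilatedSpectrumFun` as a Schwartz function. -/
def dilatedSpectrum (j k : ℤ) : 𝓢(ℝ, ℂ) :=
  (hasCompactSupport_dilatedSpectrumFun j k).toSchwartzMap (contDiff_dilatedSpectrumFun j k)

theorem dilatedSpectrum_apply (j k : ℤ) (w : ℝ) :
    dilatedSpectrum j k w = dilatedSpectrumFun j k w := rfl

open scoped FourierTransform in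
theorem ofReal_waveletFun_meyerPrimitive (j k : ℤ) (x : ℝ) :
    (waveletFun (meyerPrimitive 0) j k x : ℂ) = 𝓕⁻ (dilatedSpectrum j k) x := by
  have h2 : (0 : ℝ) < 2 ^ j := by positivity
  rw [waveletFun, SchwartzMap.fourierInv_coe, Real.fourierInv_eq', Complex.ofReal_mul]
  have h3 := Measure.integral_comp_mul_left (fun u : ℝ =>
    Complex.exp (((2 * Real.pi * inner ℝ ((2 : ℝ) ^ j * u) x : ℝ) : ℂ) * Complex.I) •
      dilatedSpectrum j k ((2 : ℝ) ^ j * u)) ((2 : ℝ) ^ (-j))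
  have h4 : ∀ w : ℝ, (2 : ℝ) ^ j * ((2 : ℝ) ^ (-j) * w) = w := fun w => by
    rw [← mul_assoc, zpow_neg, mul_inv_cancel₀ h2.ne', one_mul]
  have h4' : ∀ w : ℝ, (2 : ℝ) ^ (-j) * ((2 : ℝ) ^ j * w) = w := fun w => by
    rw [← mul_assoc, zpow_neg, inv_mul_cancel₀ h2.ne', one_mul]
  simp only [h4] at h3
  rw [h3, zpow_neg, inv_inv, abs_of_pos h2, ofReal_meyerPrimitive, SchwartzMap.fourierInv_coe,
    Real.fourierInv_eq', ← integral_const_mul, ← integral_smul]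
  refine integral_congr_ae (Eventually.of_forall fun u => ?_)
  have h5 : (2 : ℝ) ^ ((j : ℝ) / 2) = 2 ^ j * (2 : ℝ) ^ (-(j : ℝ) / 2) := by
    rw [← Real.rpow_intCast, ← Real.rpow_add two_pos]
    congr 1
    ring
  simp only [smul_eq_mul, meyerSpectrum_apply, dilatedSpectrum_apply, dilatedSpectrumFun, h4',
    Complex.real_smul]
  rw [h5]
  have h6 : Complex.exp (((2 * Real.pi * inner ℝ u ((2 : ℝ) ^ j * x - k) : ℝ) : ℂ) * Complex.I) =
      Complex.exp (((2 * Real.pi * inner ℝ ((2 : ℝ) ^ j * u) x : ℝ) : ℂ) * Complex.I) *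
        Complex.exp (-(2 * Real.pi * Complex.I * k * (u : ℝ))) := by
    rw [← Complex.exp_add]
    congr 1
    simp
    ring
  rw [h6]
  push_cast
  ring

/-- The support lies in `[-5/3, 4/3]`, which is the period `[1/3, 4/3]` followed by its translates
by `-1` and `-2`. Folding onto one period turns integrals against `e^(2πinu)` into Fourier
coefficients. -/
theorem integral_eq_intervalIntegral_of_support {q : ℝ → ℂ} (hq : Integrable q)
    (h0 : ∀ u, 4 / 3 ≤ |u| → q u = 0) :
    ∫ u, q u = ∫ u in (1 / 3 : ℝ)..(4 / 3), (q u + q (u - 1) + q (u - 2)) := by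
  have hi : ∀ a b : ℝ, IntervalIntegrable q volume a b := fun a b => hq.intervalIntegrable
  have h1 : ∀ c : ℝ, IntervalIntegrable (fun u => q (u - c)) volume (1 / 3) (4 / 3) := fun c =>
    (hq.comp_sub_right c).intervalIntegrable
  have e0 : ∫ u, q u = ∫ u in (-5 / 3 : ℝ)..(4 / 3), q u := by
    rw [intervalIntegral.integral_of_le (by norm_num), setIntegral_eq_integral_of_forall_compl_eq_zero]
    intro u hu
    refine h0 u ?_
    rw [mem_Ioc, not_and_or, not_lt, not_le] at hu
    rcases hu with hu | hu
    · rw [abs_of_nonpos (by linarith)]; linarith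
    · rw [abs_of_pos (by linarith)]; linarith
  have hi12 : IntervalIntegrable (fun u => q u + q (u - 1)) volume (1 / 3) (4 / 3) :=
    (hi _ _).add (h1 1)
  rw [e0, intervalIntegral.integral_add hi12 (h1 2), intervalIntegral.integral_add (hi _ _) (h1 1),
    intervalIntegral.integral_comp_sub_right, intervalIntegral.integral_comp_sub_right]
  norm_num
  rw [← intervalIntegral.integral_add_adjacent_intervals (hi (-(5 / 3)) (-(2 / 3))) (hi _ _),
    ← intervalIntegral.integral_add_adjacent_intervals (hi (-(2 / 3)) (1 / 3)) (hi _ _)]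
  ring

theorem meyerSpectrumFun_zero_eq (w : ℝ) :
    meyerSpectrumFun 0 w = Complex.exp (Complex.I * Real.pi * w) * (meyerWindow w : ℂ) := by
  simp [meyerSpectrumFun]

theorem exp_two_pi_int_mul_sub (n : ℤ) (m : ℕ) (u : ℝ) :
    Complex.exp (2 * Real.pi * Complex.I * n * ((u - m : ℝ) : ℂ)) =
      Complex.exp (2 * Real.pi * Complex.I * n * u) := by
  rw [Complex.exp_eq_exp_iff_exists_int]
  refine ⟨-(n * m), ?_⟩
  push_cast
  ring

theorem normSq_meyerSpectrumFun (w : ℝ) :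
    (starRingEnd ℂ) (meyerSpectrumFun 0 w) * meyerSpectrumFun 0 w = (meyerWindow w ^ 2 : ℝ) := by
  rw [← Complex.normSq_eq_conj_mul_self, Complex.normSq_eq_norm_sq, meyerSpectrumFun_zero_eq,
    norm_mul, mul_comm Complex.I, mul_assoc, mul_comm Complex.I, ← mul_assoc, ← Complex.ofReal_mul,
    Complex.norm_exp_ofReal_mul_I, one_mul, Complex.norm_real, Real.norm_eq_abs, sq_abs]

/-- At most two terms survive, and they are a sine and a cosine of one angle: for `u ≤ 2/3` the
terms at `u` and `u - 1`; for `u ≥ 2/3` those at `u` and `u - 2`, via the doubled relations at `u /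
2`. -/
theorem meyerWindow_sq_sum {u : ℝ} (hu : u ∈ Icc (1 / 3 : ℝ) (4 / 3)) :
    meyerWindow u ^ 2 + meyerWindow (u - 1) ^ 2 + meyerWindow (u - 2) ^ 2 = 1 := by
  rcases le_total u (2 / 3) with h | h
  · obtain ⟨h1, h2, -, -⟩ := meyerWindow_of_mem ⟨hu.1, h⟩
    rw [h1, h2, meyerWindow_eq_zero_of_le_abs (w := u - 2)
      (by rw [abs_of_nonpos (by linarith)]; linarith)]
    simp
  · obtain ⟨-, -, h1, h2⟩ := meyerWindow_of_mem (u := u / 2) ⟨by linarith, by linarith [hu.2]⟩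
    rw [show 2 * (u / 2) = u by ring] at h1 h2
    rw [h1, h2, meyerWindow_eq_zero_of_abs_le (w := u - 1)
      (by rw [abs_le]; exact ⟨by linarith, by linarith [hu.2]⟩)]
    simp

theorem continuous_meyerSpectrumFun (m : ℕ) : Continuous (meyerSpectrumFun m) :=
  (contDiff_meyerSpectrumFun m).continuous

theorem integral_same_scale (n : ℤ) :
    ∫ u : ℝ, (starRingEnd ℂ) (meyerSpectrumFun 0 u) * meyerSpectrumFun 0 u *
      Complex.exp (2 * Real.pi * Complex.I * n * u) = if n = 0 then 1 else 0 := by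
  rw [integral_eq_intervalIntegral_of_support]
  · have e : ∫ u in (1 / 3 : ℝ)..(4 / 3),
        ((starRingEnd ℂ) (meyerSpectrumFun 0 u) * meyerSpectrumFun 0 u *
          Complex.exp (2 * Real.pi * Complex.I * n * u) +
        (starRingEnd ℂ) (meyerSpectrumFun 0 (u - 1)) * meyerSpectrumFun 0 (u - 1) *
          Complex.exp (2 * Real.pi * Complex.I * n * ((u - 1 : ℝ) : ℂ)) +
        (starRingEnd ℂ) (meyerSpectrumFun 0 (u - 2)) * meyerSpectrumFun 0 (u - 2) *
          Complex.exp (2 * Real.pi * Complex.I * n * ((u - 2 : ℝ) : ℂ))) =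
        ∫ u in (1 / 3 : ℝ)..(4 / 3), Complex.exp ((2 * Real.pi * Complex.I * n) * u) := by
      refine intervalIntegral.integral_congr fun u hu => ?_
      rw [uIcc_of_le (by norm_num)] at hu
      have h1 := exp_two_pi_int_mul_sub n 1 u
      have h2 := exp_two_pi_int_mul_sub n 2 u
      rw [Nat.cast_one] at h1
      rw [Nat.cast_ofNat] at h2
      rw [h1, h2, normSq_meyerSpectrumFun, normSq_meyerSpectrumFun, normSq_meyerSpectrumFun,
        ← add_mul, ← add_mul, ← Complex.ofReal_add, ← Complex.ofReal_add, meyerWindow_sq_sum hu]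
      simp
    rw [e]
    split_ifs with hn
    · subst hn
      simp
      norm_num
    · rw [integral_exp_mul_complex (by simp [hn, Real.pi_ne_zero])]
      have h1 := exp_two_pi_int_mul_sub n 1 (4 / 3)
      rw [← h1]
      norm_num
  · refine Continuous.integrable_of_hasCompactSupport ?_ ?_
    · have := continuous_meyerSpectrumFun 0
      have h2 : Continuous fun u => (starRingEnd ℂ) (meyerSpectrumFun 0 u) :=
        Complex.continuous_conj.comp this
      fun_prop
    · exact ((hasCompactSupport_meyerSpectrumFun 0).mul_left).mul_right
  · intro u hu
    rw [meyerSpectrumFun_of_le_abs 0 hu]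
    simp

/-- After folding, for `u ≤ 2/3` the contributions of `u` and `u - 1` carry the same product of a
sine and a cosine, while the phase `e^(iπw)` changes sign under `w ↦ w - 1` and is unchanged under
`w ↦ w - 2`; they cancel. For `u ≥ 2/3` the supports do not meet. This sign is the purpose of the
phase in the spectrum. -/
theorem integral_adjacent_scale (n : ℤ) :
    ∫ u : ℝ, (starRingEnd ℂ) (meyerSpectrumFun 0 (2 * u)) * meyerSpectrumFun 0 u *
      Complex.exp (2 * Real.pi * Complex.I * n * u) = 0 := by
  rw [integral_eq_intervalIntegral_of_support]
  · have e : ∀ u ∈ uIcc (1 / 3 : ℝ) (4 / 3),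
        ((starRingEnd ℂ) (meyerSpectrumFun 0 (2 * u)) * meyerSpectrumFun 0 u *
          Complex.exp (2 * Real.pi * Complex.I * n * u) +
        (starRingEnd ℂ) (meyerSpectrumFun 0 (2 * (u - 1))) * meyerSpectrumFun 0 (u - 1) *
          Complex.exp (2 * Real.pi * Complex.I * n * ((u - 1 : ℝ) : ℂ)) +
        (starRingEnd ℂ) (meyerSpectrumFun 0 (2 * (u - 2))) * meyerSpectrumFun 0 (u - 2) *
          Complex.exp (2 * Real.pi * Complex.I * n * ((u - 2 : ℝ) : ℂ))) = 0 := by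
      intro u hu
      rw [uIcc_of_le (by norm_num)] at hu
      obtain ⟨hu1, hu2⟩ := hu
      rw [meyerSpectrumFun_of_le_abs 0 (w := 2 * (u - 2))
        (by rw [abs_of_nonpos (by linarith)]; linarith)]
      rcases le_total u (2 / 3) with h | h
      · obtain ⟨h1, h2, h3, h4⟩ := meyerWindow_of_mem ⟨hu1, h⟩
        have h5 := exp_two_pi_int_mul_sub n 1 u
        rw [Nat.cast_one] at h5
        rw [h5, show 2 * (u - 1) = 2 * u - 2 by ring]
        simp only [meyerSpectrumFun_zero_eq, map_mul, ← Complex.exp_conj, Complex.conj_I,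
          Complex.conj_ofReal, h1, h2, h3, h4, map_zero, zero_mul, add_zero]
        have h6 : Complex.exp (-Complex.I * Real.pi * ((2 * u - 2 : ℝ) : ℂ)) *
            Complex.exp (Complex.I * Real.pi * ((u - 1 : ℝ) : ℂ)) =
            -(Complex.exp (-Complex.I * Real.pi * ((2 * u : ℝ) : ℂ)) *
              Complex.exp (Complex.I * Real.pi * u)) := by
          rw [← Complex.exp_add, ← Complex.exp_add, ← Complex.exp_add_pi_mul_I]
          congr 1
          push_cast
          ring
        linear_combination (Real.cos (Real.pi / 2 * Real.smoothTransition (3 * u - 1)) : ℂ) *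
          (Real.sin (Real.pi / 2 * Real.smoothTransition (3 * u - 1)) : ℂ) *
          Complex.exp (2 * Real.pi * Complex.I * n * u) * h6
      · rw [meyerSpectrumFun_of_le_abs 0 (w := 2 * u) (by rw [abs_of_nonneg (by linarith)]; linarith),
          meyerSpectrumFun_of_abs_le 0 (w := u - 1)
            (by rw [abs_le]; exact ⟨by linarith, by linarith⟩)]
        simp
    rw [intervalIntegral.integral_congr e]
    simp
  · refine Continuous.integrable_of_hasCompactSupport ?_ ?_
    · have := continuous_meyerSpectrumFun 0
      have h2 : Continuous fun u => (starRingEnd ℂ) (meyerSpectrumFun 0 (2 * u)) :=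
        Complex.continuous_conj.comp (by fun_prop)
      fun_prop
    · exact ((hasCompactSupport_meyerSpectrumFun 0).mul_left).mul_right
  · intro u hu
    rw [meyerSpectrumFun_of_le_abs 0 hu]
    simp

open scoped FourierTransform in
theorem ofReal_inner_waveletLp (p q : ℤ × ℤ) :
    ((inner ℝ (waveletLp (meyerPrimitive 0) p) (waveletLp (meyerPrimitive 0) q) : ℝ) : ℂ) =
      ∫ w : ℝ, (starRingEnd ℂ) (dilatedSpectrumFun p.1 p.2 w) * dilatedSpectrumFun q.1 q.2 w := by
  have h1 := SchwartzMap.integral_inner_fourier_fourier (𝓕⁻ (dilatedSpectrum p.1 p.2))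
    (𝓕⁻ (dilatedSpectrum q.1 q.2))
  rw [FourierTransform.fourier_fourierInv_eq, FourierTransform.fourier_fourierInv_eq] at h1
  have h2 : ∫ w : ℝ, (starRingEnd ℂ) (dilatedSpectrumFun p.1 p.2 w) * dilatedSpectrumFun q.1 q.2 w =
      ∫ w : ℝ, inner ℂ (dilatedSpectrum p.1 p.2 w) (dilatedSpectrum q.1 q.2 w) :=
    integral_congr_ae (Eventually.of_forall fun w => by
      simp [dilatedSpectrum_apply, mul_comm])
  rw [h2, h1, L2.inner_def, ← integral_complex_ofReal]
  refine integral_congr_ae ?_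
  filter_upwards [(memLp_waveletFun (meyerPrimitive 0) p.1 p.2).coeFn_toLp,
    (memLp_waveletFun (meyerPrimitive 0) q.1 q.2).coeFn_toLp] with x h3 h4
  rw [waveletLp, waveletLp, h3, h4, ← ofReal_waveletFun_meyerPrimitive,
    ← ofReal_waveletFun_meyerPrimitive]
  simp [mul_comm]

theorem integral_dilatedSpectrum (j k k' : ℤ) (d : ℕ) :
    ∫ w : ℝ, (starRingEnd ℂ) (dilatedSpectrumFun j k w) * dilatedSpectrumFun (j + d) k' w =
      if d = 0 ∧ k = k' then 1 else 0 := by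
  have h2 : (0 : ℝ) < 2 ^ (j + d) := by positivity
  have h3 := Measure.integral_comp_mul_left (fun w : ℝ =>
    (starRingEnd ℂ) (dilatedSpectrumFun j k w) * dilatedSpectrumFun (j + d) k' w) (2 ^ (j + d : ℤ))
  rw [abs_of_pos (inv_pos.2 h2), eq_comm, inv_smul_eq_iff₀ h2.ne'] at h3
  rw [h3]
  have e1 : ∀ u : ℝ, (2 : ℝ) ^ (-j) * (2 ^ (j + d : ℤ) * u) = 2 ^ d * u := fun u => by
    rw [← mul_assoc, ← zpow_add₀ two_ne_zero]
    congr 1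
    simp
  have e2 : ∀ u : ℝ, (2 : ℝ) ^ (-(j + d : ℤ)) * (2 ^ (j + d : ℤ) * u) = u := fun u => by
    rw [← mul_assoc, ← zpow_add₀ two_ne_zero]
    simp
  have e3 : ∀ u : ℝ, (starRingEnd ℂ) (dilatedSpectrumFun j k (2 ^ (j + d : ℤ) * u)) *
      dilatedSpectrumFun (j + d) k' (2 ^ (j + d : ℤ) * u) =
      (((2 : ℝ) ^ (-(j : ℝ) / 2) * (2 : ℝ) ^ (-((j + d : ℤ) : ℝ) / 2) : ℝ) : ℂ) *
      ((starRingEnd ℂ) (meyerSpectrumFun 0 (2 ^ d * u)) * meyerSpectrumFun 0 u *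
        Complex.exp (2 * Real.pi * Complex.I * ((k * 2 ^ d - k' : ℤ) : ℂ) * u)) := fun u => by
    have e4 : Complex.exp (2 * Real.pi * Complex.I * ((k * 2 ^ d - k' : ℤ) : ℂ) * u) =
        (starRingEnd ℂ) (Complex.exp (-(2 * Real.pi * Complex.I * k * ((2 ^ d * u : ℝ) : ℂ)))) *
        Complex.exp (-(2 * Real.pi * Complex.I * k' * (u : ℂ))) := by
      rw [← Complex.exp_conj, ← Complex.exp_add]
      congr 1
      simp [Complex.conj_ofNat]
      ring
    rw [dilatedSpectrumFun, dilatedSpectrumFun, e1, e2, e4]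
    simp only [map_mul, Complex.conj_ofReal]
    push_cast
    ring
  simp only [e3]
  rw [integral_const_mul]
  rcases d with _ | _ | d
  · have := integral_same_scale (k - k')
    simp only [pow_zero, mul_one, one_mul]
    rw [this]
    have e5 : (((2 : ℝ) ^ (-(j : ℝ) / 2) * (2 : ℝ) ^ (-((j + (0 : ℕ) : ℤ) : ℝ) / 2) : ℝ) : ℂ) *
        (2 : ℝ) ^ (j + (0 : ℕ) : ℤ) = 1 := by
      rw [← Complex.ofReal_zpow, ← Complex.ofReal_mul, ← Real.rpow_intCast,
        ← Real.rpow_add two_pos, ← Real.rpow_add two_pos]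
      push_cast
      ring_nf
      simp
    rw [Complex.real_smul]
    simp only [sub_eq_zero, true_and]
    split_ifs
    · rw [mul_one, mul_comm]
      push_cast at e5 ⊢
      exact e5
    · simp
  · have := integral_adjacent_scale (k * 2 ^ 1 - k')
    simp only [zero_add, pow_one] at this ⊢
    rw [this]
    simp
  -- Two or more octaves apart the supports are disjoint: `|u| ≥ 1/3` gives `2^(d+2) |u| ≥ 4/3`.
  · have : ∀ u : ℝ, (starRingEnd ℂ) (meyerSpectrumFun 0 (2 ^ (d + 1 + 1) * u)) *
        meyerSpectrumFun 0 u = 0 := fun u => by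
      rcases le_total |u| (1 / 3) with h | h
      · rw [meyerSpectrumFun_of_abs_le 0 h, mul_zero]
      · rw [meyerSpectrumFun_of_le_abs 0 (w := 2 ^ (d + 1 + 1) * u), map_zero, zero_mul]
        rw [abs_mul, abs_of_pos (by positivity), pow_succ, pow_succ]
        nlinarith [one_le_pow₀ (one_le_two (α := ℝ)) (n := d)]
    simp [this]

theorem orthonormal_waveletLp_meyerPrimitive : Orthonormal ℝ (waveletLp (meyerPrimitive 0)) := by
  have key : ∀ (j k k' : ℤ) (d : ℕ), inner ℝ (waveletLp (meyerPrimitive 0) (j, k))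
      (waveletLp (meyerPrimitive 0) (j + d, k')) = if d = 0 ∧ k = k' then (1 : ℝ) else 0 := by
    intro j k k' d
    apply Complex.ofReal_injective
    rw [ofReal_inner_waveletLp, integral_dilatedSpectrum]
    split_ifs <;> simp
  rw [orthonormal_iff_ite]
  rintro ⟨j, k⟩ ⟨j', k'⟩
  rcases le_total j j' with h | h
  · obtain ⟨d, rfl⟩ := Int.le.dest h
    rw [key]
    simp
  · obtain ⟨d, rfl⟩ := Int.le.dest h
    rw [real_inner_comm, key]
    simp [eq_comm]

/-! ### Completeness of the wavelet system, by Parseval on one frequency period. -/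

theorem ae_eq_zero_of_forall_fourier_integral_eq_zero {a b : ℝ} (hab : a < b) {P : ℝ → ℂ}
    (hP : MemLp P 2 (volume.restrict (Ioc a b)))
    (h0 : ∀ n : ℤ, ∫ u in a..b, Complex.exp (2 * Real.pi * Complex.I * n * u / (b - a)) * P u = 0) :
    ∀ᵐ u : ℝ, u ∈ Ioc a b → P u = 0 := by
  have hc : ∀ n : ℤ, fourierCoeffOn hab P n = 0 := fun n => by
    rw [fourierCoeffOn_eq_integral]
    have := h0 (-n)
    simp only [fourier_coe_apply, smul_eq_mul, Complex.ofReal_sub]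
    rw [this, smul_zero]
  have h1 := tsum_sq_fourierCoeffOn hab hP
  simp only [hc, norm_zero, ne_eq, OfNat.ofNat_ne_zero, not_false_eq_true, zero_pow, tsum_zero,
    smul_eq_mul] at h1
  have h2 : ∫ u in Ioc a b, ‖P u‖ ^ 2 = 0 := by
    rw [← intervalIntegral.integral_of_le hab.le]
    have : (b - a)⁻¹ ≠ 0 := inv_ne_zero (sub_pos.2 hab).ne'
    exact (mul_eq_zero.1 h1.symm).resolve_left this
  rw [integral_eq_zero_iff_of_nonneg (fun u => by positivity)
    (hP.integrable_norm_pow two_ne_zero)] at h2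
  rw [EventuallyEq, ae_restrict_iff' measurableSet_Ioc] at h2
  filter_upwards [h2] with u hu hu'
  simpa using hu hu'

theorem ae_comp_mul_left {p : ℝ → Prop} (h : ∀ᵐ x : ℝ, p x) {c : ℝ} (hc : c ≠ 0) :
    ∀ᵐ x : ℝ, p (c * x) := by
  have hq : Measure.QuasiMeasurePreserving (fun x : ℝ => c * x) volume volume := by
    refine ⟨by fun_prop, ?_⟩
    rw [Real.map_volume_mul_left hc]
    exact Measure.smul_absolutelyContinuous
  exact hq.ae h

theorem ae_comp_add_right {p : ℝ → Prop} (h : ∀ᵐ x : ℝ, p x) (c : ℝ) : ∀ᵐ x : ℝ, p (x + c) :=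
  (measurePreserving_add_right volume c).quasiMeasurePreserving.ae h

theorem memLp_comp_mul_left {F : ℝ → ℂ} (hF : MemLp F 2) {c : ℝ} (hc : c ≠ 0) :
    MemLp (fun x => F (c * x)) 2 := by
  have hm : Measurable fun x : ℝ => c * x := by fun_prop
  have h1 : MemLp F 2 (Measure.map (fun x : ℝ => c * x) volume) := by
    rw [Real.map_volume_mul_left hc]
    exact hF.smul_measure ENNReal.ofReal_ne_top
  exact h1.comp_of_map hm.aemeasurable

theorem integral_dilatedSpectrum_conj_mul (F : ℝ → ℂ) (j k : ℤ) :
    ∫ w : ℝ, (starRingEnd ℂ) (dilatedSpectrumFun j k w) * F w =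
      (((2 : ℝ) ^ (j : ℤ) * (2 : ℝ) ^ (-(j : ℝ) / 2) : ℝ) : ℂ) *
      ∫ u : ℝ, Complex.exp (2 * Real.pi * Complex.I * k * u) *
        ((starRingEnd ℂ) (meyerSpectrumFun 0 u) * F ((2 : ℝ) ^ j * u)) := by
  have h2 : (0 : ℝ) < 2 ^ j := by positivity
  have h3 := Measure.integral_comp_mul_left (fun w : ℝ =>
    (starRingEnd ℂ) (dilatedSpectrumFun j k w) * F w) (2 ^ j)
  rw [abs_of_pos (inv_pos.2 h2), eq_comm, inv_smul_eq_iff₀ h2.ne'] at h3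
  rw [h3, Complex.ofReal_mul, mul_assoc, ← integral_const_mul, Complex.real_smul]
  congr 1
  refine integral_congr_ae (Eventually.of_forall fun u => ?_)
  have e2 : (2 : ℝ) ^ (-j) * (2 ^ j * u) = u := by
    rw [← mul_assoc, ← zpow_add₀ two_ne_zero]
    simp
  have e4 : Complex.exp (2 * Real.pi * Complex.I * k * u) =
      (starRingEnd ℂ) (Complex.exp (-(2 * Real.pi * Complex.I * k * (u : ℂ)))) := by
    rw [← Complex.exp_conj]
    simp [Complex.conj_ofNat]
  simp only [dilatedSpectrumFun, e2, map_mul, Complex.conj_ofReal]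
  rw [e4]
  ring

/-- At a fixed scale, the integrals over varying `k` are, up to a nonzero factor, the Fourier
coefficients of the folded function. -/
theorem ae_periodized_eq_zero {F : ℝ → ℂ} (hF : MemLp F 2) {j : ℤ}
    (h0 : ∀ k : ℤ, ∫ w : ℝ, (starRingEnd ℂ) (dilatedSpectrumFun j k w) * F w = 0) :
    ∀ᵐ u : ℝ, u ∈ Ioc (1 / 3 : ℝ) (4 / 3) →
      (starRingEnd ℂ) (meyerSpectrumFun 0 u) * F ((2 : ℝ) ^ j * u) +
      (starRingEnd ℂ) (meyerSpectrumFun 0 (u - 1)) * F ((2 : ℝ) ^ j * (u - 1)) +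
      (starRingEnd ℂ) (meyerSpectrumFun 0 (u - 2)) * F ((2 : ℝ) ^ j * (u - 2)) = 0 := by
  have h2 : (0 : ℝ) < 2 ^ j := by positivity
  set H : ℝ → ℂ := fun u => (starRingEnd ℂ) (meyerSpectrumFun 0 u) * F ((2 : ℝ) ^ j * u) with hH
  have hFj := memLp_comp_mul_left hF h2.ne'
  have hcs : Continuous fun u => (starRingEnd ℂ) (meyerSpectrumFun 0 u) :=
    Complex.continuous_conj.comp (continuous_meyerSpectrumFun 0)
  have hsupp : HasCompactSupport fun u => (starRingEnd ℂ) (meyerSpectrumFun 0 u) :=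
    (hasCompactSupport_meyerSpectrumFun 0).comp_left (map_zero _)
  have hH1 : Integrable H := (hcs.memLp_of_hasCompactSupport hsupp (p := 2)).integrable_mul hFj
  have hH2 : MemLp H 2 :=
    hFj.mul (hcs.memLp_of_hasCompactSupport (μ := volume) hsupp (p := ⊤))
  have hHc : ∀ c : ℝ, MemLp (fun u => H (u - c)) 2 := fun c =>
    hH2.comp_measurePreserving (measurePreserving_sub_right volume c)
  refine ae_eq_zero_of_forall_fourier_integral_eq_zero (by norm_num)
    (P := fun u => H u + H (u - 1) + H (u - 2)) (((hH2.add (hHc 1)).add (hHc 2)).restrict _) ?_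
  intro n
  have h4 := h0 n
  rw [integral_dilatedSpectrum_conj_mul] at h4
  have h5 := (mul_eq_zero.1 h4).resolve_left (Complex.ofReal_ne_zero.2 (by positivity))
  have h6 : Integrable fun u : ℝ => Complex.exp (2 * Real.pi * Complex.I * n * u) * H u := by
    refine hH1.bdd_mul (c := 1) (Continuous.aestronglyMeasurable (by fun_prop)) ?_
    refine Eventually.of_forall fun u => le_of_eq ?_
    rw [show 2 * Real.pi * Complex.I * n * u = ((2 * Real.pi * n * u : ℝ) : ℂ) * Complex.I by
      push_cast; ring, Complex.norm_exp_ofReal_mul_I]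
  rw [integral_eq_intervalIntegral_of_support h6] at h5
  · rw [← h5]
    refine intervalIntegral.integral_congr fun u _ => ?_
    have e1 := exp_two_pi_int_mul_sub n 1 u
    have e2 := exp_two_pi_int_mul_sub n 2 u
    rw [Nat.cast_one] at e1
    rw [Nat.cast_ofNat] at e2
    simp only [e1, e2]
    norm_num
    ring
  · intro u hu
    simp [hH, meyerSpectrumFun_of_le_abs 0 hu]

/-- For `u ∈ (1/3, 2/3]`, the folded identities at scale `j` (at `u`) and at scale `j - 1` (at `2u`)
are two linear equations in `F(2^j u)` and `F(2^j (u - 1))`. Once the phases are removed their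
matrix is a rotation, so both values vanish. The dyadic dilates of `(1/3, 2/3]` and `(-2/3, -1/3]`
cover all nonzero frequencies. -/
theorem ae_eq_zero_of_forall_dilatedSpectrum {F : ℝ → ℂ} (hF : MemLp F 2)
    (h0 : ∀ j k : ℤ, ∫ w : ℝ, (starRingEnd ℂ) (dilatedSpectrumFun j k w) * F w = 0) :
    ∀ᵐ w : ℝ, F w = 0 := by
  have h1 : ∀ j : ℤ, ∀ᵐ u : ℝ, u ∈ Ioc (1 / 3 : ℝ) (2 / 3) →
      F ((2 : ℝ) ^ j * u) = 0 ∧ F ((2 : ℝ) ^ j * (u - 1)) = 0 := by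
    intro j
    filter_upwards [ae_periodized_eq_zero hF (h0 j),
      ae_comp_mul_left (ae_periodized_eq_zero hF (h0 (j - 1))) two_ne_zero] with u ha hb hu
    have hu' : u ∈ Icc (1 / 3 : ℝ) (2 / 3) := Ioc_subset_Icc_self hu
    have ha := ha ⟨hu.1, by linarith [hu.2]⟩
    have hb := hb ⟨by linarith [hu.1], by linarith [hu.2]⟩
    have e : ∀ v : ℝ, (2 : ℝ) ^ (j - 1) * (2 * v) = 2 ^ j * v := fun v => by
      rw [zpow_sub_one₀ two_ne_zero]
      ring
    rw [meyerSpectrumFun_of_le_abs 0 (w := u - 2)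
      (by rw [abs_of_nonpos (by linarith [hu.2])]; linarith [hu.2]), map_zero, zero_mul,
      add_zero] at ha
    rw [meyerSpectrumFun_of_abs_le 0 (w := 2 * u - 1)
      (by rw [abs_le]; exact ⟨by linarith [hu.1], by linarith [hu.2]⟩), map_zero, zero_mul,
      add_zero, e, show 2 * u - 2 = 2 * (u - 1) by ring, e] at hb
    obtain ⟨g1, g2, g3, g4⟩ := meyerWindow_of_mem hu'
    rw [show 2 * u - 2 = 2 * (u - 1) by ring] at g4
    simp only [meyerSpectrumFun_zero_eq, map_mul, ← Complex.exp_conj, Complex.conj_I,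
      Complex.conj_ofReal, g1, g2, g3, g4] at ha hb
    have p1 : Complex.exp (-Complex.I * Real.pi * ((u - 1 : ℝ) : ℂ)) =
        -Complex.exp (-Complex.I * Real.pi * u) := by
      rw [← Complex.exp_add_pi_mul_I]
      congr 1
      push_cast
      ring
    have p2 : Complex.exp (-Complex.I * Real.pi * ((2 * (u - 1) : ℝ) : ℂ)) =
        Complex.exp (-Complex.I * Real.pi * ((2 * u : ℝ) : ℂ)) := by
      rw [Complex.exp_eq_exp_iff_exists_int]
      refine ⟨1, ?_⟩
      push_cast
      ring
    rw [p1] at ha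
    rw [p2] at hb
    set E1 := Complex.exp (-Complex.I * Real.pi * u)
    set E2 := Complex.exp (-Complex.I * Real.pi * ((2 * u : ℝ) : ℂ))
    have n1 : E1 ≠ 0 := Complex.exp_ne_zero _
    have n2 : E2 ≠ 0 := Complex.exp_ne_zero _
    set A := F (2 ^ j * u)
    set B := F (2 ^ j * (u - 1))
    set x := Real.pi / 2 * Real.smoothTransition (3 * u - 1)
    have hsc : (Real.sin x : ℂ) ^ 2 + (Real.cos x : ℂ) ^ 2 = 1 := by
      exact_mod_cast Real.sin_sq_add_cos_sq x
    have q1 : (Real.sin x : ℂ) * A - (Real.cos x : ℂ) * B = 0 := by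
      refine (mul_eq_zero.1 (?_ : E1 * _ = 0)).resolve_left n1
      linear_combination ha
    have q2 : (Real.cos x : ℂ) * A + (Real.sin x : ℂ) * B = 0 := by
      refine (mul_eq_zero.1 (?_ : E2 * _ = 0)).resolve_left n2
      linear_combination hb
    constructor
    · linear_combination (Real.sin x : ℂ) * q1 + (Real.cos x : ℂ) * q2 - A * hsc
    · linear_combination (Real.sin x : ℂ) * q2 - (Real.cos x : ℂ) * q1 - B * hsc
  have h2 : ∀ j : ℤ, ∀ᵐ w : ℝ, (2 : ℝ) ^ (-j) * w ∈ Ioc (1 / 3 : ℝ) (2 / 3) → F w = 0 := by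
    intro j
    filter_upwards [ae_comp_mul_left (h1 j) (zpow_ne_zero (-j) (two_ne_zero (α := ℝ)))] with w hw h
    have := (hw h).1
    rwa [← mul_assoc, ← zpow_add₀ two_ne_zero, add_neg_cancel, zpow_zero, one_mul] at this
  have h3 : ∀ j : ℤ, ∀ᵐ w : ℝ, (2 : ℝ) ^ (-j) * w + 1 ∈ Ioc (1 / 3 : ℝ) (2 / 3) → F w = 0 := by
    intro j
    filter_upwards [ae_comp_mul_left (ae_comp_add_right (h1 j) 1)
      (zpow_ne_zero (-j) (two_ne_zero (α := ℝ)))] with w hw h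
    have := (hw h).2
    rwa [add_sub_cancel_right, ← mul_assoc, ← zpow_add₀ two_ne_zero, add_neg_cancel, zpow_zero,
      one_mul] at this
  filter_upwards [ae_all_iff.2 h2, ae_all_iff.2 h3,
    compl_mem_ae_iff.2 (measure_singleton (μ := volume) (0 : ℝ))] with w h4 h5 h6
  rcases lt_or_gt_of_ne (show w ≠ 0 from h6) with hw | hw
  -- The sign change reverses the closed end: `Ico` for `-w` matches `w / 2^n ∈ (-2/3, -1/3]`, while
  -- the positive case needs `Ioc`.
  · obtain ⟨n, hn⟩ := exists_mem_Ico_zpow (x := 3 * -w) (y := (2 : ℝ)) (by linarith) one_lt_two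
    have hp : (0 : ℝ) < 2 ^ n := by positivity
    refine h5 n ?_
    rw [zpow_add_one₀ two_ne_zero] at hn
    rw [zpow_neg, inv_mul_eq_div]
    have h7 : w / 2 ^ n ≤ -1 / 3 := by rw [div_le_iff₀ hp]; linarith [hn.1]
    have h8 : -2 / 3 < w / 2 ^ n := by rw [lt_div_iff₀ hp]; linarith [hn.2]
    exact ⟨by linarith, by linarith⟩
  · obtain ⟨n, hn⟩ := exists_mem_Ioc_zpow (x := 3 * w) (y := (2 : ℝ)) (by linarith) one_lt_two
    have hp : (0 : ℝ) < 2 ^ n := by positivity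
    refine h4 n ?_
    rw [zpow_add_one₀ two_ne_zero] at hn
    rw [zpow_neg, inv_mul_eq_div]
    have h7 : w / 2 ^ n ≤ 2 / 3 := by rw [div_le_iff₀ hp]; linarith [hn.2]
    have h8 : 1 / 3 < w / 2 ^ n := by rw [lt_div_iff₀ hp]; linarith [hn.1]
    exact ⟨by linarith, by linarith⟩

-- A real `f` orthogonal to every wavelet is complexified; by Plancherel its Fourier transform is
-- orthogonal to every `dilatedSpectrum`, hence zero.
open scoped FourierTransform in
theorem complete_waveletLp_meyerPrimitive :
    (Submodule.span ℝ (Set.range (waveletLp (meyerPrimitive 0)))).topologicalClosure = ⊤ := by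
  rw [Submodule.topologicalClosure_eq_top_iff, Submodule.eq_bot_iff]
  intro f hf
  set fc : Lp ℂ 2 (volume : Measure ℝ) := Complex.ofRealCLM.compLp f with hfc
  have hfc' : ∀ᵐ x : ℝ, fc x = (f x : ℂ) := Complex.ofRealCLM.coeFn_compLp f
  have h1 : ∀ᵐ w : ℝ, (𝓕 fc : Lp ℂ 2 (volume : Measure ℝ)) w = 0 := by
    refine ae_eq_zero_of_forall_dilatedSpectrum (Lp.memLp _) fun j k => ?_
    have h2 : inner ℝ (waveletLp (meyerPrimitive 0) (j, k)) f = 0 :=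
      (Submodule.mem_orthogonal _ _).1 hf _ (Submodule.subset_span ⟨(j, k), rfl⟩)
    have h3 : inner ℂ ((𝓕⁻ (dilatedSpectrum j k)).toLp 2) fc = 0 := by
      have h4 : inner ℂ ((𝓕⁻ (dilatedSpectrum j k)).toLp 2) fc =
          ((inner ℝ (waveletLp (meyerPrimitive 0) (j, k)) f : ℝ) : ℂ) := by
        rw [L2.inner_def, L2.inner_def, ← integral_complex_ofReal]
        refine integral_congr_ae ?_
        filter_upwards [(memLp_waveletFun (meyerPrimitive 0) j k).coeFn_toLp, hfc',
          (𝓕⁻ (dilatedSpectrum j k)).coeFn_toLp 2] with x g1 g2 g3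
        rw [g2, g3, waveletLp, g1, ← ofReal_waveletFun_meyerPrimitive]
        simp [mul_comm]
      rw [h4, h2, Complex.ofReal_zero]
    rw [← Lp.inner_fourier_eq, SchwartzMap.toLp_fourier_eq, FourierTransform.fourier_fourierInv_eq,
      L2.inner_def] at h3
    rw [← h3]
    refine integral_congr_ae ?_
    filter_upwards [(dilatedSpectrum j k).coeFn_toLp 2] with w hw
    rw [hw, dilatedSpectrum_apply]
    simp [mul_comm]
  have h5 : 𝓕 fc = 0 := by
    rw [Lp.eq_zero_iff_ae_eq_zero]
    exact h1
  have h6 : fc = 0 := by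
    rw [← norm_eq_zero, ← Lp.norm_fourier_eq, h5, norm_zero]
  rw [Lp.eq_zero_iff_ae_eq_zero] at h6 ⊢
  filter_upwards [h6, hfc'] with x g1 g2
  rw [g1] at g2
  exact Complex.ofReal_injective g2.symm

theorem isLemarieMeyerWavelet_meyerPrimitive : IsLemarieMeyerWavelet (meyerPrimitive 0) where
  fourier_support ξ h := by
    rw [fourier_meyerPrimitive] at h
    have h1 : 1 / 3 < |ξ / (2 * Real.pi)| := by
      by_contra hc
      exact h (meyerSpectrumFun_of_abs_le 0 (not_lt.1 hc))
    have h2 : |ξ / (2 * Real.pi)| < 4 / 3 := by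
      by_contra hc
      exact h (meyerSpectrumFun_of_le_abs 0 (not_lt.1 hc))
    have hp : 0 < 2 * Real.pi := Real.two_pi_pos
    rw [abs_div, abs_of_pos hp] at h1 h2
    rw [lt_div_iff₀ hp] at h1
    rw [div_lt_iff₀ hp] at h2
    exact ⟨by linarith, by linarith⟩
  orthonormal := orthonormal_waveletLp_meyerPrimitive
  complete := complete_waveletLp_meyerPrimitive

/-! ### The law of Wiener integrals -/

theorem integral_abs_le_norm {Ω : Type*} [MeasurableSpace Ω] {P : Measure Ω}
    [IsProbabilityMeasure P] (Z : Lp ℝ 2 P) : ∫ ω, |Z ω| ∂P ≤ ‖Z‖ := by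
  have h1 : ∫ ω, |Z ω| ∂P = (eLpNorm Z 1 P).toReal := by
    rw [eLpNorm_one_eq_lintegral_enorm]
    exact integral_norm_eq_lintegral_enorm (Lp.memLp Z).1
  rw [h1, Lp.norm_def]
  exact ENNReal.toReal_mono (Lp.memLp Z).2.ne
    (eLpNorm_le_eLpNorm_of_exponent_le one_le_two (Lp.memLp Z).1)

/-- From `|e^(ix) - e^(iy)| ≤ |x - y|`, the map is 1-Lipschitz for the `L¹` norm, hence for the `L²`
norm of a probability space. -/
theorem continuous_integral_exp_I {Ω : Type*} [MeasurableSpace Ω] {P : Measure Ω}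
    [IsProbabilityMeasure P] :
    Continuous fun Z : Lp ℝ 2 P => ∫ ω, Complex.exp (Z ω * Complex.I) ∂P := by
  have hint : ∀ Z : Lp ℝ 2 P, Integrable (fun ω => Complex.exp (Z ω * Complex.I)) P := fun Z => by
    refine Integrable.of_bound (C := 1) ?_ (Eventually.of_forall fun ω => ?_)
    · have : Continuous fun x : ℝ => Complex.exp (x * Complex.I) := by fun_prop
      exact this.comp_aestronglyMeasurable (Lp.memLp Z).1
    · rw [Complex.norm_exp_ofReal_mul_I]
  refine (LipschitzWith.of_dist_le_mul (K := 1) fun X Y => ?_).continuous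
  rw [NNReal.coe_one, one_mul, dist_eq_norm, dist_eq_norm, ← integral_sub (hint X) (hint Y)]
  refine le_trans ?_ (integral_abs_le_norm (X - Y))
  refine (norm_integral_le_integral_norm _).trans ?_
  refine integral_mono_ae ((hint X).sub (hint Y)).norm
    ((Lp.memLp (X - Y)).integrable (by norm_num)).abs ?_
  filter_upwards [Lp.coeFn_sub X Y] with ω hω
  rw [hω, Pi.sub_apply]
  have h1 : Complex.exp (X ω * Complex.I) - Complex.exp (Y ω * Complex.I) =
      Complex.exp (Y ω * Complex.I) * (Complex.exp (Complex.I * ((X ω - Y ω : ℝ) : ℂ)) - 1) := by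
    rw [mul_sub, ← Complex.exp_add]
    congr 2
    · push_cast; ring
    · ring
  rw [h1, norm_mul, Complex.norm_exp_ofReal_mul_I, one_mul]
  exact (Real.norm_exp_I_mul_ofReal_sub_one_le).trans (le_of_eq (Real.norm_eq_abs _))

theorem integral_sq_eq_norm_sq {Ω : Type*} [MeasurableSpace Ω] {P : Measure Ω}
    (Z : Lp ℝ 2 P) : ∫ ω, Z ω ^ 2 ∂P = ‖Z‖ ^ 2 := by
  rw [← real_inner_self_eq_norm_sq, L2.inner_def]
  refine integral_congr_ae (Eventually.of_forall fun ω => ?_)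
  simp

theorem IsBrownianOnLine.integral_exp_stepIntegral {Ω : Type*} [MeasurableSpace Ω] {P : Measure Ω}
    [IsProbabilityMeasure P] {W : ℝ → Ω → ℝ} (hW : IsBrownianOnLine W P) (c : LineInterval →₀ ℝ) :
    ∫ ω, Complex.exp (hW.stepIntegral c ω * Complex.I) ∂P =
      Complex.exp (-(‖stepFunction c‖ ^ 2 / 2 : ℝ)) := by
  classical
  set Y : LineInterval → Ω → ℝ := fun p ω => c p * (W p.1.2 ω - W p.1.1 ω) with hY
  have hYG : IsGaussianProcess Y P := by
    refine hW.isGaussianProcess.of_isGaussianProcess fun p => ⟨{p.1.1, p.1.2}, ?_⟩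
    refine ⟨c p • (ContinuousLinearMap.proj ⟨p.1.2, by simp⟩ -
      ContinuousLinearMap.proj ⟨p.1.1, by simp⟩), fun ω => ?_⟩
    simp [hY, Finset.restrict_def]
  have hS : hW.stepIntegral c =ᵐ[P] fun ω => ∑ p ∈ c.support, Y p ω := by
    rw [IsBrownianOnLine.stepIntegral, Finsupp.linearCombination_apply, Finsupp.sum]
    have h1 : ∀ p : LineInterval, (c p • (hW.val p.1.2 - hW.val p.1.1) : Lp ℝ 2 P) =ᵐ[P] Y p := by
      intro p
      filter_upwards [Lp.coeFn_smul (c p) (hW.val p.1.2 - hW.val p.1.1),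
        Lp.coeFn_sub (hW.val p.1.2) (hW.val p.1.1), (hW.memLp p.1.1).coeFn_toLp,
        (hW.memLp p.1.2).coeFn_toLp] with ω g1 g2 g3 g4
      rw [g1, Pi.smul_apply, g2, Pi.sub_apply, IsBrownianOnLine.val, IsBrownianOnLine.val, g3, g4]
      simp [hY]
    filter_upwards [Lp.coeFn_finsetSum c.support fun p => c p • (hW.val p.1.2 - hW.val p.1.1),
      ae_all_iff.2 fun p : c.support => h1 p] with ω g1 g2
    rw [g1, Finset.sum_apply]
    exact Finset.sum_congr rfl fun p hp => g2 ⟨p, hp⟩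
  have hG : HasGaussianLaw (hW.stepIntegral c) P := (hYG.hasGaussianLaw_fun_sum).congr hS.symm
  have hmean : ∫ ω, hW.stepIntegral c ω ∂P = 0 := by
    rw [integral_congr_ae hS, integral_finsetSum]
    · refine Finset.sum_eq_zero fun p _ => ?_
      simp only [hY]
      rw [integral_const_mul, integral_sub ((hW.memLp _).integrable (by norm_num))
        ((hW.memLp _).integrable (by norm_num)), hW.centered, hW.centered]
      simp
    · intro p _
      exact (((hW.memLp _).integrable (by norm_num)).sub
        ((hW.memLp _).integrable (by norm_num))).const_mul _
  have hvar : Var[hW.stepIntegral c; P] = ‖stepFunction c‖ ^ 2 := by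
    rw [variance_of_integral_eq_zero hG.aemeasurable hmean, ← hW.norm_stepIntegral,
      ← integral_sq_eq_norm_sq]
  have h1 := hG.map_eq_gaussianReal
  rw [hmean, hvar] at h1
  have h2 := charFun_gaussianReal (μ := 0) (v := (‖stepFunction c‖ ^ 2).toNNReal) 1
  rw [← h1, charFun_apply_real, integral_map hG.aemeasurable
    (Continuous.aestronglyMeasurable (by fun_prop))] at h2
  simp only [Complex.ofReal_one, one_mul] at h2
  rw [h2]
  congr 1
  rw [Real.coe_toNNReal _ (by positivity)]
  push_cast
  ring

/-- Both sides are continuous in `f` and agree on the dense set of step functions. Since `f` is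
arbitrary and the integral is linear, this single identity determines all joint laws of Wiener
integrals. -/
theorem IsBrownianOnLine.integral_exp_wienerIntegral {Ω : Type*} [MeasurableSpace Ω]
    {P : Measure Ω} [IsProbabilityMeasure P] {W : ℝ → Ω → ℝ} (hW : IsBrownianOnLine W P)
    (f : Lp ℝ 2 (volume : Measure ℝ)) :
    ∫ ω, Complex.exp (hW.wienerIntegral f ω * Complex.I) ∂P =
      Complex.exp (-(‖f‖ ^ 2 / 2 : ℝ)) := by
  refine denseRange_stepFunction.induction_on f (isClosed_eq ?_ ?_) fun c => ?_
  · exact continuous_integral_exp_I.comp hW.wienerIntegral.continuous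
  · fun_prop
  · rw [hW.wienerIntegral_stepFunction, hW.integral_exp_stepIntegral]

theorem IsBrownianOnLine.measurable_wienerIntegral {Ω : Type*} [MeasurableSpace Ω]
    {P : Measure Ω} {W : ℝ → Ω → ℝ} (hW : IsBrownianOnLine W P)
    (f : Lp ℝ 2 (volume : Measure ℝ)) : Measurable (hW.wienerIntegral f) :=
  (Lp.stronglyMeasurable _).measurable

theorem IsBrownianOnLine.map_wienerIntegral {Ω : Type*} [MeasurableSpace Ω]
    {P : Measure Ω} [IsProbabilityMeasure P] {W : ℝ → Ω → ℝ} (hW : IsBrownianOnLine W P)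
    {f : Lp ℝ 2 (volume : Measure ℝ)} (hf : ‖f‖ = 1) :
    P.map (hW.wienerIntegral f) = gaussianReal 0 1 := by
  have hm := hW.measurable_wienerIntegral f
  have : IsProbabilityMeasure (P.map (hW.wienerIntegral f)) :=
    Measure.isProbabilityMeasure_map hm.aemeasurable
  refine Measure.ext_of_charFun ?_
  funext t
  rw [charFun_gaussianReal, charFun_apply_real, integral_map hm.aemeasurable
    (Continuous.aestronglyMeasurable (by fun_prop))]
  have h1 := hW.integral_exp_wienerIntegral (t • f)
  rw [map_smul] at h1
  have h2 : ∫ ω, Complex.exp (t * hW.wienerIntegral f ω * Complex.I) ∂P =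
      ∫ ω, Complex.exp ((t • hW.wienerIntegral f : Lp ℝ 2 P) ω * Complex.I) ∂P := by
    refine integral_congr_ae ?_
    filter_upwards [Lp.coeFn_smul t (hW.wienerIntegral f)] with ω hω
    rw [hω]
    simp
  rw [h2, h1, norm_smul, hf, mul_one, Real.norm_eq_abs, sq_abs]
  congr 1
  push_cast
  simp

/-- The joint characteristic function at `t` is that of the integral of `∑ tᵢ eᵢ` at 1, and `‖∑ tᵢ
eᵢ‖² = ∑ tᵢ²` makes it factor. -/
theorem IsBrownianOnLine.iIndepFun_wienerIntegral {Ω : Type*} [MeasurableSpace Ω]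
    {P : Measure Ω} [IsProbabilityMeasure P] {W : ℝ → Ω → ℝ} (hW : IsBrownianOnLine W P)
    {ι : Type*} [Fintype ι] {e : ι → Lp ℝ 2 (volume : Measure ℝ)} (he : Orthonormal ℝ e) :
    iIndepFun (fun i => (hW.wienerIntegral (e i) : Ω → ℝ)) P := by
  rw [iIndepFun_iff_charFun_pi fun i => (hW.measurable_wienerIntegral (e i)).aemeasurable]
  intro t
  have hm : Measurable fun ω => WithLp.toLp 2 fun i => (hW.wienerIntegral (e i) : Ω → ℝ) ω := by
    have h := fun i => hW.measurable_wienerIntegral (e i)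
    exact (PiLp.continuous_toLp 2 _).measurable.comp (measurable_pi_iff.2 h)
  have h1 := hW.integral_exp_wienerIntegral (∑ i, t i • e i)
  have h2 : ∀ᵐ ω ∂P, hW.wienerIntegral (∑ i, t i • e i) ω = ∑ i, t i * hW.wienerIntegral (e i) ω := by
    rw [map_sum]
    filter_upwards [Lp.coeFn_finsetSum Finset.univ fun i => hW.wienerIntegral (t i • e i),
      ae_all_iff.2 fun i => Lp.coeFn_smul (t i) (hW.wienerIntegral (e i))] with ω g1 g2
    rw [g1, Finset.sum_apply]
    refine Finset.sum_congr rfl fun i _ => ?_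
    rw [map_smul, g2 i]
    simp
  rw [charFun_apply, integral_map hm.aemeasurable
    (Continuous.aestronglyMeasurable (by fun_prop))]
  have h3 : ∫ ω, Complex.exp ((inner ℝ (WithLp.toLp 2 fun i => hW.wienerIntegral (e i) ω) t : ℝ) *
      Complex.I) ∂P =
      ∫ ω, Complex.exp (hW.wienerIntegral (∑ i, t i • e i) ω * Complex.I) ∂P := by
    refine integral_congr_ae ?_
    filter_upwards [h2] with ω hω
    rw [hω]
    simp [PiLp.inner_apply, mul_comm]
  have hn : ‖∑ i, t i • e i‖ ^ 2 = ∑ i, t i ^ 2 := by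
    rw [← real_inner_self_eq_norm_sq, he.inner_sum]
    simp [pow_two]
  rw [h3, h1, hn]
  have h4 : ∀ i, charFun (P.map (hW.wienerIntegral (e i))) (t i) =
      Complex.exp (-(t i ^ 2 / 2 : ℝ)) := fun i => by
    rw [hW.map_wienerIntegral (he.1 i), charFun_gaussianReal]
    congr 1
    push_cast
    simp
  rw [Finset.prod_congr rfl fun i _ => h4 i, ← Complex.exp_sum]
  congr 1
  push_cast
  rw [Finset.sum_neg_distrib, Finset.sum_div]

/-! ### Almost sure behaviour of orthonormal families of Wiener integrals -/

theorem summable_weight : Summable fun jk : ℤ × ℤ =>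
    ((2 : ℝ) ^ jk.1.natAbs * (1 + |(jk.2 : ℝ)|) ^ 2)⁻¹ := by
  have h1 : Summable fun j : ℤ => ((2 : ℝ) ^ j.natAbs)⁻¹ := by
    have : Summable fun n : ℕ => ((2 : ℝ) ^ n)⁻¹ := by
      simpa using summable_geometric_two
    exact Summable.of_nat_of_neg (by simpa using this) (by simpa using this)
  have h2 : Summable fun k : ℤ => ((1 + |(k : ℝ)|) ^ 2)⁻¹ := by
    have : Summable fun n : ℕ => ((1 + (n : ℝ)) ^ 2)⁻¹ := by
      have h := (summable_nat_add_iff 1).2 (Real.summable_one_div_nat_pow.2 one_lt_two)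
      simpa [add_comm] using h
    exact Summable.of_nat_of_neg (by simpa using this) (by simpa using this)
  have := h1.mul_of_nonneg h2 (fun j => by positivity) (fun k => by positivity)
  refine this.congr fun jk => ?_
  rw [mul_inv]

/-- All coefficients share the same finite `p`-th moment, so the weighted sum of their `p`-th powers
has finite expectation and is almost surely finite; it dominates each of its terms. Keeping every
`p` allows the exponents to be made arbitrarily small by taking roots. -/
theorem IsBrownianOnLine.ae_growth {Ω : Type*} [MeasurableSpace Ω]
    {P : Measure Ω} [IsProbabilityMeasure P] {W : ℝ → Ω → ℝ} (hW : IsBrownianOnLine W P)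
    {e : ℤ × ℤ → Lp ℝ 2 (volume : Measure ℝ)} (he : Orthonormal ℝ e) :
    ∀ᵐ ω ∂P, ∀ p : ℕ, ∃ C : ℝ, ∀ jk : ℤ × ℤ, |hW.wienerIntegral (e jk) ω| ^ p ≤
      C * (2 ^ jk.1.natAbs * (1 + |(jk.2 : ℝ)|) ^ 2) := by
  rw [ae_all_iff]
  intro p
  set w : ℤ × ℤ → ℝ := fun jk => ((2 : ℝ) ^ jk.1.natAbs * (1 + |(jk.2 : ℝ)|) ^ 2)⁻¹ with hw
  have hw0 : ∀ jk, 0 < w jk := fun jk => by simp only [hw]; positivity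
  have hm : ∀ jk, Measurable (hW.wienerIntegral (e jk)) := fun jk =>
    hW.measurable_wienerIntegral _
  have hmom : ∀ jk, ∫⁻ ω, ENNReal.ofReal (|hW.wienerIntegral (e jk) ω| ^ p) ∂P =
      ∫⁻ x, ENNReal.ofReal (|x| ^ p) ∂(gaussianReal 0 1) := fun jk => by
    rw [← hW.map_wienerIntegral (he.1 jk), lintegral_map (by fun_prop) (hm jk)]
  have hfin : ∫⁻ x, ENNReal.ofReal (|x| ^ p) ∂(gaussianReal 0 1) ≠ ∞ := by
    have h1 : Integrable (fun x : ℝ => ‖x‖ ^ p) (gaussianReal 0 1) :=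
      (IsGaussian.memLp_id (gaussianReal 0 1) p (ENNReal.natCast_ne_top p)).integrable_norm_pow'
    have h2 := h1.lintegral_lt_top
    simpa using h2.ne
  have hsum : ∫⁻ ω, ∑' jk, ENNReal.ofReal (w jk) *
      ENNReal.ofReal (|hW.wienerIntegral (e jk) ω| ^ p) ∂P ≠ ∞ := by
    rw [lintegral_tsum fun jk => by
      have := hm jk
      fun_prop]
    have : ∀ jk, ∫⁻ ω, ENNReal.ofReal (w jk) *
        ENNReal.ofReal (|hW.wienerIntegral (e jk) ω| ^ p) ∂P =
        ENNReal.ofReal (w jk) * ∫⁻ x, ENNReal.ofReal (|x| ^ p) ∂(gaussianReal 0 1) := fun jk => by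
      have := hm jk
      rw [lintegral_const_mul _ (by fun_prop), hmom]
    simp only [this]
    rw [ENNReal.tsum_mul_right]
    exact ENNReal.mul_ne_top (summable_weight.tsum_ofReal_ne_top) hfin
  filter_upwards [ae_lt_top' (by
    refine AEMeasurable.tsum fun jk => ?_
    have := hm jk
    fun_prop) hsum] with ω hω
  refine ⟨(∑' jk, ENNReal.ofReal (w jk) *
    ENNReal.ofReal (|hW.wienerIntegral (e jk) ω| ^ p)).toReal, fun jk => ?_⟩
  have h1 := ENNReal.le_tsum (f := fun jk => ENNReal.ofReal (w jk) *
    ENNReal.ofReal (|hW.wienerIntegral (e jk) ω| ^ p)) jk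
  have h2 := ENNReal.toReal_mono hω.ne h1
  rw [← ENNReal.ofReal_mul (hw0 jk).le, ENNReal.toReal_ofReal (mul_nonneg (hw0 jk).le (by positivity))] at h2
  rw [← div_le_iff₀ (by positivity), div_eq_inv_mul]
  exact h2

/-! ### Large coefficients in every short window, by Borel–Cantelli. -/

theorem gaussianReal_Ioo_lt_one : gaussianReal 0 1 (Ioo (-1 : ℝ) 1) < 1 := by
  refine lt_of_le_of_ne prob_le_one fun h => ?_
  have h1 : gaussianReal 0 1 (Ioo (-1 : ℝ) 1)ᶜ = 0 := (prob_compl_eq_zero_iff measurableSet_Ioo).2 h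
  have h2 : (volume : Measure ℝ) (Ioo (-1 : ℝ) 1)ᶜ = 0 :=
    gaussianReal_absolutelyContinuous' 0 one_ne_zero h1
  have h3 : (volume : Measure ℝ) (Icc 1 2) ≤ (volume : Measure ℝ) (Ioo (-1 : ℝ) 1)ᶜ :=
    measure_mono fun x hx h => by linarith [hx.1, h.2]
  rw [h2, Real.volume_Icc] at h3
  norm_num at h3

/-- By independence, all `Lj` coefficients of one window lie in `(-1, 1)` with probability `q^(Lj)`.
There are at most `3 · 4^j` windows, so `q^L < 1/8` leaves the summable bound `3 · 2^(-j)`. The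
range `|m| ≤ 4^j` eventually contains `⌊2^j s⌋` for every real `s`, which makes the exceptional
event independent of `s`. -/
theorem IsBrownianOnLine.ae_exists_one_le {Ω : Type*} [MeasurableSpace Ω]
    {P : Measure Ω} [IsProbabilityMeasure P] {W : ℝ → Ω → ℝ} (hW : IsBrownianOnLine W P)
    {e : ℤ × ℤ → Lp ℝ 2 (volume : Measure ℝ)} (he : Orthonormal ℝ e) :
    ∃ L : ℕ, ∀ᵐ ω ∂P, ∀ᶠ j : ℕ in atTop, ∀ m : ℤ, |m| ≤ 4 ^ j →
      ∃ i : ℕ, i < L * j ∧ 1 ≤ |hW.wienerIntegral (e (j, m + i)) ω| := by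
  set q : ℝ≥0∞ := gaussianReal 0 1 (Ioo (-1 : ℝ) 1) with hq
  have hq1 : q < 1 := gaussianReal_Ioo_lt_one
  obtain ⟨L, hL⟩ : ∃ L : ℕ, q ^ L < 8⁻¹ :=
    ((ENNReal.tendsto_pow_atTop_nhds_zero_of_lt_one hq1).eventually_lt_const
      (by simp)).exists
  refine ⟨L, ?_⟩
  have hm : ∀ jk, Measurable (hW.wienerIntegral (e jk)) := fun jk =>
    hW.measurable_wienerIntegral _
  set E : ℕ → ℤ → Set Ω := fun j m => ⋂ i : Fin (L * j),
    (hW.wienerIntegral (e (j, m + (i : ℕ)))) ⁻¹' Ioo (-1 : ℝ) 1 with hE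
  have hPE : ∀ j m, P (E j m) = q ^ (L * j) := by
    intro j m
    have hind := hW.iIndepFun_wienerIntegral
      (he.comp (fun i : Fin (L * j) => ((j : ℤ), m + ((i : ℕ) : ℤ))) fun a b h => by
        simp only [Prod.mk.injEq, add_right_inj, Nat.cast_inj, true_and] at h
        exact Fin.ext h)
    simp only [hE]
    simp only [Function.comp_apply] at hind
    rw [hind.meas_iInter fun i => ⟨Ioo (-1) 1, measurableSet_Ioo, rfl⟩]
    have : ∀ i : Fin (L * j), P ((hW.wienerIntegral (e (j, m + (i : ℕ)))) ⁻¹' Ioo (-1 : ℝ) 1) = q :=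
      fun i => by
        rw [hq, ← hW.map_wienerIntegral (he.1 (j, m + (i : ℕ))), Measure.map_apply (hm _)
          measurableSet_Ioo]
    rw [Finset.prod_congr rfl fun i _ => this i]
    simp
  set A : ℕ → Set Ω := fun j => ⋃ m ∈ Finset.Icc (-(4 ^ j) : ℤ) (4 ^ j), E j m with hA
  have hPA : ∀ j, P (A j) ≤ 3 * (2⁻¹ : ℝ≥0∞) ^ j := by
    intro j
    refine (measure_biUnion_finset_le _ _).trans ?_
    simp only [hPE, Finset.sum_const, Int.card_Icc, nsmul_eq_mul]
    have h1 : ((4 ^ j + 1 - -4 ^ j : ℤ).toNat : ℝ≥0∞) ≤ 3 * 4 ^ j := by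
      have : (4 ^ j + 1 - -4 ^ j : ℤ).toNat ≤ 3 * 4 ^ j := by
        have : (1 : ℤ) ≤ 4 ^ j := one_le_pow₀ (by norm_num)
        have h4 : ((4 ^ j : ℕ) : ℤ) = 4 ^ j := by push_cast; rfl
        omega
      exact_mod_cast this
    have h2 : q ^ (L * j) ≤ (8⁻¹ : ℝ≥0∞) ^ j := by
      rw [pow_mul]
      gcongr
    calc _ ≤ 3 * 4 ^ j * (8⁻¹ : ℝ≥0∞) ^ j := mul_le_mul' h1 h2
      _ = 3 * (4 * 8⁻¹ : ℝ≥0∞) ^ j := by rw [mul_assoc, mul_pow]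
      _ = 3 * (2⁻¹ : ℝ≥0∞) ^ j := by
        congr 2
        rw [show (8 : ℝ≥0∞) = 4 * 2 by norm_num, ENNReal.mul_inv (by simp) (by simp), ← mul_assoc,
          ENNReal.mul_inv_cancel (by simp) (by simp), one_mul]
  have hsum : ∑' j, P (A j) ≠ ∞ := by
    refine ne_top_of_le_ne_top ?_ (ENNReal.tsum_le_tsum hPA)
    rw [ENNReal.tsum_mul_left, ENNReal.tsum_geometric]
    refine ENNReal.mul_ne_top (by simp) ?_
    simp
  filter_upwards [ae_eventually_notMem hsum] with ω hω
  filter_upwards [hω] with j hj m hmj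
  by_contra hc
  push Not at hc
  refine hj ?_
  simp only [hA, mem_iUnion]
  refine ⟨m, Finset.mem_Icc.2 (abs_le.1 hmj), ?_⟩
  simp only [hE, mem_iInter, mem_preimage]
  exact fun i => abs_lt.1 (hc i i.2)

/-! ### Fractional primitives with a complex exponent -/

/-- `∫₀^∞ u ^ (z - 1/2) ψ(y - u) du`, the extension of `fractionalPrimitive` to complex `z`. -/
def complexPrimitive (ψ : 𝓢(ℝ, ℝ)) (y : ℝ) (z : ℂ) : ℂ :=
  ∫ u in Ioi (0 : ℝ), (u : ℂ) ^ (z - 1 / 2) * (ψ (y - u) : ℂ)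

/-- `ψ` has iterated antiderivatives of every order in the Schwartz class. -/
def HasSchwartzPrimitives (ψ : 𝓢(ℝ, ℝ)) : Prop :=
  ∀ m : ℕ, ∃ φ : 𝓢(ℝ, ℝ), (SchwartzMap.derivCLM ℝ ℝ)^[m] φ = ψ

theorem HasSchwartzPrimitives.deriv {ψ : 𝓢(ℝ, ℝ)} (h : HasSchwartzPrimitives ψ) :
    HasSchwartzPrimitives (SchwartzMap.derivCLM ℝ ℝ ψ) := fun m => by
  obtain ⟨φ, rfl⟩ := h m
  exact ⟨SchwartzMap.derivCLM ℝ ℝ φ, by rw [← Function.iterate_succ_apply,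
    Function.iterate_succ_apply']⟩

theorem one_add_abs_le_mul (y u : ℝ) : 1 + |y| ≤ (1 + |u|) * (1 + |y - u|) := by
  have h := abs_add_le (y - u) u
  rw [sub_add_cancel] at h
  nlinarith [mul_nonneg (abs_nonneg u) (abs_nonneg (y - u))]

theorem inv_one_add_abs_pow_le (y u : ℝ) (n : ℕ) :
    ((1 + |y - u|) ^ n)⁻¹ ≤ (1 + |u|) ^ n * ((1 + |y|) ^ n)⁻¹ := by
  rw [← div_eq_mul_inv, le_div_iff₀ (by positivity), inv_mul_le_iff₀ (by positivity), mul_comm,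
    ← mul_pow]
  exact pow_le_pow_left₀ (by positivity) (one_add_abs_le_mul y u) n

theorem inv_one_add_abs_pow_le' (y u : ℝ) (n : ℕ) :
    ((1 + |y - u|) ^ n)⁻¹ ≤ (1 + |y|) ^ n * ((1 + |u|) ^ n)⁻¹ := by
  have := inv_one_add_abs_pow_le u y n
  rwa [abs_sub_comm] at this

theorem SchwartzMap.exists_decay (ψ : 𝓢(ℝ, ℝ)) (n : ℕ) :
    ∃ C > 0, ∀ x, |ψ x| ≤ C * ((1 + |x|) ^ n)⁻¹ := by
  have h := fun x => SchwartzMap.one_add_le_sup_seminorm_apply (𝕜 := ℝ) (m := (n, 0)) (k := n)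
    (n := 0) le_rfl le_rfl ψ x
  set A := 2 ^ (n, 0).1 * ((Finset.Iic (n, 0)).sup fun m => SchwartzMap.seminorm ℝ m.1 m.2) ψ
  have hA : 0 ≤ A := (h 0).trans' (by positivity)
  refine ⟨A + 1, by positivity, fun x => ?_⟩
  rw [← div_eq_mul_inv, le_div_iff₀ (by positivity), mul_comm]
  have := h x
  rw [norm_iteratedFDeriv_zero, Real.norm_eq_abs, Real.norm_eq_abs] at this
  exact this.trans (le_add_of_nonneg_right zero_le_one)

theorem integrable_inv_one_add_abs_sq : Integrable fun x : ℝ => ((1 + |x|) ^ 2)⁻¹ := by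
  refine integrable_inv_one_add_sq.mono' (Measurable.aestronglyMeasurable (by fun_prop))
    (Eventually.of_forall fun x => ?_)
  rw [Real.norm_of_nonneg (by positivity)]
  refine inv_anti₀ (by positivity) ?_
  rw [← sq_abs x]
  nlinarith [abs_nonneg x]

theorem norm_ofReal_cpow_of_pos {u : ℝ} (hu : 0 < u) (a : ℂ) : ‖(u : ℂ) ^ a‖ = u ^ a.re :=
  Complex.norm_cpow_eq_rpow_re_of_pos hu a

theorem integrableOn_cpow_mul_of_decay {f : ℝ → ℂ} (hf : Continuous f) {a : ℂ} (ha : -1 < a.re)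
    {n : ℕ} (hn : a.re + 1 < n) {C : ℝ} (hC : 0 ≤ C) (hfC : ∀ u, ‖f u‖ ≤ C * ((1 + |u|) ^ n)⁻¹) :
    IntegrableOn (fun u : ℝ => (u : ℂ) ^ a * f u) (Ioi 0) := by
  have h := mellinConvergent_of_isBigO_rpow (a := n) (b := 0)
    (f := f) (s := a + 1) (hf.locallyIntegrable.locallyIntegrableOn _) ?_ (by simpa using hn) ?_
    (by simpa using by linarith)
  · refine (h.congr_fun (fun u hu => ?_) measurableSet_Ioi)
    simp
  · refine Asymptotics.IsBigO.of_bound C ?_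
    filter_upwards [eventually_gt_atTop 0] with u hu
    rw [Real.norm_of_nonneg (by positivity)]
    refine (hfC _).trans ?_
    gcongr
    rw [Real.rpow_neg hu.le, Real.rpow_natCast]
    refine inv_anti₀ (by positivity) (pow_le_pow_left₀ hu.le ?_ _)
    rw [abs_of_pos hu]
    linarith
  · refine Asymptotics.IsBigO.of_bound C ?_
    filter_upwards [self_mem_nhdsWithin] with u hu
    rw [neg_zero, Real.rpow_zero, norm_one, mul_one]
    refine (hfC _).trans (mul_le_of_le_one_right hC (inv_le_one_of_one_le₀ ?_))
    exact one_le_pow₀ (by linarith [abs_nonneg u])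

theorem integrableOn_cpow_mul_schwartz (ψ : 𝓢(ℝ, ℝ)) (y : ℝ) {a : ℂ} (ha : -1 < a.re) :
    IntegrableOn (fun u : ℝ => (u : ℂ) ^ a * (ψ (y - u) : ℂ)) (Ioi 0) := by
  obtain ⟨C, hC, hψ⟩ := ψ.exists_decay (⌈|a.re|⌉₊ + 2)
  have hcont : Continuous fun u : ℝ => (ψ (y - u) : ℂ) := by
    have := ψ.continuous
    fun_prop
  refine integrableOn_cpow_mul_of_decay hcont ha (n := ⌈|a.re|⌉₊ + 2)
    (C := C * (1 + |y|) ^ (⌈|a.re|⌉₊ + 2)) ?_ (by positivity) fun u => ?_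
  · have := Nat.le_ceil |a.re|
    push_cast
    linarith [le_abs_self a.re]
  · rw [Complex.norm_real, Real.norm_eq_abs, mul_assoc]
    refine (hψ _).trans ?_
    gcongr
    exact inv_one_add_abs_pow_le' y u _

theorem integrableOn_Ioi_one_cpow_mul_schwartz (ψ : 𝓢(ℝ, ℝ)) (y : ℝ) (a : ℂ) :
    IntegrableOn (fun u : ℝ => (u : ℂ) ^ a * (ψ (y - u) : ℂ)) (Ioi 1) := by
  have h := (integrableOn_cpow_mul_schwartz ψ y (a := (|a.re| : ℝ)) (by
    rw [Complex.ofReal_re]; linarith [abs_nonneg a.re])).mono_set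
    (Ioi_subset_Ioi (zero_le_one (α := ℝ)))
  have hcont : ContinuousOn (fun u : ℝ => (u : ℂ) ^ a * (ψ (y - u) : ℂ)) (Ioi 1) := by
    have h2 : Continuous fun u : ℝ => (ψ (y - u) : ℂ) := by
      have := ψ.continuous
      fun_prop
    refine ContinuousOn.mul (fun u hu => ?_) h2.continuousOn
    exact (Complex.continuousAt_ofReal_cpow_const u a
      (Or.inr (by linarith [show (1 : ℝ) < u from hu]))).continuousWithinAt
  refine h.norm.mono' (hcont.aestronglyMeasurable measurableSet_Ioi) ?_
  refine (ae_restrict_iff' measurableSet_Ioi).2 (Eventually.of_forall fun u hu => ?_)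
  have hu : (1 : ℝ) < u := hu
  rw [norm_mul, norm_mul, norm_ofReal_cpow_of_pos (by linarith), norm_ofReal_cpow_of_pos (by linarith),
    Complex.ofReal_re]
  gcongr
  · exact hu.le
  · exact le_abs_self _

/-- Integration by parts away from the singularity of the power, so that no condition on `a` is
needed and the step can be iterated. -/
theorem integral_Ioi_one_cpow_deriv (ψ : 𝓢(ℝ, ℝ)) (y : ℝ) (a : ℂ) :
    ∫ u in Ioi (1 : ℝ), (u : ℂ) ^ a * (SchwartzMap.derivCLM ℝ ℝ ψ (y - u) : ℂ) =
      (ψ (y - 1) : ℂ) + a * ∫ u in Ioi (1 : ℝ), (u : ℂ) ^ (a - 1) * (ψ (y - u) : ℂ) := by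
  have hu : ∀ x ∈ Ioi (1 : ℝ), HasDerivAt (fun u : ℝ => (u : ℂ) ^ a) (a * (x : ℂ) ^ (a - 1)) x := by
    intro x hx
    have hx0 : (0 : ℝ) < x := zero_lt_one.trans hx
    by_cases ha : a = 0
    · subst ha
      simpa using hasDerivAt_const x (1 : ℂ)
    · have h := (hasDerivAt_id (x : ℂ)).cpow_const (c := a) (Or.inl (by simpa using hx0))
      simpa using h.comp_ofReal
  have hv : ∀ x : ℝ, HasDerivAt (fun u : ℝ => -(ψ (y - u) : ℂ))
      (SchwartzMap.derivCLM ℝ ℝ ψ (y - x) : ℂ) x := by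
    intro x
    have h := ((ψ.hasDerivAt (y - x)).comp_const_sub y x).ofReal_comp.neg
    rw [SchwartzMap.derivCLM_apply]
    refine h.congr_deriv ?_
    push_cast
    ring
  have hint : IntegrableOn ((fun u : ℝ => a * (u : ℂ) ^ (a - 1)) * fun u : ℝ => -(ψ (y - u) : ℂ))
      (Ioi 1) := by
    refine ((integrableOn_Ioi_one_cpow_mul_schwartz ψ y (a - 1)).const_mul (-a)).congr
      (Eventually.of_forall fun u => ?_)
    simp
    ring
  have hlim1 : Tendsto ((fun u : ℝ => (u : ℂ) ^ a) * fun u : ℝ => -(ψ (y - u) : ℂ)) (𝓝[>] 1)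
      (𝓝 (-(ψ (y - 1) : ℂ))) := by
    have h1 : ContinuousAt ((fun u : ℝ => (u : ℂ) ^ a) * fun u : ℝ => -(ψ (y - u) : ℂ)) 1 :=
      (Complex.continuousAt_ofReal_cpow_const 1 a (Or.inr one_ne_zero)).mul (hv 1).continuousAt
    have h2 := h1.tendsto.mono_left (nhdsWithin_le_nhds (s := Ioi 1))
    simpa using h2
  have hlim2 : Tendsto ((fun u : ℝ => (u : ℂ) ^ a) * fun u : ℝ => -(ψ (y - u) : ℂ)) atTop (𝓝 0) := by
    set n := ⌈|a.re|⌉₊ with hn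
    obtain ⟨C, hC, hψ⟩ := ψ.exists_decay (n + 1)
    have h0 : Tendsto (fun u : ℝ => C * (1 + |y|) ^ (n + 1) * u⁻¹) atTop (𝓝 0) := by
      simpa using tendsto_inv_atTop_zero.const_mul (C * (1 + |y|) ^ (n + 1))
    refine squeeze_zero_norm' ?_ h0
    filter_upwards [eventually_gt_atTop 1] with u hu
    have hu0 : (0 : ℝ) < u := zero_lt_one.trans hu
    rw [Pi.mul_apply, norm_mul, norm_neg, Complex.norm_real, norm_ofReal_cpow_of_pos hu0,
      Real.norm_eq_abs]
    have h1 : u ^ a.re ≤ u ^ n := by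
      rw [← Real.rpow_natCast]
      exact Real.rpow_le_rpow_of_exponent_le hu.le ((le_abs_self _).trans (Nat.le_ceil _))
    have h2 : |ψ (y - u)| ≤ C * ((1 + |y|) ^ (n + 1) * (u ^ (n + 1))⁻¹) := by
      refine (hψ _).trans ?_
      gcongr
      refine (inv_one_add_abs_pow_le' y u _).trans ?_
      gcongr
      rw [abs_of_pos hu0]
      linarith
    calc u ^ a.re * |ψ (y - u)| ≤ u ^ n * (C * ((1 + |y|) ^ (n + 1) * (u ^ (n + 1))⁻¹)) := by
          gcongr
      _ = C * (1 + |y|) ^ (n + 1) * u⁻¹ := by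
        rw [pow_succ u]
        field_simp
  rw [integral_Ioi_mul_deriv_eq_deriv_mul hu (fun x _ => hv x)
    (integrableOn_Ioi_one_cpow_mul_schwartz _ y a) hint hlim1 hlim2, ← integral_const_mul,
    zero_sub, neg_neg, sub_eq_add_neg, ← integral_neg]
  congr 1
  refine integral_congr_ae (Eventually.of_forall fun u => ?_)
  simp only
  ring

/-- Each integration by parts removes one derivative from `φ` and lowers the exponent by one,
leaving a boundary term that is Schwartz in `y`. After `m` of them the exponent has real part at
most `-N`, and convolving such a power with a Schwartz function gives decay of order `N`. The radius
`R` is quantified so that the induction can pass to `a - 1`. -/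
theorem exists_bound_integral_Ioi_one (m : ℕ) : ∀ (N : ℕ) (φ : 𝓢(ℝ, ℝ)) (R : ℝ), ∃ C > 0,
    ∀ a : ℂ, ‖a‖ ≤ R → a.re ≤ m - N → ∀ y : ℝ,
      ‖∫ u in Ioi (1 : ℝ), (u : ℂ) ^ a * ((SchwartzMap.derivCLM ℝ ℝ)^[m] φ (y - u) : ℂ)‖ ≤
        C * ((1 + |y|) ^ N)⁻¹ := by
  induction m with
  | zero =>
    intro N φ R
    obtain ⟨C, hC, hφ⟩ := φ.exists_decay (N + 2)
    set I := ∫ x : ℝ, ((1 + |x|) ^ 2)⁻¹ with hI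
    have hI0 : 0 ≤ I := integral_nonneg fun x => by positivity
    refine ⟨C * 2 ^ N * (I + 1), by positivity, fun a _ ha y => ?_⟩
    simp only [Nat.cast_zero, zero_sub, Function.iterate_zero, id_eq] at ha ⊢
    have hg : Integrable fun u : ℝ => C * 2 ^ N * ((1 + |y|) ^ N)⁻¹ * ((1 + |y - u|) ^ 2)⁻¹ :=
      (integrable_inv_one_add_abs_sq.comp_sub_left y).const_mul _
    refine (norm_integral_le_of_norm_le hg.integrableOn
      ((ae_restrict_iff' measurableSet_Ioi).2 (Eventually.of_forall fun u hu => ?_))).trans ?_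
    · have hu : (1 : ℝ) < u := hu
      have hu0 : (0 : ℝ) < u := by linarith
      rw [norm_mul, norm_ofReal_cpow_of_pos hu0, Complex.norm_real, Real.norm_eq_abs]
      have h1 : u ^ a.re ≤ 2 ^ N * ((1 + |u|) ^ N)⁻¹ := by
        calc u ^ a.re ≤ u ^ (-(N : ℝ)) := Real.rpow_le_rpow_of_exponent_le hu.le ha
          _ = (u ^ N)⁻¹ := by rw [Real.rpow_neg hu0.le, Real.rpow_natCast]
          _ ≤ _ := by
            rw [← div_eq_mul_inv, ← div_pow, ← inv_pow]
            refine pow_le_pow_left₀ (by positivity) ?_ _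
            rw [abs_of_pos hu0, inv_eq_one_div, div_le_div_iff₀ hu0 (by linarith)]
            linarith
      have h2 := inv_one_add_abs_pow_le y (y - u) N
      have h3 : ((1 + |u|) ^ N)⁻¹ * ((1 + |y - u|) ^ N)⁻¹ ≤ ((1 + |y|) ^ N)⁻¹ := by
        rw [← mul_inv, ← mul_pow]
        exact inv_anti₀ (by positivity)
          (pow_le_pow_left₀ (by positivity) (one_add_abs_le_mul y u) N)
      calc u ^ a.re * |φ (y - u)|
          ≤ (2 ^ N * ((1 + |u|) ^ N)⁻¹) * (C * ((1 + |y - u|) ^ (N + 2))⁻¹) := by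
            gcongr
            exact hφ _
        _ = C * 2 ^ N * (((1 + |u|) ^ N)⁻¹ * ((1 + |y - u|) ^ N)⁻¹) * ((1 + |y - u|) ^ 2)⁻¹ := by
            rw [pow_add, mul_inv]
            ring
        _ ≤ C * 2 ^ N * ((1 + |y|) ^ N)⁻¹ * ((1 + |y - u|) ^ 2)⁻¹ := by gcongr
    · refine (setIntegral_le_integral hg (Eventually.of_forall fun u => by positivity)).trans ?_
      rw [integral_const_mul]
      have e := integral_sub_left_eq_self (fun x : ℝ => ((1 + |x|) ^ 2)⁻¹) volume y
      rw [e, ← hI]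
      have : 0 ≤ C * 2 ^ N * ((1 + |y|) ^ N)⁻¹ := by positivity
      nlinarith
  | succ m ih =>
    intro N φ R
    obtain ⟨C, hC, h⟩ := ih N φ (R + 1)
    obtain ⟨C', hC', h'⟩ := ((SchwartzMap.derivCLM ℝ ℝ)^[m] φ).exists_decay N
    refine ⟨C' * 2 ^ N + |R| * C, by positivity, fun a haR ha y => ?_⟩
    simp only [Function.iterate_succ_apply']
    rw [integral_Ioi_one_cpow_deriv]
    refine (norm_add_le _ _).trans ?_
    rw [add_mul]
    refine add_le_add ?_ ?_
    · rw [Complex.norm_real, Real.norm_eq_abs]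
      refine (h' _).trans ?_
      rw [mul_assoc]
      gcongr
      have := inv_one_add_abs_pow_le y 1 N
      rw [abs_one] at this
      norm_num at this ⊢
      exact this
    · rw [norm_mul, mul_assoc]
      have h1 := h (a - 1) ((norm_sub_le _ _).trans (by rw [norm_one]; linarith)) (by
        rw [Complex.sub_re, Complex.one_re]
        push_cast at ha
        linarith) y
      have h2 : ‖a‖ ≤ |R| := haR.trans (le_abs_self R)
      gcongr

/-- On `(0, 1]` the singularity is at worst `u^(-1/2)` and `ψ(y - u)` decays directly; on `(1, ∞)`,
where the power does not decay enough by itself, the antiderivatives of `ψ` are used. -/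
theorem HasSchwartzPrimitives.exists_bound {ψ : 𝓢(ℝ, ℝ)} (hψ : HasSchwartzPrimitives ψ) (N : ℕ) :
    ∃ C > 0, ∀ z : ℂ, 0 ≤ z.re → z.re ≤ 1 → |z.im| ≤ 1 → ∀ y : ℝ,
      ‖complexPrimitive ψ y z‖ ≤ C * ((1 + |y|) ^ N)⁻¹ := by
  obtain ⟨φ, hφ⟩ := hψ (N + 1)
  -- With `N + 1` antiderivatives the exponent may have real part up to 1, and here it is at most
  -- `1/2`; the radius 3 dominates `|z - 1/2| ≤ 1 + 1 + 1/2`.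
  obtain ⟨C, hC, h⟩ := exists_bound_integral_Ioi_one (N + 1) N φ 3
  obtain ⟨C', hC', h'⟩ := ψ.exists_decay N
  rw [hφ] at h
  refine ⟨C' * 2 ^ N * 2 + C, by positivity, fun z hz0 hz1 hz2 y => ?_⟩
  have hre : (z - 1 / 2).re = z.re - 1 / 2 := by simp
  have hint := integrableOn_cpow_mul_schwartz ψ y (a := z - 1 / 2) (by rw [hre]; linarith)
  rw [complexPrimitive, ← Ioc_union_Ioi_eq_Ioi (zero_le_one (α := ℝ)),
    setIntegral_union (Ioc_disjoint_Ioi le_rfl) measurableSet_Ioi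
    (hint.mono_set Ioc_subset_Ioi_self) (hint.mono_set (Ioi_subset_Ioi zero_le_one))]
  refine (norm_add_le _ _).trans ?_
  rw [add_mul]
  refine add_le_add ?_ ?_
  · have hg : IntegrableOn (fun u : ℝ => C' * 2 ^ N * ((1 + |y|) ^ N)⁻¹ * u ^ (-(1 / 2) : ℝ))
        (Ioc 0 1) := by
      have := intervalIntegral.intervalIntegrable_rpow' (a := 0) (b := 1)
        (r := -(1 / 2 : ℝ)) (by norm_num)
      exact ((intervalIntegrable_iff_integrableOn_Ioc_of_le zero_le_one).1 this).const_mul _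
    refine (norm_integral_le_of_norm_le hg
      ((ae_restrict_iff' measurableSet_Ioc).2 (Eventually.of_forall fun u hu => ?_))).trans ?_
    · rw [norm_mul, norm_ofReal_cpow_of_pos hu.1, Complex.norm_real, Real.norm_eq_abs, mul_comm]
      have h1 : u ^ (z - 1 / 2).re ≤ u ^ (-(1 / 2) : ℝ) :=
        Real.rpow_le_rpow_of_exponent_ge hu.1 hu.2 (by rw [hre]; linarith)
      have h2 : |ψ (y - u)| ≤ C' * 2 ^ N * ((1 + |y|) ^ N)⁻¹ := by
        refine (h' _).trans ?_
        rw [mul_assoc]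
        gcongr
        refine (inv_one_add_abs_pow_le y u N).trans ?_
        gcongr
        rw [abs_of_pos hu.1]
        linarith [hu.2]
      have h3 : 0 ≤ u ^ (z - 1 / 2).re := Real.rpow_nonneg hu.1.le _
      gcongr
    · rw [integral_const_mul, ← intervalIntegral.integral_of_le zero_le_one,
        integral_rpow (Or.inl (by norm_num))]
      norm_num
      rw [mul_right_comm]
  · refine h (z - 1 / 2) ?_ (by rw [hre]; push_cast; linarith) y
    refine (norm_sub_le _ _).trans ?_
    have := Complex.norm_le_abs_re_add_abs_im z
    rw [abs_of_nonneg hz0] at this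
    norm_num
    linarith

/-- The primitive is the Mellin transform of `u ↦ ψ(y - u)` at `z + 1/2`. -/
theorem differentiableAt_complexPrimitive (ψ : 𝓢(ℝ, ℝ)) (y : ℝ) {z : ℂ} (hz : 0 ≤ z.re) :
    DifferentiableAt ℂ (complexPrimitive ψ y) z := by
  obtain ⟨C, hC, hψ⟩ := ψ.exists_decay (⌈z.re⌉₊ + 2)
  have hcont : Continuous fun u : ℝ => (ψ (y - u) : ℂ) := by
    have := ψ.continuous
    fun_prop
  have h := mellin_differentiableAt_of_isBigO_rpow (a := (⌈z.re⌉₊ + 2 : ℕ)) (b := 0)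
    (f := fun u : ℝ => (ψ (y - u) : ℂ)) (s := z + 1 / 2)
    (hcont.locallyIntegrable.locallyIntegrableOn _) ?_ ?_ ?_ ?_
  · have e : complexPrimitive ψ y = mellin (fun u : ℝ => (ψ (y - u) : ℂ)) ∘ fun z => z + 1 / 2 := by
      funext z
      rw [complexPrimitive, Function.comp_apply, mellin]
      refine integral_congr_ae (Eventually.of_forall fun u => ?_)
      simp only [smul_eq_mul]
      congr 2
      ring
    rw [e]
    exact h.comp z (by fun_prop)
  · refine Asymptotics.IsBigO.of_bound (C * (1 + |y|) ^ (⌈z.re⌉₊ + 2)) ?_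
    filter_upwards [eventually_gt_atTop 0] with u hu
    rw [Complex.norm_real, Real.norm_eq_abs, Real.norm_of_nonneg (by positivity)]
    refine (hψ _).trans ?_
    rw [mul_assoc]
    gcongr
    refine (inv_one_add_abs_pow_le' y u _).trans ?_
    gcongr
    rw [Real.rpow_neg hu.le, Real.rpow_natCast]
    refine inv_anti₀ (by positivity) (pow_le_pow_left₀ hu.le ?_ _)
    rw [abs_of_pos hu]
    linarith
  · have := Nat.le_ceil z.re
    push_cast
    simp
    linarith
  · refine Asymptotics.IsBigO.of_bound C ?_
    filter_upwards [self_mem_nhdsWithin] with u hu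
    rw [Complex.norm_real, neg_zero, Real.rpow_zero, norm_one, mul_one, Real.norm_eq_abs]
    refine (hψ _).trans (mul_le_of_le_one_right hC.le (inv_le_one_of_one_le₀ ?_))
    exact one_le_pow₀ (by linarith [abs_nonneg (y - u)])
  · simp
    linarith

theorem complexPrimitive_ofReal (ψ : 𝓢(ℝ, ℝ)) (y θ : ℝ) :
    complexPrimitive ψ y θ = fractionalPrimitive ψ y θ := by
  rw [complexPrimitive, fractionalPrimitive, ← integral_sub_left_eq_self _ volume y,
    ← integral_complex_ofReal, ← integral_indicator measurableSet_Ioi]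
  refine integral_congr_ae (Eventually.of_forall fun u => ?_)
  simp only [sub_sub_cancel, posPow]
  by_cases hu : 0 < u
  · rw [indicator_of_mem (show u ∈ Ioi 0 from hu), if_pos hu, Complex.ofReal_mul,
      Complex.ofReal_cpow hu.le]
    push_cast
    rfl
  · rw [indicator_of_notMem (show u ∉ Ioi 0 from hu), if_neg hu]
    simp

theorem hasDerivAt_complexPrimitive (ψ : 𝓢(ℝ, ℝ)) (y : ℝ) {z : ℂ} (hz : 0 ≤ z.re) :
    HasDerivAt (fun y => complexPrimitive ψ y z)
      (complexPrimitive (SchwartzMap.derivCLM ℝ ℝ ψ) y z) y := by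
  have hre : (z - 1 / 2).re = z.re - 1 / 2 := by simp
  have ha : -1 < (z - 1 / 2).re := by rw [hre]; linarith
  set n := ⌈z.re⌉₊ + 2 with hn
  obtain ⟨C, hC, hψ⟩ := (SchwartzMap.derivCLM ℝ ℝ ψ).exists_decay n
  have hgc : Continuous fun u : ℝ => ((C * (2 + |y|) ^ n * ((1 + |u|) ^ n)⁻¹ : ℝ) : ℂ) := by
    refine Complex.continuous_ofReal.comp (continuous_const.mul (Continuous.inv₀ (by fun_prop) ?_))
    intro u
    positivity
  have hg := integrableOn_cpow_mul_of_decay (a := z - 1 / 2) hgc ha (n := n)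
    (C := C * (2 + |y|) ^ n) (by
      have := Nat.le_ceil z.re
      rw [hre, hn]
      push_cast
      linarith) (by positivity)
    (fun u => by rw [Complex.norm_real, Real.norm_of_nonneg (by positivity)])
  refine (hasDerivAt_integral_of_dominated_loc_of_deriv_le
    (F := fun (y : ℝ) (u : ℝ) => (u : ℂ) ^ (z - 1 / 2) * (ψ (y - u) : ℂ))
    (F' := fun (y : ℝ) (u : ℝ) => (u : ℂ) ^ (z - 1 / 2) * (SchwartzMap.derivCLM ℝ ℝ ψ (y - u) : ℂ))
    (Metric.ball_mem_nhds y zero_lt_one)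
    (Eventually.of_forall fun x => (integrableOn_cpow_mul_schwartz ψ x ha).aestronglyMeasurable)
    (integrableOn_cpow_mul_schwartz ψ y ha)
    (integrableOn_cpow_mul_schwartz _ y ha).aestronglyMeasurable ?_ hg.norm ?_).2
  · refine (ae_restrict_iff' measurableSet_Ioi).2 (Eventually.of_forall fun u hu x hx => ?_)
    rw [norm_mul, norm_mul, Complex.norm_real, Complex.norm_real, Real.norm_eq_abs,
      Real.norm_of_nonneg (by positivity)]
    gcongr
    refine (hψ _).trans ?_
    rw [mul_assoc]
    gcongr
    rw [Metric.mem_ball, Real.dist_eq] at hx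
    have hb : 1 + |x| ≤ 2 + |y| := by linarith [abs_sub_abs_le_abs_sub x y]
    exact (inv_one_add_abs_pow_le' x u n).trans (mul_le_mul_of_nonneg_right
      (pow_le_pow_left₀ (by positivity) hb n) (by positivity))
  · refine Eventually.of_forall fun u x _ => ?_
    have h := ((ψ.hasDerivAt (x - u)).comp_sub_const x u).ofReal_comp
    rw [SchwartzMap.derivCLM_apply]
    exact h.const_mul _

/-- Far points use the decay of each value; points within distance 1 use the mean value theorem, the
derivative in `y` being the primitive of `ψ'`, which decays equally fast. The factor `min 1 |x - y|`
is what produces the Hölder exponent in `scale_factor_le`. -/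
theorem HasSchwartzPrimitives.exists_increment_bound {ψ : 𝓢(ℝ, ℝ)} (hψ : HasSchwartzPrimitives ψ)
    (N : ℕ) : ∃ C > 0, ∀ z : ℂ, 0 ≤ z.re → z.re ≤ 1 → |z.im| ≤ 1 → ∀ x y : ℝ,
      ‖complexPrimitive ψ x z - complexPrimitive ψ y z‖ ≤
        C * min 1 |x - y| * (((1 + |x|) ^ N)⁻¹ + ((1 + |y|) ^ N)⁻¹) := by
  obtain ⟨C, hC, h⟩ := hψ.exists_bound N
  obtain ⟨C', hC', h'⟩ := hψ.deriv.exists_bound N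
  refine ⟨C + C' * 2 ^ N, by positivity, fun z h0 h1 h2 x y => ?_⟩
  have p1 : 0 ≤ ((1 + |x|) ^ N)⁻¹ := by positivity
  have p2 : 0 ≤ ((1 + |y|) ^ N)⁻¹ := by positivity
  rcases le_total 1 |x - y| with hxy | hxy
  · rw [min_eq_left hxy, mul_one]
    refine (norm_sub_le _ _).trans ((add_le_add (h z h0 h1 h2 x) (h z h0 h1 h2 y)).trans ?_)
    rw [← mul_add]
    gcongr
    linarith [show (0 : ℝ) < C' * 2 ^ N by positivity]
  · rw [min_eq_right hxy]
    have hmv := (convex_uIcc x y).norm_image_sub_le_of_norm_hasDerivWithin_le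
      (f := fun y => complexPrimitive ψ y z) (C := C' * 2 ^ N * ((1 + |x|) ^ N)⁻¹)
      (fun w _ => (hasDerivAt_complexPrimitive ψ w h0).hasDerivWithinAt)
      (fun w hw => by
        refine (h' z h0 h1 h2 w).trans ?_
        rw [mul_assoc]
        gcongr
        have hwx : |x - w| ≤ 1 := by
          rw [abs_sub_comm]
          exact (abs_sub_left_of_mem_uIcc hw).trans (by rwa [abs_sub_comm])
        have := inv_one_add_abs_pow_le x (x - w) N
        rw [sub_sub_cancel] at this
        refine this.trans ?_
        gcongr
        linarith)
      right_mem_uIcc left_mem_uIcc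
    rw [Real.norm_eq_abs] at hmv
    refine hmv.trans ?_
    have p3 : 0 ≤ |x - y| := abs_nonneg _
    calc C' * 2 ^ N * ((1 + |x|) ^ N)⁻¹ * |x - y|
        ≤ C' * 2 ^ N * |x - y| * (((1 + |x|) ^ N)⁻¹ + ((1 + |y|) ^ N)⁻¹) := by
          rw [mul_right_comm]
          gcongr
          linarith
      _ ≤ _ := by
          gcongr
          linarith

/-! ### Wavelet series with slowly growing coefficients -/

/-- All powers of the coefficients are dominated by `2 ^ |j| (1 + |k|) ^ 2`. -/
def IsSlowlyGrowing (c : ℤ × ℤ → ℝ) : Prop :=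
  ∀ p : ℕ, ∃ C : ℝ, ∀ jk : ℤ × ℤ, |c jk| ^ p ≤ C * (2 ^ jk.1.natAbs * (1 + |(jk.2 : ℝ)|) ^ 2)

theorem IsSlowlyGrowing.exists_bound {c : ℤ × ℤ → ℝ} (hc : IsSlowlyGrowing c) {δ : ℝ} (hδ : 0 < δ) :
    ∃ C > 0, ∀ jk : ℤ × ℤ, |c jk| ≤ C * (((2 : ℝ) ^ jk.1.natAbs) ^ δ * (1 + |(jk.2 : ℝ)|) ^ δ) := by
  -- With `pδ > 2`, the `p`-th root of `2^|j| (1+|k|)^2` has both exponents below `δ`.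
  obtain ⟨p, hp⟩ := exists_nat_gt (2 / δ)
  have hp0 : (0 : ℝ) < p := (by positivity : (0 : ℝ) < 2 / δ).trans hp
  have hpδ : 2 < p * δ := by rwa [div_lt_iff₀ hδ] at hp
  have hpn : p ≠ 0 := by rintro rfl; simp at hp0
  obtain ⟨C, hC⟩ := hc p
  refine ⟨(|C| + 1) ^ (1 / (p : ℝ)), by positivity, fun jk => ?_⟩
  set Y : ℝ := (2 : ℝ) ^ jk.1.natAbs with hY
  have hY1 : 1 ≤ Y := one_le_pow₀ one_le_two
  set K : ℝ := 1 + |(jk.2 : ℝ)| with hK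
  have hK1 : 1 ≤ K := by rw [hK]; linarith [abs_nonneg (jk.2 : ℝ)]
  have hY0 : 0 < Y := by linarith
  have hK0 : 0 < K := by linarith
  refine le_of_pow_le_pow_left₀ hpn (by positivity) ((hC jk).trans ?_)
  rw [mul_pow, mul_pow, ← Real.rpow_natCast ((|C| + 1) ^ (1 / (p : ℝ))) p,
    ← Real.rpow_natCast (Y ^ δ),
    ← Real.rpow_natCast (K ^ δ), ← Real.rpow_mul (by positivity), ← Real.rpow_mul hY0.le,
    ← Real.rpow_mul hK0.le, one_div, inv_mul_cancel₀ hp0.ne', Real.rpow_one]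
  have h1 : Y ≤ Y ^ (δ * p) := by
    conv_lhs => rw [← Real.rpow_one Y]
    exact Real.rpow_le_rpow_of_exponent_le hY1 (by linarith)
  have h2 : K ^ 2 ≤ K ^ (δ * p) := by
    rw [← Real.rpow_natCast]
    exact Real.rpow_le_rpow_of_exponent_le hK1 (by push_cast; linarith)
  have h3 : C ≤ |C| + 1 := by linarith [le_abs_self C]
  gcongr

/-- The weights `2 ^ (-δ|j|) (1 + |y_j - k|) ^ (-2)`. -/
def shiftedWeight (δ : ℝ) (y : ℤ → ℝ) (jk : ℤ × ℤ) : ℝ :=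
  (((2 : ℝ) ^ jk.1.natAbs) ^ δ)⁻¹ * ((1 + |y jk.1 - jk.2|) ^ 2)⁻¹

theorem shiftedWeight_nonneg (δ : ℝ) (y : ℤ → ℝ) (jk : ℤ × ℤ) : 0 ≤ shiftedWeight δ y jk := by
  unfold shiftedWeight
  positivity

theorem summable_shiftedWeight_zero {δ : ℝ} (hδ : 0 < δ) : Summable (shiftedWeight δ fun _ => 0) := by
  have h1 : Summable fun j : ℤ => (((2 : ℝ) ^ j.natAbs) ^ δ)⁻¹ := by
    have h : Summable fun n : ℕ => (((2 : ℝ) ^ n) ^ δ)⁻¹ := by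
      have h2 : (((2 : ℝ) ^ δ)⁻¹) < 1 := inv_lt_one_of_one_lt₀ (Real.one_lt_rpow one_lt_two hδ)
      refine (summable_geometric_of_lt_one (by positivity) h2).congr fun n => ?_
      rw [inv_pow, ← Real.rpow_natCast, ← Real.rpow_natCast, ← Real.rpow_mul zero_le_two,
        ← Real.rpow_mul zero_le_two, mul_comm]
    exact Summable.of_nat_of_neg (by simpa using h) (by simpa using h)
  have h2 : Summable fun k : ℤ => ((1 + |(0 : ℝ) - k|) ^ 2)⁻¹ := by
    have : Summable fun n : ℕ => ((1 + (n : ℝ)) ^ 2)⁻¹ := by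
      have h := (summable_nat_add_iff 1).2 (Real.summable_one_div_nat_pow.2 one_lt_two)
      simpa [add_comm] using h
    exact Summable.of_nat_of_neg (by simpa using this) (by simpa using this)
  exact h1.mul_of_nonneg h2 (fun j => by positivity) (fun k => by positivity)

/-- Translating `k` by `⌊y_j⌋` at each scale reduces to zero shift; the fractional part at most
doubles `1 + |y_j - k|`, whence the factor `4`. The uniformity in `y` makes the series bounds
uniform in time. -/
theorem summable_shiftedWeight {δ : ℝ} (hδ : 0 < δ) (y : ℤ → ℝ) :
    Summable (shiftedWeight δ y) ∧
      ∑' jk, shiftedWeight δ y jk ≤ 4 * ∑' jk, shiftedWeight δ (fun _ => 0) jk := by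
  set e : ℤ × ℤ ≃ ℤ × ℤ :=
    { toFun := fun jk => (jk.1, jk.2 - ⌊y jk.1⌋)
      invFun := fun jk => (jk.1, jk.2 + ⌊y jk.1⌋)
      left_inv := fun jk => by simp
      right_inv := fun jk => by simp } with he
  have hle : ∀ jk, shiftedWeight δ y jk ≤ 4 * shiftedWeight δ (fun _ => 0) (e jk) := fun jk => by
    have h1 : ((1 + |y jk.1 - jk.2|) ^ 2)⁻¹ ≤ 4 * ((1 + |(0 : ℝ) - (e jk).2|) ^ 2)⁻¹ := by
      rw [← div_eq_mul_inv, inv_eq_one_div, div_le_div_iff₀ (by positivity) (by positivity), one_mul]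
      have h2 : 1 + |(0 : ℝ) - (e jk).2| ≤ 2 * (1 + |y jk.1 - jk.2|) := by
        have h3 : (0 : ℝ) - (e jk).2 = (y jk.1 - jk.2) - (y jk.1 - ⌊y jk.1⌋) := by
          simp only [he, Equiv.coe_fn_mk]
          push_cast
          ring
        have h4 := abs_sub (y jk.1 - jk.2) (y jk.1 - ⌊y jk.1⌋)
        have h5 : |y jk.1 - ⌊y jk.1⌋| ≤ 1 := by
          rw [abs_of_nonneg (sub_nonneg.2 (Int.floor_le _))]
          linarith [Int.lt_floor_add_one (y jk.1)]
        rw [h3]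
        linarith [abs_nonneg (y jk.1 - jk.2)]
      calc (1 + |(0 : ℝ) - (e jk).2|) ^ 2 ≤ (2 * (1 + |y jk.1 - jk.2|)) ^ 2 :=
            pow_le_pow_left₀ (by positivity) h2 2
        _ = _ := by ring
    unfold shiftedWeight
    calc _ ≤ (((2 : ℝ) ^ jk.1.natAbs) ^ δ)⁻¹ * (4 * ((1 + |(0 : ℝ) - (e jk).2|) ^ 2)⁻¹) := by gcongr
      _ = _ := by
        simp only [he, Equiv.coe_fn_mk]
        ring
  have hs := (((e.summable_iff).2 (summable_shiftedWeight_zero hδ)).mul_left 4)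
  have hs' := hs.of_nonneg_of_le (shiftedWeight_nonneg δ y) hle
  refine ⟨hs', (hs'.tsum_le_tsum hle hs).trans (le_of_eq ?_)⟩
  rw [tsum_mul_left]
  congr 1
  exact e.tsum_eq _

/-- The `(j, k)` term of the increment between `s` and `t` of the wavelet series, at the complex
parameter `z`. -/
def incrementTerm (ψ : 𝓢(ℝ, ℝ)) (c : ℤ × ℤ → ℝ) (t s : ℝ) (z : ℂ) (jk : ℤ × ℤ) : ℂ :=
  (2 : ℂ) ^ (-(jk.1 : ℂ) * z) * c jk *
    (complexPrimitive ψ ((2 : ℝ) ^ jk.1 * t - jk.2) z -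
      complexPrimitive ψ ((2 : ℝ) ^ jk.1 * s - jk.2) z)

/-- Fine scales (`j ≥ 0`) use `min 1 x ≤ x^(σ - 3δ)`: of the three lost `δ`, one pays for the growth
of the coefficients in `j`, one for that in `k`, and one is left for summability. Coarse scales use
`min 1 x ≤ x`, leaving `2^(|j|(σ + δ - 1))`, which `2δ ≤ 1 - σ` makes summable. -/
theorem scale_factor_le {δ σ h T : ℝ} (hδ : 0 < δ) (hδ1 : 3 * δ ≤ σ) (hδ2 : 2 * δ ≤ 1 - σ)
    (hh : 0 ≤ h) (hT : 0 ≤ T) (j : ℤ) :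
    ((2 : ℝ) ^ j) ^ (-σ) * ((2 : ℝ) ^ j.natAbs) ^ δ * min 1 (2 ^ j * h) * (1 + 2 ^ j * T) ^ δ ≤
      (1 + T) * (h ^ (σ - 3 * δ) + h) * (((2 : ℝ) ^ j.natAbs) ^ δ)⁻¹ := by
  have hT1 : 1 ≤ 1 + T := by linarith
  have hTδ : (1 + T) ^ δ ≤ 1 + T := by
    conv_rhs => rw [← Real.rpow_one (1 + T)]
    exact Real.rpow_le_rpow_of_exponent_le hT1 (by linarith)
  set Y : ℝ := (2 : ℝ) ^ j.natAbs with hY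
  have hY1 : 1 ≤ Y := one_le_pow₀ one_le_two
  have hY0 : 0 < Y := by linarith
  have hhs : 0 ≤ h ^ (σ - 3 * δ) := Real.rpow_nonneg hh _
  rcases le_total 0 j with hj | hj
  · have hX : (2 : ℝ) ^ j = Y := by
      rw [hY, ← zpow_natCast, Int.natAbs_of_nonneg hj]
    rw [hX]
    have h1 : min 1 (Y * h) ≤ Y ^ (σ - 3 * δ) * h ^ (σ - 3 * δ) := by
      rw [← Real.mul_rpow hY0.le hh]
      rcases le_total 1 (Y * h) with h2 | h2
      · exact (min_le_left _ _).trans (Real.one_le_rpow h2 (by linarith))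
      · refine (min_le_right _ _).trans ?_
        rcases (mul_nonneg hY0.le hh).eq_or_lt with h3 | h3
        · rw [← h3]
          exact Real.rpow_nonneg le_rfl _
        · conv_lhs => rw [← Real.rpow_one (Y * h)]
          exact Real.rpow_le_rpow_of_exponent_ge h3 h2 (by linarith)
    have h2 : (1 + Y * T) ^ δ ≤ Y ^ δ * (1 + T) := by
      calc (1 + Y * T) ^ δ ≤ (Y * (1 + T)) ^ δ :=
            Real.rpow_le_rpow (by positivity) (by nlinarith) hδ.le
        _ = Y ^ δ * (1 + T) ^ δ := Real.mul_rpow hY0.le (by linarith)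
        _ ≤ _ := by gcongr
    have h0 : 0 ≤ min 1 (Y * h) := le_min zero_le_one (by positivity)
    calc Y ^ (-σ) * Y ^ δ * min 1 (Y * h) * (1 + Y * T) ^ δ
        ≤ Y ^ (-σ) * Y ^ δ * (Y ^ (σ - 3 * δ) * h ^ (σ - 3 * δ)) * (Y ^ δ * (1 + T)) := by gcongr
      _ = (1 + T) * h ^ (σ - 3 * δ) * (Y ^ (-σ) * Y ^ δ * Y ^ (σ - 3 * δ) * Y ^ δ) := by ring
      _ = (1 + T) * h ^ (σ - 3 * δ) * (Y ^ δ)⁻¹ := by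
        rw [← Real.rpow_add hY0, ← Real.rpow_add hY0, ← Real.rpow_add hY0, ← Real.rpow_neg hY0.le]
        ring_nf
      _ ≤ _ := by
        gcongr
        linarith
  · have hX : (2 : ℝ) ^ j = Y⁻¹ := by
      rw [hY, ← zpow_natCast, ← zpow_neg]
      congr 1
      omega
    rw [hX]
    have h1 : (1 + Y⁻¹ * T) ^ δ ≤ 1 + T := by
      refine (Real.rpow_le_rpow (by positivity) ?_ hδ.le).trans hTδ
      have : Y⁻¹ ≤ 1 := inv_le_one_of_one_le₀ hY1
      nlinarith
    have h0 : 0 ≤ min 1 (Y⁻¹ * h) := le_min zero_le_one (by positivity)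
    calc Y⁻¹ ^ (-σ) * Y ^ δ * min 1 (Y⁻¹ * h) * (1 + Y⁻¹ * T) ^ δ
        ≤ Y⁻¹ ^ (-σ) * Y ^ δ * (Y⁻¹ * h) * (1 + T) := by
          gcongr
          exact min_le_right _ _
      _ = (1 + T) * h * (Y ^ σ * Y ^ δ * Y ^ (-1 : ℝ)) := by
        rw [Real.inv_rpow hY0.le, Real.rpow_neg hY0.le, inv_inv, Real.rpow_neg_one]
        ring
      _ ≤ (1 + T) * h * (Y ^ δ)⁻¹ := by
        rw [← Real.rpow_add hY0, ← Real.rpow_add hY0, ← Real.rpow_neg hY0.le]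
        gcongr
        · linarith
      _ ≤ _ := by
        gcongr
        linarith

theorem exists_incrementTerm_bound {ψ : 𝓢(ℝ, ℝ)} (hψ : HasSchwartzPrimitives ψ)
    {c : ℤ × ℤ → ℝ} (hc : IsSlowlyGrowing c) {δ a b : ℝ} (hδ : 0 < δ) (hδa : 3 * δ ≤ a)
    (hδb : 2 * δ ≤ 1 - b) : ∃ C > 0, ∀ z : ℂ, a ≤ z.re → z.re ≤ b → |z.im| ≤ 1 → ∀ t s T : ℝ,
      |t| ≤ T → |s| ≤ T → ∀ jk : ℤ × ℤ, ‖incrementTerm ψ c t s z jk‖ ≤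
        C * ((1 + T) * (|t - s| ^ (z.re - 3 * δ) + |t - s|)) *
          (shiftedWeight δ (fun j => 2 ^ j * t) jk + shiftedWeight δ (fun j => 2 ^ j * s) jk) := by
  obtain ⟨C₁, hC₁, h₁⟩ := hc.exists_bound hδ
  -- Decay of order 3: one power absorbs `(1 + |k|)^δ`, two remain for summability in `k`.
  obtain ⟨C₂, hC₂, h₂⟩ := hψ.exists_increment_bound 3
  refine ⟨C₁ * C₂, by positivity, fun z hza hzb hzi t s T htT hsT jk => ?_⟩
  have hT : 0 ≤ T := (abs_nonneg t).trans htT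
  obtain ⟨j, k⟩ := jk
  set X : ℝ := (2 : ℝ) ^ j with hX
  have hX0 : 0 < X := by positivity
  set Y : ℝ := (2 : ℝ) ^ j.natAbs with hY
  have hY0 : 0 < Y := by positivity
  have hn : ‖(2 : ℂ) ^ (-(j : ℂ) * z)‖ = X ^ (-z.re) := by
    have := Complex.norm_cpow_eq_rpow_re_of_pos (two_pos (α := ℝ)) (-(j : ℂ) * z)
    rw [Complex.ofReal_ofNat] at this
    rw [this, hX, ← Real.rpow_intCast, ← Real.rpow_mul zero_le_two]
    congr 1
    simp
  have hg : ∀ t : ℝ, |t| ≤ T → (1 + |(k : ℝ)|) ^ δ * ((1 + |X * t - k|) ^ 3)⁻¹ ≤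
      (1 + X * T) ^ δ * ((1 + |X * t - k|) ^ 2)⁻¹ := by
    intro t ht
    set g := 1 + |X * t - k| with hg
    have hg1 : 1 ≤ g := by rw [hg]; linarith [abs_nonneg (X * t - k)]
    have hg0 : 0 < g := by linarith
    have h3 : 1 + |(k : ℝ)| ≤ (1 + X * T) * g := by
      have := one_add_abs_le_mul (k : ℝ) (X * t)
      rw [abs_sub_comm, abs_mul, abs_of_pos hX0] at this
      refine this.trans ?_
      gcongr
    have h4 : (1 + |(k : ℝ)|) ^ δ ≤ (1 + X * T) ^ δ * g := by
      calc (1 + |(k : ℝ)|) ^ δ ≤ ((1 + X * T) * g) ^ δ :=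
            Real.rpow_le_rpow (by positivity) h3 hδ.le
        _ = (1 + X * T) ^ δ * g ^ δ := Real.mul_rpow (by positivity) hg0.le
        _ ≤ _ := by
          gcongr
          conv_rhs => rw [← Real.rpow_one g]
          exact Real.rpow_le_rpow_of_exponent_le hg1 (by linarith)
    calc _ ≤ (1 + X * T) ^ δ * g * (g ^ 3)⁻¹ := by gcongr
      _ = (1 + X * T) ^ δ * (g ^ 2)⁻¹ := by
        field_simp
  have hd := h₂ z (by linarith) (by linarith) hzi (X * t - k) (X * s - k)
  have e1 : |X * t - k - (X * s - k)| = X * |t - s| := by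
    rw [sub_sub_sub_cancel_right, ← mul_sub, abs_mul, abs_of_pos hX0]
  rw [e1] at hd
  have hm0 : 0 ≤ min 1 (X * |t - s|) := le_min zero_le_one (by positivity)
  have hk0 : 0 ≤ (1 + |(k : ℝ)|) ^ δ := by positivity
  have hsf := scale_factor_le hδ (by linarith : 3 * δ ≤ z.re) (by linarith) (abs_nonneg (t - s)) hT j
  rw [← hX, ← hY] at hsf
  unfold incrementTerm
  rw [norm_mul, norm_mul, hn, Complex.norm_real, Real.norm_eq_abs]
  have h₁' := h₁ (j, k)
  simp only [← hY] at h₁'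
  calc X ^ (-z.re) * |c (j, k)| * ‖complexPrimitive ψ (X * t - k) z - complexPrimitive ψ (X * s - k) z‖
      ≤ X ^ (-z.re) * (C₁ * (Y ^ δ * (1 + |(k : ℝ)|) ^ δ)) * (C₂ * min 1 (X * |t - s|) *
        (((1 + |X * t - k|) ^ 3)⁻¹ + ((1 + |X * s - k|) ^ 3)⁻¹)) := by gcongr
    _ = C₁ * C₂ * (X ^ (-z.re) * Y ^ δ * min 1 (X * |t - s|)) *
        ((1 + |(k : ℝ)|) ^ δ * ((1 + |X * t - k|) ^ 3)⁻¹ +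
          (1 + |(k : ℝ)|) ^ δ * ((1 + |X * s - k|) ^ 3)⁻¹) := by ring
    _ ≤ C₁ * C₂ * (X ^ (-z.re) * Y ^ δ * min 1 (X * |t - s|)) *
        ((1 + X * T) ^ δ * ((1 + |X * t - k|) ^ 2)⁻¹ +
          (1 + X * T) ^ δ * ((1 + |X * s - k|) ^ 2)⁻¹) := by
      exact mul_le_mul_of_nonneg_left (add_le_add (hg t htT) (hg s hsT)) (by positivity)
    _ = C₁ * C₂ * (X ^ (-z.re) * Y ^ δ * min 1 (X * |t - s|) * (1 + X * T) ^ δ) *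
        (((1 + |X * t - k|) ^ 2)⁻¹ + ((1 + |X * s - k|) ^ 2)⁻¹) := by ring
    _ ≤ C₁ * C₂ * ((1 + T) * (|t - s| ^ (z.re - 3 * δ) + |t - s|) * (Y ^ δ)⁻¹) *
        (((1 + |X * t - k|) ^ 2)⁻¹ + ((1 + |X * s - k|) ^ 2)⁻¹) := by gcongr
    _ = _ := by
      simp only [shiftedWeight, ← hY, ← hX]
      ring

/-! ### The sum of the wavelet series -/

/-- The sum of the wavelet series at time `t` and complex parameter `z`. -/
def waveletSeries (ψ : 𝓢(ℝ, ℝ)) (c : ℤ × ℤ → ℝ) (t : ℝ) (z : ℂ) : ℂ :=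
  ∑' jk, incrementTerm ψ c t 0 z jk

theorem incrementTerm_sub (ψ : 𝓢(ℝ, ℝ)) (c : ℤ × ℤ → ℝ) (t s : ℝ) (z : ℂ) (jk : ℤ × ℤ) :
    incrementTerm ψ c t 0 z jk - incrementTerm ψ c s 0 z jk = incrementTerm ψ c t s z jk := by
  unfold incrementTerm
  ring

theorem exists_sum_incrementTerm_bound {ψ : 𝓢(ℝ, ℝ)} (hψ : HasSchwartzPrimitives ψ)
    {c : ℤ × ℤ → ℝ} (hc : IsSlowlyGrowing c) {δ a b : ℝ} (hδ : 0 < δ) (hδa : 3 * δ ≤ a)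
    (hδb : 2 * δ ≤ 1 - b) : ∃ C > 0, ∀ z : ℂ, a ≤ z.re → z.re ≤ b → |z.im| ≤ 1 → ∀ t s T : ℝ,
      |t| ≤ T → |s| ≤ T → (Summable fun jk => ‖incrementTerm ψ c t s z jk‖) ∧
        ∑' jk, ‖incrementTerm ψ c t s z jk‖ ≤
          C * ((1 + T) * (|t - s| ^ (z.re - 3 * δ) + |t - s|)) := by
  obtain ⟨C, hC, h⟩ := exists_incrementTerm_bound hψ hc hδ hδa hδb
  set S := ∑' jk, shiftedWeight δ (fun _ => 0) jk
  have hS : 0 ≤ S := tsum_nonneg fun jk => shiftedWeight_nonneg _ _ _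
  refine ⟨C * (8 * S + 1), by positivity, fun z h1 h2 h3 t s T ht hs => ?_⟩
  obtain ⟨hs1, hs2⟩ := summable_shiftedWeight hδ fun j => 2 ^ j * t
  obtain ⟨hs3, hs4⟩ := summable_shiftedWeight hδ fun j => 2 ^ j * s
  have hT : 0 ≤ T := (abs_nonneg t).trans ht
  set D := C * ((1 + T) * (|t - s| ^ (z.re - 3 * δ) + |t - s|))
  have hD : 0 ≤ D := by positivity
  have hb := (hs1.add hs3).mul_left D
  have hsum := hb.of_nonneg_of_le (fun jk => norm_nonneg _) (h z h1 h2 h3 t s T ht hs)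
  refine ⟨hsum, (hsum.tsum_le_tsum (h z h1 h2 h3 t s T ht hs) hb).trans ?_⟩
  rw [tsum_mul_left, hs1.tsum_add hs3]
  calc _ ≤ D * (4 * S + 4 * S) := by gcongr
    _ ≤ D * (8 * S + 1) := by
      refine mul_le_mul_of_nonneg_left (by linarith) hD
    _ = _ := by ring

theorem exists_admissible_exponent {a b : ℝ} (ha : 0 < a) (hb : b < 1) {η : ℝ} (hη : 0 < η) :
    ∃ δ > 0, 3 * δ ≤ a ∧ 2 * δ ≤ 1 - b ∧ 3 * δ ≤ η := by
  refine ⟨min (a / 3) (min ((1 - b) / 2) (η / 3)), ?_, ?_, ?_, ?_⟩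
  · exact lt_min (by linarith) (lt_min (by linarith) (by linarith))
  · linarith [min_le_left (a / 3) (min ((1 - b) / 2) (η / 3))]
  · linarith [(min_le_right (a / 3) (min ((1 - b) / 2) (η / 3))).trans (min_le_left _ _)]
  · linarith [(min_le_right (a / 3) (min ((1 - b) / 2) (η / 3))).trans (min_le_right _ _)]

/-- The open rectangle of complex parameters. -/
def parameterStrip : Set ℂ := {z | 0 < z.re ∧ z.re < 1 ∧ |z.im| < 1}

theorem isOpen_parameterStrip : IsOpen parameterStrip :=
  (isOpen_lt continuous_const Complex.continuous_re).inter
    ((isOpen_lt Complex.continuous_re continuous_const).inter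
      (isOpen_lt (continuous_abs.comp Complex.continuous_im) continuous_const))

theorem ofReal_mem_parameterStrip {θ : ℝ} (hθ : θ ∈ Ioo (0 : ℝ) 1) :
    (θ : ℂ) ∈ parameterStrip := by
  refine ⟨?_, ?_, ?_⟩ <;> simp [hθ.1, hθ.2]

theorem summable_incrementTerm {ψ : 𝓢(ℝ, ℝ)} (hψ : HasSchwartzPrimitives ψ)
    {c : ℤ × ℤ → ℝ} (hc : IsSlowlyGrowing c) {z : ℂ} (hz : z ∈ parameterStrip) (t s : ℝ) :
    Summable (incrementTerm ψ c t s z) := by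
  obtain ⟨δ, hδ, h1, h2, -⟩ := exists_admissible_exponent hz.1 hz.2.1 one_pos
  obtain ⟨C, -, h⟩ := exists_sum_incrementTerm_bound hψ hc hδ h1 h2
  exact (h z le_rfl le_rfl hz.2.2.le t s (max |t| |s|) (le_max_left _ _) (le_max_right _ _)).1.of_norm

theorem waveletSeries_sub {ψ : 𝓢(ℝ, ℝ)} (hψ : HasSchwartzPrimitives ψ)
    {c : ℤ × ℤ → ℝ} (hc : IsSlowlyGrowing c) {z : ℂ} (hz : z ∈ parameterStrip) (t s : ℝ) :
    waveletSeries ψ c t z - waveletSeries ψ c s z = ∑' jk, incrementTerm ψ c t s z jk := by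
  unfold waveletSeries
  rw [← (summable_incrementTerm hψ hc hz t 0).tsum_sub (summable_incrementTerm hψ hc hz s 0)]
  exact tsum_congr fun jk => incrementTerm_sub ψ c t s z jk

theorem exists_waveletSeries_sub_bound {ψ : 𝓢(ℝ, ℝ)} (hψ : HasSchwartzPrimitives ψ)
    {c : ℤ × ℤ → ℝ} (hc : IsSlowlyGrowing c) {δ a b : ℝ} (hδ : 0 < δ) (hδa : 3 * δ ≤ a)
    (hδb : 2 * δ ≤ 1 - b) : ∃ C > 0, ∀ z ∈ parameterStrip, a ≤ z.re → z.re ≤ b → ∀ t s T : ℝ,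
      |t| ≤ T → |s| ≤ T → ‖waveletSeries ψ c t z - waveletSeries ψ c s z‖ ≤
          C * ((1 + T) * (|t - s| ^ (z.re - 3 * δ) + |t - s|)) := by
  obtain ⟨C, hC, h⟩ := exists_sum_incrementTerm_bound hψ hc hδ hδa hδb
  refine ⟨C, hC, fun z hz h1 h2 t s T ht hs => ?_⟩
  rw [waveletSeries_sub hψ hc hz]
  obtain ⟨g1, g2⟩ := h z h1 h2 hz.2.2.le t s T ht hs
  exact (norm_tsum_le_tsum_norm g1).trans g2

theorem waveletSeries_zero (ψ : 𝓢(ℝ, ℝ)) (c : ℤ × ℤ → ℝ) (z : ℂ) : waveletSeries ψ c 0 z = 0 := by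
  simp [waveletSeries, incrementTerm]

theorem rpow_le_one_add {h r : ℝ} (hh : 0 ≤ h) (h0 : 0 ≤ r) (h1 : r ≤ 1) : h ^ r ≤ 1 + h := by
  calc h ^ r ≤ (1 + h) ^ r := Real.rpow_le_rpow hh (by linarith) h0
    _ ≤ (1 + h) ^ (1 : ℝ) := Real.rpow_le_rpow_of_exponent_le (by linarith) h1
    _ = 1 + h := Real.rpow_one _

theorem differentiableOn_waveletSeries {ψ : 𝓢(ℝ, ℝ)} (hψ : HasSchwartzPrimitives ψ)
    {c : ℤ × ℤ → ℝ} (hc : IsSlowlyGrowing c) (t : ℝ) :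
    DifferentiableOn ℂ (waveletSeries ψ c t) parameterStrip := by
  intro z hz
  set a := z.re / 2 with ha
  set b := (z.re + 1) / 2 with hb
  have ha0 : 0 < a := by have := hz.1; positivity
  have hb1 : b < 1 := by have := hz.2.1; rw [hb]; linarith
  obtain ⟨δ, hδ, h1, h2, -⟩ := exists_admissible_exponent ha0 hb1 one_pos
  obtain ⟨C, hC, h⟩ := exists_incrementTerm_bound hψ hc hδ h1 h2
  set U : Set ℂ := {z | a < z.re ∧ z.re < b ∧ |z.im| < 1}
  have hU : IsOpen U := (isOpen_lt continuous_const Complex.continuous_re).inter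
    ((isOpen_lt Complex.continuous_re continuous_const).inter
      (isOpen_lt (continuous_abs.comp Complex.continuous_im) continuous_const))
  have hzU : z ∈ U := ⟨by rw [ha]; linarith [hz.1], by rw [hb]; linarith [hz.2.1], hz.2.2⟩
  obtain ⟨hs1, -⟩ := summable_shiftedWeight hδ fun j => 2 ^ j * t
  obtain ⟨hs3, -⟩ := summable_shiftedWeight hδ fun j => 2 ^ j * (0 : ℝ)
  have hd : DifferentiableOn ℂ (fun z => ∑' jk, incrementTerm ψ c t 0 z jk) U := by
    refine Complex.differentiableOn_tsum_of_summable_norm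
      ((hs1.add hs3).mul_left (C * ((1 + |t|) * ((1 + |t|) + |t|)))) (fun jk w hw => ?_) hU
      fun jk w hw => ?_
    · have hw0 : 0 ≤ w.re := by linarith [hw.1]
      refine DifferentiableAt.differentiableWithinAt ?_
      unfold incrementTerm
      refine DifferentiableAt.mul (DifferentiableAt.mul ?_ (differentiableAt_const _))
        ((differentiableAt_complexPrimitive ψ _ hw0).sub (differentiableAt_complexPrimitive ψ _ hw0))
      exact DifferentiableAt.const_cpow (by fun_prop) (Or.inl two_ne_zero)
    · refine (h w hw.1.le hw.2.1.le hw.2.2.le t 0 |t| le_rfl (by simp) jk).trans ?_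
      have := shiftedWeight_nonneg δ (fun j => 2 ^ j * t) jk
      have := shiftedWeight_nonneg δ (fun j => 2 ^ j * (0 : ℝ)) jk
      rw [sub_zero]
      gcongr
      exact rpow_le_one_add (abs_nonneg t) (by linarith [hw.1]) (by linarith [hw.2.1])
  exact (hd.differentiableAt (hU.mem_nhds hzU)).differentiableWithinAt

/-! ### Real derivatives of holomorphic functions -/

theorem iteratedDeriv_re_ofReal {U : Set ℂ} (hU : IsOpen U) {f : ℂ → ℂ}
    (hf : DifferentiableOn ℂ f U) (n : ℕ) : ∀ x : ℝ, (x : ℂ) ∈ U →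
      iteratedDeriv n (fun θ : ℝ => (f θ).re) x = (iteratedDeriv n f x).re := by
  induction n with
  | zero => intro x _; simp
  | succ n ih =>
    intro x hx
    rw [iteratedDeriv_succ, iteratedDeriv_succ]
    have hev : iteratedDeriv n (fun θ : ℝ => (f θ).re) =ᶠ[𝓝 x]
        fun y : ℝ => (iteratedDeriv n f y).re := by
      filter_upwards [(hU.preimage Complex.continuous_ofReal).mem_nhds hx] with y hy
      exact ih y hy
    rw [hev.deriv_eq]
    have han := (hf.analyticOnNhd hU) x hx
    have hd : HasDerivAt (iteratedDeriv n f) (deriv (iteratedDeriv n f) x) (x : ℂ) := by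
      rw [iteratedDeriv_eq_iterate]
      exact (han.iterated_deriv n).differentiableAt.hasDerivAt
    exact hd.real_of_complex.deriv

theorem contDiffOn_re_ofReal {U : Set ℂ} (hU : IsOpen U) {f : ℂ → ℂ}
    (hf : DifferentiableOn ℂ f U) {s : Set ℝ} (hs : ∀ x ∈ s, (x : ℂ) ∈ U) (n : ℕ∞) :
    ContDiffOn ℝ n (fun θ : ℝ => (f θ).re) s := by
  have h1 : ContDiffOn ℝ n f U := (hf.contDiffOn hU).restrict_scalars ℝ
  exact Complex.reCLM.contDiff.comp_contDiffOn
    (h1.comp Complex.ofRealCLM.contDiff.contDiffOn hs)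

/-! ### Moduli of continuity of the wavelet series -/

theorem rpow_le_rpow_mul {h L p q R : ℝ} (hh : 0 < h) (hL : h ≤ L) (hL1 : 1 ≤ L) (hpq : q ≤ p)
    (hR : p - q ≤ R) : h ^ p ≤ L ^ R * h ^ q := by
  calc h ^ p = h ^ (p - q) * h ^ q := by rw [← Real.rpow_add hh, sub_add_cancel]
    _ ≤ L ^ (p - q) * h ^ q := by
      gcongr
    _ ≤ _ := by
      gcongr

/-- Cauchy's estimate on a circle of radius `r` about `θ`, applied to the holomorphic increment
between `s` and `t`. On that circle `Re z - 3δ ≥ θ - r - 3δ ≥ θ - ε`, since `r` and `3δ` are at most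
`ε / 2`; thus every derivative inherits the modulus. -/
theorem exists_iteratedDeriv_waveletSeries_sub_bound {ψ : 𝓢(ℝ, ℝ)} (hψ : HasSchwartzPrimitives ψ)
    {c : ℤ × ℤ → ℝ} (hc : IsSlowlyGrowing c) (n : ℕ) {a b ε : ℝ} (ha : 0 < a) (hb : b < 1)
    (hε : 0 < ε) (M : ℝ) : ∃ C > 0, ∀ θ ∈ Icc a b, ∀ t ∈ Icc (-M) M, ∀ s ∈ Icc (-M) M,
      ‖iteratedDeriv n (waveletSeries ψ c t) θ - iteratedDeriv n (waveletSeries ψ c s) θ‖ ≤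
        C * |t - s| ^ (θ - ε) := by
  obtain ⟨r, hr, hra, hrb, hrε, hr1⟩ : ∃ r > 0, r ≤ a / 2 ∧ r ≤ (1 - b) / 2 ∧ r ≤ ε / 2 ∧ r ≤ 1 / 2 :=
    ⟨min (min (a / 2) ((1 - b) / 2)) (min (ε / 2) (1 / 2)),
      lt_min (lt_min (by linarith) (by linarith)) (lt_min (by linarith) (by norm_num)),
      (min_le_left _ _).trans (min_le_left _ _), (min_le_left _ _).trans (min_le_right _ _),
      (min_le_right _ _).trans (min_le_left _ _), (min_le_right _ _).trans (min_le_right _ _)⟩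
  obtain ⟨δ, hδ, h1, h2, h3⟩ := exists_admissible_exponent (a := a - r) (b := b + r) (η := ε / 2)
    (by linarith) (by linarith) (by linarith)
  obtain ⟨C, hC, h⟩ := exists_waveletSeries_sub_bound hψ hc hδ h1 h2
  -- An upper bound for `|t - s|` that is at least 1. As `|t - s|` may exceed 1, lowering an
  -- exponent costs a power of `L`, and the drops below are at most `2 + ε`.
  set L := 1 + 2 * |M| with hL
  set D := C * ((1 + |M|) * (L ^ (2 + ε) + L ^ (2 + ε))) with hD
  have hL1 : 1 ≤ L := by rw [hL]; linarith [abs_nonneg M]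
  refine ⟨n.factorial * D / r ^ n, by positivity, fun θ hθ t ht s hs => ?_⟩
  have hball : Metric.closedBall (θ : ℂ) r ⊆
      parameterStrip ∩ {z | a - r ≤ z.re ∧ z.re ≤ b + r ∧ |z.re - θ| ≤ r} := by
    intro z hz
    rw [Metric.mem_closedBall, dist_eq_norm] at hz
    have e1 := (Complex.abs_re_le_norm (z - θ)).trans hz
    have e2 := (Complex.abs_im_le_norm (z - θ)).trans hz
    simp only [Complex.sub_re, Complex.ofReal_re, Complex.sub_im, Complex.ofReal_im, sub_zero] at e1 e2
    obtain ⟨e3, e4⟩ := abs_le.1 e1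
    exact ⟨⟨by linarith [hθ.1], by linarith [hθ.2], by linarith⟩, by linarith [hθ.1],
      by linarith [hθ.2], e1⟩
  have han : ∀ t, ContDiffAt ℂ n (waveletSeries ψ c t) θ := fun t =>
    ((differentiableOn_waveletSeries hψ hc t).analyticOnNhd isOpen_parameterStrip θ
      (hball (Metric.mem_closedBall_self hr.le)).1).contDiffAt
  rw [← iteratedDeriv_fun_sub (han t) (han s)]
  rcases eq_or_ne t s with rfl | hts
  · simp only [sub_self]
    rw [iteratedDeriv_const]
    simp only [ite_self, norm_zero]
    positivity
  have hpos : 0 < |t - s| := abs_pos.2 (sub_ne_zero.2 hts)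
  have hMt : |t| ≤ |M| := (abs_le.2 ht).trans (le_abs_self M)
  have hMs : |s| ≤ |M| := (abs_le.2 hs).trans (le_abs_self M)
  have hle : |t - s| ≤ L := by
    have := abs_sub t s
    rw [hL]
    linarith
  have key := Complex.norm_iteratedDeriv_le_of_forall_mem_sphere_norm_le
    (f := fun z => waveletSeries ψ c t z - waveletSeries ψ c s z) (C := D * |t - s| ^ (θ - ε)) n hr
    (DifferentiableOn.diffContOnCl (by
      rw [closure_ball _ hr.ne']
      exact ((differentiableOn_waveletSeries hψ hc t).sub
        (differentiableOn_waveletSeries hψ hc s)).mono fun z hz => (hball hz).1)) fun z hz => ?_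
  · exact key.trans (le_of_eq (by ring))
  · obtain ⟨hz0, hz1, hz2, hz3⟩ := hball (Metric.sphere_subset_closedBall hz)
    obtain ⟨e3, e4⟩ := abs_le.1 hz3
    have h4 : |t - s| ^ (z.re - 3 * δ) ≤ L ^ (2 + ε) * |t - s| ^ (θ - ε) :=
      rpow_le_rpow_mul hpos hle hL1 (by linarith) (by linarith)
    have h5 : |t - s| ≤ L ^ (2 + ε) * |t - s| ^ (θ - ε) := by
      have := rpow_le_rpow_mul (p := 1) (q := θ - ε) (R := 2 + ε) hpos hle hL1
        (by linarith [hθ.2]) (by linarith [hθ.1])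
      rwa [Real.rpow_one] at this
    calc _ ≤ C * ((1 + |M|) * (|t - s| ^ (z.re - 3 * δ) + |t - s|)) :=
          h z hz0 hz1 hz2 t s |M| hMt hMs
      _ ≤ C * ((1 + |M|) * (L ^ (2 + ε) * |t - s| ^ (θ - ε) + L ^ (2 + ε) * |t - s| ^ (θ - ε))) := by
        gcongr
      _ = _ := by ring

theorem exists_iteratedDeriv_waveletSeries_bound {ψ : 𝓢(ℝ, ℝ)} (hψ : HasSchwartzPrimitives ψ)
    {c : ℤ × ℤ → ℝ} (hc : IsSlowlyGrowing c) (n : ℕ) {a b : ℝ} (ha : 0 < a) (hb : b < 1) {M : ℝ}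
    (hM : 0 < M) : ∃ C > 0, ∀ θ ∈ Icc a b, ∀ t ∈ Icc (-M) M,
      ‖iteratedDeriv n (waveletSeries ψ c t) θ‖ ≤ C := by
  -- The series vanishes at time 0, so an increment bound is a bound; the loss `a / 2` keeps the
  -- exponent `θ - a / 2` positive.
  obtain ⟨C, hC, h⟩ := exists_iteratedDeriv_waveletSeries_sub_bound hψ hc n ha hb (half_pos ha) M
  refine ⟨C * (1 + M), by positivity, fun θ hθ t ht => ?_⟩
  have h0 := h θ hθ t ht 0 ⟨by linarith, hM.le⟩
  have h1 : waveletSeries ψ c 0 = fun _ => 0 := funext fun z => waveletSeries_zero ψ c z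
  rw [h1, iteratedDeriv_const] at h0
  simp only [ite_self, sub_zero] at h0
  refine h0.trans (mul_le_mul_of_nonneg_left ?_ hC.le)
  refine (rpow_le_one_add (abs_nonneg t) (by linarith [hθ.1]) (by linarith [hθ.2])).trans ?_
  linarith [abs_le.2 ht]

/-- The path between the two points changes the time at the larger parameter, which produces `max θ₁
θ₂` in the exponent, and changes the parameter at the other time, where the bound on the next
derivative gives the Lipschitz term. -/
theorem exists_iteratedDeriv_waveletSeries_modulus {ψ : 𝓢(ℝ, ℝ)} (hψ : HasSchwartzPrimitives ψ)
    {c : ℤ × ℤ → ℝ} (hc : IsSlowlyGrowing c) (n : ℕ) {ε M a b : ℝ} (hε : 0 < ε) (hM : 0 < M)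
    (ha : 0 < a) (hb : b < 1) : ∃ C > 0, ∀ t₁ ∈ Icc (-M) M, ∀ θ₁ ∈ Icc a b,
      ∀ t₂ ∈ Icc (-M) M, ∀ θ₂ ∈ Icc a b,
        |iteratedDeriv n (fun θ : ℝ => (waveletSeries ψ c t₁ θ).re) θ₁ -
          iteratedDeriv n (fun θ : ℝ => (waveletSeries ψ c t₂ θ).re) θ₂| ≤
            C * (|t₁ - t₂| ^ (max θ₁ θ₂ - ε) + |θ₁ - θ₂|) := by
  obtain ⟨C₁, hC₁, h₁⟩ := exists_iteratedDeriv_waveletSeries_sub_bound hψ hc n ha hb hε M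
  obtain ⟨C₂, hC₂, h₂⟩ := exists_iteratedDeriv_waveletSeries_bound hψ hc (n + 1) ha hb hM
  have hstrip : ∀ θ ∈ Icc a b, (θ : ℂ) ∈ parameterStrip := fun θ hθ =>
    ofReal_mem_parameterStrip ⟨ha.trans_le hθ.1, hθ.2.trans_lt hb⟩
  have hre : ∀ t, ∀ θ ∈ Icc a b, iteratedDeriv n (fun θ : ℝ => (waveletSeries ψ c t θ).re) θ =
      (iteratedDeriv n (waveletSeries ψ c t) θ).re := fun t θ hθ =>
    iteratedDeriv_re_ofReal isOpen_parameterStrip (differentiableOn_waveletSeries hψ hc t) n θ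
      (hstrip θ hθ)
  have hlip : ∀ t ∈ Icc (-M) M, ∀ θ₁ ∈ Icc a b, ∀ θ₂ ∈ Icc a b,
      |(iteratedDeriv n (waveletSeries ψ c t) θ₁).re - (iteratedDeriv n (waveletSeries ψ c t) θ₂).re|
        ≤ C₂ * |θ₁ - θ₂| := by
    intro t ht θ₁ hθ₁ θ₂ hθ₂
    refine (convex_Icc a b).norm_image_sub_le_of_norm_hasDerivWithin_le
      (f := fun θ : ℝ => (iteratedDeriv n (waveletSeries ψ c t) θ).re)
      (f' := fun θ : ℝ => (iteratedDeriv (n + 1) (waveletSeries ψ c t) θ).re)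
      (fun θ hθ => ?_) (fun θ hθ => ?_) hθ₂ hθ₁
    · have han := (differentiableOn_waveletSeries hψ hc t).analyticOnNhd isOpen_parameterStrip θ
        (hstrip θ hθ)
      have hd := (han.iterated_deriv n).differentiableAt.hasDerivAt
      rw [← iteratedDeriv_eq_iterate, ← iteratedDeriv_succ] at hd
      exact hd.real_of_complex.hasDerivWithinAt
    · exact (Complex.abs_re_le_norm _).trans (h₂ θ hθ t ht)
  have hinc : ∀ θ ∈ Icc a b, ∀ t ∈ Icc (-M) M, ∀ s ∈ Icc (-M) M,
      |(iteratedDeriv n (waveletSeries ψ c t) θ).re - (iteratedDeriv n (waveletSeries ψ c s) θ).re|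
        ≤ C₁ * |t - s| ^ (θ - ε) := fun θ hθ t ht s hs => by
    rw [← Complex.sub_re]
    exact (Complex.abs_re_le_norm _).trans (h₁ θ hθ t ht s hs)
  have hsum : ∀ {x y A B : ℝ}, 0 ≤ A → 0 ≤ B → x ≤ C₁ * A → y ≤ C₂ * B →
      x + y ≤ (C₁ + C₂) * (A + B) := fun hA hB hx hy => by
    nlinarith [mul_nonneg hC₁.le hB, mul_nonneg hC₂.le hA]
  refine ⟨C₁ + C₂, by positivity, fun t₁ ht₁ θ₁ hθ₁ t₂ ht₂ θ₂ hθ₂ => ?_⟩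
  rw [hre t₁ θ₁ hθ₁, hre t₂ θ₂ hθ₂]
  rcases le_total θ₁ θ₂ with hle | hle
  · rw [max_eq_right hle]
    refine (abs_sub_le _ (iteratedDeriv n (waveletSeries ψ c t₁) θ₂).re _).trans ?_
    rw [add_comm]
    exact hsum (by positivity) (by positivity) (hinc θ₂ hθ₂ t₁ ht₁ t₂ ht₂) (hlip t₁ ht₁ θ₁ hθ₁ θ₂ hθ₂)
  · rw [max_eq_left hle]
    refine (abs_sub_le _ (iteratedDeriv n (waveletSeries ψ c t₂) θ₁).re _).trans ?_
    exact hsum (by positivity) (by positivity) (hinc θ₁ hθ₁ t₁ ht₁ t₂ ht₂) (hlip t₂ ht₂ θ₁ hθ₁ θ₂ hθ₂)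

theorem continuousOn_re_waveletSeries {ψ : 𝓢(ℝ, ℝ)} (hψ : HasSchwartzPrimitives ψ)
    {c : ℤ × ℤ → ℝ} (hc : IsSlowlyGrowing c) :
    ContinuousOn (fun p : ℝ × ℝ => (waveletSeries ψ c p.1 p.2).re) (univ ×ˢ Ioo (0 : ℝ) 1) := by
  rintro ⟨t, θ⟩ ⟨-, hθ⟩
  refine ContinuousAt.continuousWithinAt ?_
  set a := θ / 2 with ha
  set b := (θ + 1) / 2 with hb
  have hθ' : a < θ ∧ θ < b := ⟨by rw [ha]; linarith [hθ.1], by rw [hb]; linarith [hθ.2]⟩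
  have ha0 : 0 < a := half_pos hθ.1
  obtain ⟨C, hC, h⟩ := exists_iteratedDeriv_waveletSeries_modulus hψ hc 0 (half_pos ha0)
    (M := |t| + 1) (by positivity) ha0 (b := b) (by rw [hb]; linarith [hθ.2])
  simp only [iteratedDeriv_zero] at h
  have ht : t ∈ Icc (-(|t| + 1)) (|t| + 1) := abs_le.1 (by linarith)
  have hev : ∀ᶠ p : ℝ × ℝ in 𝓝 (t, θ), p.1 ∈ Icc (-(|t| + 1)) (|t| + 1) ∧ p.2 ∈ Icc a b := by
    refine prod_mem_nhds (Icc_mem_nhds ?_ ?_) (Icc_mem_nhds hθ'.1 hθ'.2)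
    · linarith [neg_abs_le t]
    · linarith [le_abs_self t]
  have hlim : Tendsto (fun p : ℝ × ℝ => C * (|p.1 - t| ^ (max p.2 θ - a / 2) + |p.2 - θ|))
      (𝓝 (t, θ)) (𝓝 0) := by
    have hcont : ContinuousAt (fun p : ℝ × ℝ => C * (|p.1 - t| ^ (max p.2 θ - a / 2) + |p.2 - θ|))
        (t, θ) := by
      refine continuousAt_const.mul (ContinuousAt.add (ContinuousAt.rpow ?_ ?_ (Or.inr ?_)) ?_)
      · fun_prop
      · fun_prop
      · simp only [max_self]
        linarith
      · fun_prop
    have := hcont.tendsto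
    simp only [sub_self, abs_zero, max_self, add_zero] at this
    rwa [Real.zero_rpow (by linarith), mul_zero] at this
  rw [ContinuousAt, tendsto_iff_dist_tendsto_zero]
  refine squeeze_zero' (Eventually.of_forall fun _ => dist_nonneg) ?_ hlim
  filter_upwards [hev] with p hp
  exact h p.1 hp.1 p.2 hp.2 t ht θ ⟨hθ'.1.le, hθ'.2.le⟩

theorem limsup_re_waveletSeries_eq_zero {ψ : 𝓢(ℝ, ℝ)} (hψ : HasSchwartzPrimitives ψ)
    {c : ℤ × ℤ → ℝ} (hc : IsSlowlyGrowing c) {ε : ℝ} (hε : 0 < ε) (s : ℝ) {θ : ℝ}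
    (hθ : θ ∈ Ioo (0 : ℝ) 1) :
    limsup (fun h : ℝ => ((|(waveletSeries ψ c (s + h) θ).re - (waveletSeries ψ c s θ).re| /
      |h| ^ (θ - ε) : ℝ) : EReal)) (𝓝[≠] 0) = 0 := by
  -- Using half of `ε` leaves a factor `|h|^(ε/2)` in the quotient, which tends to zero.
  obtain ⟨C, hC, h⟩ := exists_iteratedDeriv_waveletSeries_modulus hψ hc 0 (half_pos hε)
    (M := |s| + 1) (by positivity) hθ.1 (b := θ) hθ.2
  simp only [iteratedDeriv_zero] at h
  refine Tendsto.limsup_eq ?_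
  rw [← EReal.coe_zero, EReal.tendsto_coe]
  have hlim : Tendsto (fun h : ℝ => C * |h| ^ (ε / 2)) (𝓝[≠] 0) (𝓝 0) := by
    have hcont : ContinuousAt (fun h : ℝ => C * |h| ^ (ε / 2)) 0 :=
      continuousAt_const.mul (ContinuousAt.rpow (by fun_prop) (by fun_prop) (Or.inr (by linarith)))
    have := hcont.tendsto
    rw [abs_zero, Real.zero_rpow (by linarith), mul_zero] at this
    exact this.mono_left nhdsWithin_le_nhds
  refine squeeze_zero' (Eventually.of_forall fun _ => by positivity) ?_ hlim
  have hev : ∀ᶠ h : ℝ in 𝓝[≠] 0, h ∈ Icc (-1 : ℝ) 1 :=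
    mem_nhdsWithin_of_mem_nhds (Icc_mem_nhds (by norm_num) (by norm_num))
  filter_upwards [hev, self_mem_nhdsWithin] with x hx hx0
  have hxa : |x| ≤ 1 := abs_le.2 hx
  have hpos : 0 < |x| := abs_pos.2 hx0
  have h1 := h (s + x) (abs_le.1 ((abs_add_le s x).trans (by linarith))) θ ⟨le_rfl, le_rfl⟩ s
    (abs_le.1 (by linarith)) θ ⟨le_rfl, le_rfl⟩
  rw [max_self, sub_self, abs_zero, add_zero, add_sub_cancel_left] at h1
  rw [div_le_iff₀ (by positivity), mul_assoc, ← Real.rpow_add hpos]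
  rwa [show ε / 2 + (θ - ε) = θ - ε / 2 by ring]

/-! ### Fractional integration kernels -/

/-- `(u)₊ ^ a` for a complex exponent `a`. -/
def complexPosPow (a : ℂ) : ℝ → ℂ := (Ioi (0 : ℝ)).indicator fun u => (u : ℂ) ^ a

theorem complexPosPow_of_pos (a : ℂ) {u : ℝ} (hu : 0 < u) : complexPosPow a u = (u : ℂ) ^ a :=
  indicator_of_mem (mem_Ioi.2 hu) _

theorem complexPosPow_of_nonpos (a : ℂ) {u : ℝ} (hu : u ≤ 0) : complexPosPow a u = 0 :=
  indicator_of_notMem (by simpa using hu) _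

theorem measurable_complexPosPow (a : ℂ) : Measurable (complexPosPow a) :=
  Measurable.indicator (by fun_prop) measurableSet_Ioi

theorem integral_complexPosPow_mul (a : ℂ) (f : ℝ → ℂ) :
    ∫ u, complexPosPow a u * f u = ∫ u in Ioi (0 : ℝ), (u : ℂ) ^ a * f u := by
  rw [← integral_indicator measurableSet_Ioi]
  congr 1
  ext u
  simp only [complexPosPow, indicator_apply]
  split_ifs <;> simp

theorem integrable_norm_complexPosPow_mul {a : ℂ} (h0 : -1 < a.re) (h1 : a.re < 2) :
    Integrable fun u : ℝ => ‖complexPosPow a u‖ * ((1 + |u|) ^ 3)⁻¹ := by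
  have hc : Continuous fun u : ℝ => ((((1 + |u|) ^ 3)⁻¹ : ℝ) : ℂ) :=
    Complex.continuous_ofReal.comp
      (Continuous.inv₀ (by fun_prop) fun u => by positivity)
  have h := integrableOn_cpow_mul_of_decay hc h0 (n := 3) (by norm_num; linarith) zero_le_one
    fun u => by
      rw [Complex.norm_real, Real.norm_of_nonneg (by positivity), one_mul]
  rw [← integrable_indicator_iff measurableSet_Ioi] at h
  refine h.norm.congr (Eventually.of_forall fun u => ?_)
  simp only [complexPosPow, indicator_apply]
  split_ifs
  · rw [norm_mul, Complex.norm_real, Real.norm_of_nonneg (by positivity)]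
  · simp

theorem inv_one_add_abs_pow_anti (x : ℝ) {m n : ℕ} (h : m ≤ n) :
    ((1 + |x|) ^ n)⁻¹ ≤ ((1 + |x|) ^ m)⁻¹ :=
  inv_anti₀ (by positivity) (pow_le_pow_right₀ (by linarith [abs_nonneg x]) h)

/-- Three powers of the decay of `g` are moved to `u` at the price of `(1 + |x|)^3`, which the five
powers of `f` absorb with two to spare. The sign `σ` covers both orders of integration in the
transposition below. -/
theorem integrable_complexPosPow_mul_mul {a : ℂ} (h0 : -1 < a.re) (h1 : a.re < 2) {f g : ℝ → ℂ}
    (hf : Continuous f) (hg : Continuous g) {A B : ℝ} (hfA : ∀ x, ‖f x‖ ≤ A * ((1 + |x|) ^ 5)⁻¹)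
    (hgB : ∀ x, ‖g x‖ ≤ B * ((1 + |x|) ^ 5)⁻¹) {σ : ℝ} (hσ : |σ| = 1) :
    Integrable (Function.uncurry fun u x => complexPosPow a u * (f x * g (x + σ * u))) := by
  have hA : 0 ≤ A := by have := (norm_nonneg _).trans (hfA 0); simpa using this
  have hB : 0 ≤ B := by have := (norm_nonneg _).trans (hgB 0); simpa using this
  refine (((integrable_norm_complexPosPow_mul h0 h1).mul_prod integrable_inv_one_add_abs_sq).const_mul
    (A * B)).mono' ?_ (Eventually.of_forall ?_)
  · refine Measurable.aestronglyMeasurable ?_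
    exact ((measurable_complexPosPow a).comp measurable_fst).mul
      ((hf.measurable.comp measurable_snd).mul (hg.measurable.comp (by fun_prop)))
  · rintro ⟨u, x⟩
    simp only [Function.uncurry_apply_pair]
    rw [norm_mul, norm_mul]
    have h2 : ‖g (x + σ * u)‖ ≤ B * ((1 + |x|) ^ 3 * ((1 + |u|) ^ 3)⁻¹) := by
      refine (hgB _).trans (mul_le_mul_of_nonneg_left ?_ hB)
      refine (inv_one_add_abs_pow_anti _ (by norm_num : 3 ≤ 5)).trans ?_
      have := inv_one_add_abs_pow_le' x (-(σ * u)) 3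
      rwa [sub_neg_eq_add, abs_neg, abs_mul, hσ, one_mul] at this
    calc _ ≤ ‖complexPosPow a u‖ * (A * ((1 + |x|) ^ 5)⁻¹ *
          (B * ((1 + |x|) ^ 3 * ((1 + |u|) ^ 3)⁻¹))) := by
          gcongr
          exact hfA x
      _ = _ := by field_simp

theorem integral_complexPosPow_adjoint {a : ℂ} (h0 : -1 < a.re) (h1 : a.re < 2) {f g : ℝ → ℂ}
    (hf : Continuous f) (hg : Continuous g) {A B : ℝ} (hfA : ∀ x, ‖f x‖ ≤ A * ((1 + |x|) ^ 5)⁻¹)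
    (hgB : ∀ x, ‖g x‖ ≤ B * ((1 + |x|) ^ 5)⁻¹) :
    ∫ t, (∫ u, complexPosPow a u * f (t - u)) * g t =
      ∫ x, f x * ∫ u, complexPosPow a u * g (x + u) := by
  have e1 := integrable_complexPosPow_mul_mul h0 h1 hg hf hgB hfA (σ := -1) (by simp)
  have e2 := integrable_complexPosPow_mul_mul h0 h1 hf hg hfA hgB (σ := 1) (by simp)
  have s1 := integral_integral_swap e1
  have s2 := integral_integral_swap e2
  simp only [neg_one_mul, ← sub_eq_add_neg, one_mul] at s1 s2
  calc _ = ∫ t, ∫ u, complexPosPow a u * (g t * f (t - u)) := by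
        congr 1
        ext t
        rw [← integral_mul_const]
        congr 1
        ext u
        ring
    _ = ∫ u, ∫ x, complexPosPow a u * (f x * g (x + u)) := by
        rw [← s1]
        congr 1
        ext u
        rw [← integral_add_right_eq_self (fun t => complexPosPow a u * (g t * f (t - u))) u]
        congr 1
        ext x
        rw [add_sub_cancel_right]
        ring
    _ = _ := by
        rw [s2]
        congr 1
        ext x
        rw [← integral_const_mul]
        congr 1
        ext u
        ring

theorem integral_complexPosPow_mul_complexPosPow {s t : ℂ} (w : ℝ) :
    ∫ u, complexPosPow (s - 1) u * complexPosPow (t - 1) (w - u) =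
      Complex.betaIntegral s t * complexPosPow (s + t - 1) w := by
  rcases le_or_gt w 0 with hw | hw
  · rw [complexPosPow_of_nonpos _ hw, mul_zero, integral_eq_zero_of_ae]
    refine Eventually.of_forall fun u => ?_
    rcases le_or_gt u 0 with hu | hu
    · simp [complexPosPow_of_nonpos _ hu]
    · simp [complexPosPow_of_nonpos _ (by linarith : w - u ≤ 0)]
  · rw [complexPosPow_of_pos _ hw, mul_comm, ← Complex.betaIntegral_scaled s t hw,
      intervalIntegral.integral_of_le hw.le, integral_Ioc_eq_integral_Ioo,
      ← integral_indicator measurableSet_Ioo]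
    congr 1
    ext u
    by_cases hu : u ∈ Ioo 0 w
    · rw [indicator_of_mem hu, complexPosPow_of_pos _ hu.1, complexPosPow_of_pos _ (sub_pos.2 hu.2),
        Complex.ofReal_sub]
    · rw [indicator_of_notMem hu]
      rcases le_or_gt u 0 with h | h
      · simp [complexPosPow_of_nonpos _ h]
      · have : w ≤ u := by
          by_contra! h2
          exact hu ⟨h, h2⟩
        simp [complexPosPow_of_nonpos _ (by linarith : w - u ≤ 0)]

/-- The semigroup law of fractional integration: Fubini after the shear `w = u + v`, the inner
integral being Euler's beta integral. For `u, v > 0` one has `(1+u)(1+v) ≤ (1+u+v)^2`, so decay of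
order 6 splits into order 3 in each variable. -/
theorem integral_complexPosPow_comp {s t : ℂ} (hs : 0 < s.re) (hs' : s.re < 3) (ht : 0 < t.re)
    (ht' : t.re < 3) {f : ℝ → ℂ} (hf : Continuous f) {A : ℝ}
    (hfA : ∀ x, ‖f x‖ ≤ A * ((1 + |x|) ^ 6)⁻¹) :
    ∫ u, complexPosPow (s - 1) u * ∫ v, complexPosPow (t - 1) v * f (u + v) =
      Complex.betaIntegral s t * ∫ w, complexPosPow (s + t - 1) w * f w := by
  have hA : 0 ≤ A := by have := (norm_nonneg _).trans (hfA 0); simpa using this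
  set F : ℝ × ℝ → ℂ := fun p =>
    complexPosPow (s - 1) p.1 * (complexPosPow (t - 1) p.2 * f (p.1 + p.2)) with hF
  have hFi : Integrable F := by
    refine (((integrable_norm_complexPosPow_mul (a := s - 1) (by simp [hs]) (by
      simp; linarith)).mul_prod
      (integrable_norm_complexPosPow_mul (a := t - 1) (by simp [ht]) (by
      simp; linarith))).const_mul A).mono' ?_ (Eventually.of_forall ?_)
    · refine Measurable.aestronglyMeasurable ?_
      exact ((measurable_complexPosPow _).comp measurable_fst).mul
        (((measurable_complexPosPow _).comp measurable_snd).mul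
          (hf.measurable.comp (by fun_prop)))
    · rintro ⟨u, v⟩
      simp only [hF, norm_mul]
      rcases le_or_gt u 0 with hu | hu
      · simp [complexPosPow_of_nonpos _ hu]
      rcases le_or_gt v 0 with hv | hv
      · simp [complexPosPow_of_nonpos _ hv]
      have h2 : ‖f (u + v)‖ ≤ A * (((1 + |u|) ^ 3)⁻¹ * ((1 + |v|) ^ 3)⁻¹) := by
        refine (hfA _).trans (mul_le_mul_of_nonneg_left ?_ hA)
        rw [← mul_inv, abs_of_pos hu, abs_of_pos hv, abs_of_pos (add_pos hu hv)]
        refine inv_anti₀ (by positivity) ?_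
        rw [← mul_pow, show 6 = 2 * 3 by norm_num, pow_mul]
        refine pow_le_pow_left₀ (by positivity) ?_ 3
        nlinarith
      calc _ ≤ ‖complexPosPow (s - 1) u‖ * (‖complexPosPow (t - 1) v‖ *
            (A * (((1 + |u|) ^ 3)⁻¹ * ((1 + |v|) ^ 3)⁻¹))) := by gcongr
        _ = _ := by ring
  have hsh := ((measurePreserving_prod_sub (volume : Measure ℝ) (volume : Measure ℝ)).integrable_comp
    hFi.aestronglyMeasurable).2 hFi
  have hswap := integral_integral_swap (f := fun u w => F (u, w - u)) hsh
  calc _ = ∫ u, ∫ w, F (u, w - u) := by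
        congr 1
        ext u
        rw [integral_sub_right_eq_self (fun v => F (u, v)) u, ← integral_const_mul]
    _ = _ := by
        rw [hswap, ← integral_const_mul]
        congr 1
        ext w
        rw [← mul_assoc, ← integral_complexPosPow_mul_complexPosPow, ← integral_mul_const]
        congr 1
        ext u
        simp only [hF]
        rw [add_sub_cancel]
        ring

theorem betaIntegral_ne_zero {s t : ℂ} (hs : 0 < s.re) (ht : 0 < t.re) :
    Complex.betaIntegral s t ≠ 0 := by
  intro h
  have h1 := Complex.Gamma_mul_Gamma_eq_betaIntegral hs ht
  rw [h, mul_zero] at h1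
  exact mul_ne_zero (Complex.Gamma_ne_zero_of_re_pos hs) (Complex.Gamma_ne_zero_of_re_pos ht) h1

/-! ### A function dual to the fractional primitive -/

/-- The reflection `x ↦ ψ (-x)`. -/
def reflection : 𝓢(ℝ, ℝ) →L[ℝ] 𝓢(ℝ, ℝ) :=
  SchwartzMap.compCLMOfContinuousLinearEquiv ℝ (ContinuousLinearEquiv.neg ℝ)

theorem reflection_apply (ψ : 𝓢(ℝ, ℝ)) (x : ℝ) : reflection ψ x = ψ (-x) := rfl

theorem derivCLM_reflection (ψ : 𝓢(ℝ, ℝ)) :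
    SchwartzMap.derivCLM ℝ ℝ (reflection ψ) = -reflection (SchwartzMap.derivCLM ℝ ℝ ψ) := by
  ext x
  have h := (ψ.hasDerivAt (-x)).scomp x (hasDerivAt_neg x)
  have h2 : HasDerivAt (reflection ψ) ((-1 : ℝ) • deriv ψ (-x)) x := h
  rw [SchwartzMap.derivCLM_apply, h2.deriv]
  simp [reflection_apply, SchwartzMap.derivCLM_apply]

theorem HasSchwartzPrimitives.reflection {ψ : 𝓢(ℝ, ℝ)} (hψ : HasSchwartzPrimitives ψ) :
    HasSchwartzPrimitives (reflection ψ) := by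
  have h : ∀ (m : ℕ) (φ : 𝓢(ℝ, ℝ)), ∃ φ' : 𝓢(ℝ, ℝ), (SchwartzMap.derivCLM ℝ ℝ)^[m] φ' =
      _root_.reflection ((SchwartzMap.derivCLM ℝ ℝ)^[m] φ) := by
    intro m
    induction m with
    | zero => exact fun φ => ⟨_, rfl⟩
    | succ m ih =>
      intro φ
      obtain ⟨φ', h'⟩ := ih φ
      refine ⟨-φ', ?_⟩
      have hneg : ∀ χ : 𝓢(ℝ, ℝ), (SchwartzMap.derivCLM ℝ ℝ)^[m] (-χ) =
          -(SchwartzMap.derivCLM ℝ ℝ)^[m] χ := fun χ =>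
        (Function.Commute.iterate_left (fun χ => map_neg (SchwartzMap.derivCLM ℝ ℝ) χ) m χ)
      rw [Function.iterate_succ_apply', hneg, h', map_neg, derivCLM_reflection, neg_neg,
        Function.iterate_succ_apply']
  intro m
  obtain ⟨φ, hφ⟩ := hψ m
  obtain ⟨φ', h'⟩ := h m φ
  exact ⟨φ', by rw [h', hφ]⟩

/-- The function `t ↦ ∫₀^∞ v ^ (1/2 - z) ψ''(t + v) dv`. -/
def dualPrimitive (ψ : 𝓢(ℝ, ℝ)) (z : ℂ) (t : ℝ) : ℂ :=
  complexPrimitive (SchwartzMap.derivCLM ℝ ℝ (SchwartzMap.derivCLM ℝ ℝ (reflection ψ))) (-t) (1 - z)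

theorem dualPrimitive_eq (ψ : 𝓢(ℝ, ℝ)) (z : ℂ) (t : ℝ) :
    dualPrimitive ψ z t = ∫ v, complexPosPow (1 / 2 - z) v *
      ((SchwartzMap.derivCLM ℝ ℝ (SchwartzMap.derivCLM ℝ ℝ ψ) (t + v) : ℝ) : ℂ) := by
  rw [integral_complexPosPow_mul, dualPrimitive, complexPrimitive]
  congr 1
  ext v
  rw [derivCLM_reflection, map_neg, derivCLM_reflection, neg_neg, reflection_apply,
    show 1 - z - 1 / 2 = 1 / 2 - z by ring, show -(-t - v) = t + v by ring]

theorem continuous_dualPrimitive (ψ : 𝓢(ℝ, ℝ)) {z : ℂ} (hz : z.re ≤ 1) :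
    Continuous (dualPrimitive ψ z) := by
  have h : Continuous fun y => complexPrimitive
      (SchwartzMap.derivCLM ℝ ℝ (SchwartzMap.derivCLM ℝ ℝ (reflection ψ))) y (1 - z) :=
    continuous_iff_continuousAt.2 fun y =>
      (hasDerivAt_complexPrimitive _ y (by simp [hz])).continuousAt
  exact h.comp continuous_neg

theorem exists_dualPrimitive_bound {ψ : 𝓢(ℝ, ℝ)} (hψ : HasSchwartzPrimitives ψ) {z : ℂ}
    (hz : z ∈ parameterStrip) (N : ℕ) :
    ∃ C > 0, ∀ t, ‖dualPrimitive ψ z t‖ ≤ C * ((1 + |t|) ^ N)⁻¹ := by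
  obtain ⟨C, hC, h⟩ := hψ.reflection.deriv.deriv.exists_bound N
  refine ⟨C, hC, fun t => ?_⟩
  have := h (1 - z) (by simpa using hz.2.1.le) (by simpa using hz.1.le) (by simpa using hz.2.2.le) (-t)
  rwa [abs_neg] at this

theorem integrable_of_decay {f : ℝ → ℂ} (hf : Continuous f) {C : ℝ}
    (h : ∀ x, ‖f x‖ ≤ C * ((1 + |x|) ^ 2)⁻¹) : Integrable f :=
  (integrable_inv_one_add_abs_sq.const_mul C).mono' hf.aestronglyMeasurable (Eventually.of_forall h)

/-- Up to reflection the integrand is the derivative of a decaying primitive, one of the two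
derivatives of `ψ` being pulled out of the integral. Zero mean removes the contribution of the base
point `s`. -/
theorem integral_dualPrimitive {ψ : 𝓢(ℝ, ℝ)} (hψ : HasSchwartzPrimitives ψ) {z : ℂ}
    (hz : z ∈ parameterStrip) : ∫ t, dualPrimitive ψ z t = 0 := by
  have h0 : 0 ≤ (1 - z).re := by simpa using hz.2.1.le
  have h1 : (1 - z).re ≤ 1 := by simpa using hz.1.le
  have h2 : |(1 - z).im| ≤ 1 := by simpa using hz.2.2.le
  set χ := SchwartzMap.derivCLM ℝ ℝ (reflection ψ) with hχ
  obtain ⟨C, -, h⟩ := hψ.reflection.deriv.exists_bound 2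
  obtain ⟨C', -, h'⟩ := hψ.reflection.deriv.deriv.exists_bound 2
  unfold dualPrimitive
  rw [integral_neg_eq_self fun t => complexPrimitive (SchwartzMap.derivCLM ℝ ℝ χ) t (1 - z)]
  refine integral_eq_zero_of_hasDerivAt_of_integrable
    (fun y => hasDerivAt_complexPrimitive χ y h0) ?_ ?_
  · exact integrable_of_decay (continuous_iff_continuousAt.2 fun y =>
      (hasDerivAt_complexPrimitive _ y h0).continuousAt) (h' _ h0 h1 h2)
  · exact integrable_of_decay (continuous_iff_continuousAt.2 fun y =>
      (hasDerivAt_complexPrimitive _ y h0).continuousAt) (h _ h0 h1 h2)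

theorem integral_Ioi_mul_deriv_deriv (ψ : 𝓢(ℝ, ℝ)) (x : ℝ) :
    ∫ w, complexPosPow 1 w *
      ((SchwartzMap.derivCLM ℝ ℝ (SchwartzMap.derivCLM ℝ ℝ ψ) (x + w) : ℝ) : ℂ) = ψ x := by
  set ψ₁ := SchwartzMap.derivCLM ℝ ℝ ψ with hψ₁
  set ψ₂ := SchwartzMap.derivCLM ℝ ℝ ψ₁ with hψ₂
  have hd : ∀ (φ : 𝓢(ℝ, ℝ)) (w : ℝ),
      HasDerivAt (fun w => φ (x + w)) (SchwartzMap.derivCLM ℝ ℝ φ (x + w)) w := fun φ w => by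
    rw [SchwartzMap.derivCLM_apply]
    exact (φ.hasDerivAt (x + w)).comp_const_add x w
  have hdec : ∀ φ : 𝓢(ℝ, ℝ), ∀ n : ℕ, ∃ C > 0, ∀ w, |φ (x + w)| ≤ C * ((1 + |w|) ^ n)⁻¹ := by
    intro φ n
    obtain ⟨C, hC, h⟩ := φ.exists_decay n
    refine ⟨C * (1 + |x|) ^ n, by positivity, fun w => (h _).trans ?_⟩
    have := inv_one_add_abs_pow_le' x (-w) n
    rw [sub_neg_eq_add, abs_neg] at this
    rw [mul_assoc]
    gcongr
  have hlim : Tendsto (fun w => w * ψ₁ (x + w) - ψ (x + w)) atTop (𝓝 0) := by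
    have hψlim : ∀ φ : 𝓢(ℝ, ℝ), Tendsto (fun w : ℝ => φ (x + w)) atTop (𝓝 0) := fun φ =>
      (φ.tendsto_cocompact.mono_left atTop_le_cocompact).comp
        (tendsto_atTop_add_const_left atTop x tendsto_id)
    rw [← sub_zero (0 : ℝ)]
    refine Tendsto.sub ?_ (hψlim ψ)
    obtain ⟨C, hC, h⟩ := hdec ψ₁ 2
    have h1 : Tendsto (fun w : ℝ => C * w⁻¹) atTop (𝓝 0) := by
      simpa using tendsto_inv_atTop_zero.const_mul C
    refine squeeze_zero_norm' ?_ h1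
    filter_upwards [eventually_gt_atTop 0] with w hw
    rw [norm_mul, Real.norm_of_nonneg hw.le, Real.norm_eq_abs]
    calc w * |ψ₁ (x + w)| ≤ w * (C * (w ^ 2)⁻¹) := by
          gcongr
          refine (h w).trans ?_
          gcongr
          rw [abs_of_pos hw]
          linarith
      _ = C * w⁻¹ := by field_simp
  have hint : IntegrableOn (fun w => w * ψ₂ (x + w)) (Ioi 0) := by
    obtain ⟨C, hC, h⟩ := hdec ψ₂ 3
    have hc : Continuous fun w => w * ψ₂ (x + w) := by fun_prop
    refine ((integrable_inv_one_add_abs_sq.const_mul C).mono' hc.aestronglyMeasurable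
      (Eventually.of_forall fun w => ?_)).integrableOn
    rw [norm_mul, Real.norm_eq_abs, Real.norm_eq_abs]
    calc |w| * |ψ₂ (x + w)| ≤ (1 + |w|) * (C * ((1 + |w|) ^ 3)⁻¹) := by
          gcongr
          · linarith
          · exact h w
      _ = _ := by field_simp
  have key := integral_Ioi_of_hasDerivAt_of_tendsto (a := 0)
    (f := fun w => w * ψ₁ (x + w) - ψ (x + w)) (f' := fun w => w * ψ₂ (x + w))
    (Continuous.continuousWithinAt (by fun_prop)) (fun w _ => by
      have := ((hasDerivAt_id w).mul (hd ψ₁ w)).sub (hd ψ w)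
      refine this.congr_deriv ?_
      change 1 * ψ₁ (x + w) + w * ψ₂ (x + w) - ψ₁ (x + w) = w * ψ₂ (x + w)
      ring) hint hlim
  rw [integral_complexPosPow_mul]
  simp only [zero_mul, zero_sub, add_zero, neg_neg] at key
  rw [← key, ← integral_complex_ofReal]
  congr 1
  ext w
  simp

/-- The fractional orders `z + 1/2` and `3/2 - z` add up to 2, and integration of order 2 undoes the
two derivatives. This dictates the form of `dualPrimitive`: two derivatives keep both exponents
above `-1` throughout the strip. -/
theorem integral_complexPosPow_mul_dualPrimitive (ψ : 𝓢(ℝ, ℝ)) {z : ℂ} (hz : z ∈ parameterStrip)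
    (x : ℝ) : ∫ u, complexPosPow (z - 1 / 2) u * dualPrimitive ψ z (x + u) =
      Complex.betaIntegral (z + 1 / 2) (3 / 2 - z) * ψ x := by
  set ψ₂ := SchwartzMap.derivCLM ℝ ℝ (SchwartzMap.derivCLM ℝ ℝ ψ) with hψ₂
  obtain ⟨C, hC, h⟩ := ψ₂.exists_decay 6
  have hz0 := hz.1
  have hz1 := hz.2.1
  have key := integral_complexPosPow_comp (s := z + 1 / 2) (t := 3 / 2 - z)
    (f := fun w => ((ψ₂ (x + w) : ℝ) : ℂ)) (A := C * (1 + |x|) ^ 6)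
    (by simp; linarith) (by simp; linarith) (by simp; linarith) (by simp; linarith)
    (Complex.continuous_ofReal.comp (by fun_prop)) fun w => by
      rw [Complex.norm_real, Real.norm_eq_abs, mul_assoc]
      refine (h _).trans ?_
      have := inv_one_add_abs_pow_le' x (-w) 6
      rw [sub_neg_eq_add, abs_neg] at this
      gcongr
  rw [show z + 1 / 2 + (3 / 2 - z) - 1 = 1 by ring, integral_Ioi_mul_deriv_deriv,
    show z + 1 / 2 - 1 = z - 1 / 2 by ring, show 3 / 2 - z - 1 = 1 / 2 - z by ring] at key
  rw [← key]
  congr 1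
  ext u
  rw [dualPrimitive_eq]
  simp only [add_assoc]
  rfl

theorem integral_fractional_mul_dualPrimitive {ψ : 𝓢(ℝ, ℝ)} (hψ : HasSchwartzPrimitives ψ) {z : ℂ}
    (hz : z ∈ parameterStrip) {f : ℝ → ℂ} (hf : Continuous f) {A : ℝ}
    (hfA : ∀ x, ‖f x‖ ≤ A * ((1 + |x|) ^ 5)⁻¹) :
    ∫ t, (∫ u, complexPosPow (z - 1 / 2) u * f (t - u)) * dualPrimitive ψ z t =
      Complex.betaIntegral (z + 1 / 2) (3 / 2 - z) * ∫ x, f x * ψ x := by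
  obtain ⟨C, hC, h⟩ := exists_dualPrimitive_bound hψ hz 5
  have hz0 := hz.1
  have hz1 := hz.2.1
  rw [integral_complexPosPow_adjoint (by simp; linarith) (by simp; linarith) hf
    (continuous_dualPrimitive ψ hz.2.1.le) hfA h, ← integral_const_mul]
  congr 1
  ext x
  rw [integral_complexPosPow_mul_dualPrimitive ψ hz]
  ring

/-! ### Recovering the coefficients from the sum of the series -/

theorem complexPrimitive_scale (ψ : 𝓢(ℝ, ℝ)) (z : ℂ) {R : ℝ} (hR : 0 < R) (m t : ℝ) :
    complexPrimitive ψ (R * t - m) z = R * (R : ℂ) ^ (z - 1 / 2) *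
      ∫ u, complexPosPow (z - 1 / 2) u * ((ψ (R * (t - u) - m) : ℝ) : ℂ) := by
  rw [integral_complexPosPow_mul, complexPrimitive]
  have h := integral_comp_mul_left_Ioi
    (fun v : ℝ => (v : ℂ) ^ (z - 1 / 2) * ((ψ (R * t - m - v) : ℝ) : ℂ)) 0 hR
  rw [mul_zero] at h
  have h2 : ∫ u in Ioi (0 : ℝ), ((R * u : ℝ) : ℂ) ^ (z - 1 / 2) * ((ψ (R * t - m - R * u) : ℝ) : ℂ) =
      (R : ℂ) ^ (z - 1 / 2) *
        ∫ u in Ioi (0 : ℝ), (u : ℂ) ^ (z - 1 / 2) * ((ψ (R * (t - u) - m) : ℝ) : ℂ) := by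
    rw [← integral_const_mul]
    refine setIntegral_congr_fun measurableSet_Ioi fun u hu => ?_
    have hu : 0 < u := hu
    rw [Complex.ofReal_mul, Complex.mul_cpow_ofReal_nonneg hR.le hu.le, mul_assoc,
      show R * t - m - R * u = R * (t - u) - m by ring]
  rw [mul_assoc, ← h2, h, Complex.real_smul, Complex.ofReal_inv, mul_inv_cancel_left₀]
  exact_mod_cast hR.ne'

theorem exists_decay_scale (ψ : 𝓢(ℝ, ℝ)) (n : ℕ) {R : ℝ} (hR : 0 < R) (m : ℝ) :
    ∃ C, ∀ x, |ψ (R * x - m)| ≤ C * ((1 + |x|) ^ n)⁻¹ := by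
  obtain ⟨C, hC, h⟩ := ψ.exists_decay n
  refine ⟨C * ((1 + |m|) ^ n * (1 + R⁻¹) ^ n), fun x => (h _).trans ?_⟩
  rw [mul_assoc]
  refine mul_le_mul_of_nonneg_left ?_ hC.le
  refine (inv_one_add_abs_pow_le (R * x) m n).trans ?_
  rw [mul_assoc]
  refine mul_le_mul_of_nonneg_left ?_ (by positivity)
  rw [← div_eq_mul_inv, le_div_iff₀ (by positivity), inv_mul_le_iff₀ (by positivity), mul_comm,
    ← mul_pow]
  refine pow_le_pow_left₀ (by positivity) ?_ n
  rw [abs_mul, abs_of_pos hR]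
  have : R⁻¹ * (R * |x|) = |x| := inv_mul_cancel_left₀ hR.ne' _
  have h1 : 0 < R⁻¹ := by positivity
  nlinarith [mul_nonneg hR.le (abs_nonneg x), abs_nonneg x]

theorem inner_waveletLp (ψ : 𝓢(ℝ, ℝ)) (J K j k : ℤ) :
    inner ℝ (waveletLp ψ (J, K)) (waveletLp ψ (j, k)) =
      (2 : ℝ) ^ ((J : ℝ) / 2) * (2 : ℝ) ^ ((j : ℝ) / 2) * ((2 : ℝ) ^ j)⁻¹ *
        ∫ x, ψ ((2 : ℝ) ^ J * ((2 : ℝ) ^ j)⁻¹ * (x + k) - K) * ψ x := by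
  have h1 : inner ℝ (waveletLp ψ (J, K)) (waveletLp ψ (j, k)) =
      ∫ x, waveletFun ψ J K x * waveletFun ψ j k x := by
    rw [L2.inner_def]
    refine integral_congr_ae ?_
    filter_upwards [(memLp_waveletFun ψ J K).coeFn_toLp, (memLp_waveletFun ψ j k).coeFn_toLp]
      with x e1 e2
    simp only [waveletLp]
    rw [e1, e2]
    simp [mul_comm]
  set F : ℝ → ℝ := fun x => ψ ((2 : ℝ) ^ J * ((2 : ℝ) ^ j)⁻¹ * (x + k) - K) * ψ x with hF
  have h2 := Measure.integral_comp_mul_left (fun y => F (y - k)) ((2 : ℝ) ^ j)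
  rw [integral_sub_right_eq_self F (k : ℝ), abs_of_pos (by positivity), smul_eq_mul] at h2
  rw [h1, mul_assoc, ← h2, ← integral_const_mul]
  congr 1
  ext x
  simp only [hF, waveletFun]
  rw [sub_add_cancel, show (2 : ℝ) ^ J * ((2 : ℝ) ^ j)⁻¹ * ((2 : ℝ) ^ j * x) = (2 : ℝ) ^ J * x by
    field_simp]
  ring

theorem Orthonormal.integral_wavelet {ψ : 𝓢(ℝ, ℝ)} (ho : Orthonormal ℝ (waveletLp ψ))
    (J K j k : ℤ) : ∫ x, ψ ((2 : ℝ) ^ J * ((2 : ℝ) ^ j)⁻¹ * (x + k) - K) * ψ x =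
      if (J, K) = (j, k) then 1 else 0 := by
  have h := inner_waveletLp ψ J K j k
  rw [orthonormal_iff_ite.1 ho] at h
  split_ifs at h ⊢ with hjk
  · obtain ⟨rfl, rfl⟩ := Prod.mk.inj hjk
    have e : (2 : ℝ) ^ J * ((2 : ℝ) ^ J)⁻¹ = 1 := mul_inv_cancel₀ (by positivity)
    rw [← Real.rpow_add two_pos, add_halves, Real.rpow_intCast, e, one_mul] at h
    rw [e, ← h]
  · have h0 := h.symm
    rw [mul_eq_zero] at h0
    exact h0.resolve_left (by positivity)

/-- Biorthogonality: fractional integration commutes with dilation up to a constant, and its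
transpose turns the dual function back into `ψ`, so only the orthonormality of the wavelets is left.
The dilation constant equals 1 when `J = j`. -/
theorem integral_complexPrimitive_mul_dualPrimitive {ψ : 𝓢(ℝ, ℝ)} (hψ : HasSchwartzPrimitives ψ)
    (ho : Orthonormal ℝ (waveletLp ψ)) {z : ℂ} (hz : z ∈ parameterStrip) (J K j k : ℤ) :
    ∫ t : ℝ, complexPrimitive ψ ((2 : ℝ) ^ J * (((2 : ℝ) ^ j)⁻¹ * (t + k)) - K) z *
      dualPrimitive ψ z t =
      if (J, K) = (j, k) then Complex.betaIntegral (z + 1 / 2) (3 / 2 - z) else 0 := by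
  set R : ℝ := (2 : ℝ) ^ J * ((2 : ℝ) ^ j)⁻¹ with hR
  have hR0 : 0 < R := by positivity
  set f : ℝ → ℂ := fun x => ((ψ (R * (x + k) - K) : ℝ) : ℂ) with hf
  obtain ⟨A, hA⟩ := exists_decay_scale ψ 5 hR0 (K - R * k)
  have hfA : ∀ x, ‖f x‖ ≤ A * ((1 + |x|) ^ 5)⁻¹ := fun x => by
    rw [hf, Complex.norm_real, Real.norm_eq_abs, show R * (x + k) - K = R * x - (K - R * k) by ring]
    exact hA x
  have hfc : Continuous f := Complex.continuous_ofReal.comp (by fun_prop)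
  have key := integral_fractional_mul_dualPrimitive hψ hz hfc hfA
  have h1 : ∀ t : ℝ, complexPrimitive ψ ((2 : ℝ) ^ J * (((2 : ℝ) ^ j)⁻¹ * (t + k)) - K) z =
      R * (R : ℂ) ^ (z - 1 / 2) * ∫ u, complexPosPow (z - 1 / 2) u * f (t - u) := fun t => by
    rw [← mul_assoc, ← hR, complexPrimitive_scale ψ z hR0]
    simp only [hf, sub_add_eq_add_sub]
  have h2 : ∫ x, f x * ψ x = ((if (J, K) = (j, k) then 1 else 0 : ℝ) : ℂ) := by
    rw [← ho.integral_wavelet J K j k, ← integral_complex_ofReal]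
    congr 1
    ext x
    simp [hf, hR]
  simp_rw [h1, mul_assoc _ _ (dualPrimitive ψ z _)]
  rw [integral_const_mul, key, h2]
  split_ifs with hjk
  · obtain ⟨rfl, rfl⟩ := Prod.mk.inj hjk
    have : R = 1 := mul_inv_cancel₀ (by positivity)
    simp [this]
  · simp

theorem exists_integrable_tsum_bound {ψ : 𝓢(ℝ, ℝ)} (hψ : HasSchwartzPrimitives ψ)
    {c : ℤ × ℤ → ℝ} (hc : IsSlowlyGrowing c) {z : ℂ} (hz : z ∈ parameterStrip) (s : ℝ) :
    ∃ C > 0, ∀ t : ℝ, (Summable fun jk => ‖incrementTerm ψ c t s z jk‖) ∧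
      ∑' jk, ‖incrementTerm ψ c t s z jk‖ ≤ C * (1 + |t - s|) ^ 2 := by
  obtain ⟨δ, hδ, h1, h2, -⟩ := exists_admissible_exponent hz.1 hz.2.1 one_pos
  obtain ⟨C, hC, h⟩ := exists_sum_incrementTerm_bound hψ hc hδ h1 h2
  refine ⟨C * (2 * (1 + |s|)), by positivity, fun t => ?_⟩
  have ht : |t| ≤ |t - s| + |s| := by simpa using abs_add_le (t - s) s
  obtain ⟨g1, g2⟩ := h z le_rfl le_rfl hz.2.2.le t s (|t - s| + |s|) ht
    (by linarith [abs_nonneg (t - s)])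
  refine ⟨g1, g2.trans ?_⟩
  rw [mul_assoc]
  refine mul_le_mul_of_nonneg_left ?_ hC.le
  have h3 := rpow_le_one_add (r := z.re - 3 * δ) (abs_nonneg (t - s)) (by linarith)
    (by linarith [hz.2.1])
  calc _ ≤ (1 + (|t - s| + |s|)) * ((1 + |t - s|) + |t - s|) := by gcongr
    _ ≤ ((1 + |s|) * (1 + |t - s|)) * (2 * (1 + |t - s|)) := by
      gcongr
      · nlinarith [mul_nonneg (abs_nonneg s) (abs_nonneg (t - s))]
      · linarith
    _ = _ := by ring

/-- Term-by-term integration isolates one coefficient: base-point terms vanish by zero mean, the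
others by biorthogonality. The exchange is legitimate because the sum of the norms grows at most
quadratically in `t`, against decay of order 4. -/
theorem integral_waveletSeries_sub_mul_dualPrimitive {ψ : 𝓢(ℝ, ℝ)} (hψ : HasSchwartzPrimitives ψ)
    (ho : Orthonormal ℝ (waveletLp ψ)) {c : ℤ × ℤ → ℝ} (hc : IsSlowlyGrowing c) {z : ℂ}
    (hz : z ∈ parameterStrip) (s : ℝ) (j k : ℤ) :
    ∫ t : ℝ, (waveletSeries ψ c (((2 : ℝ) ^ j)⁻¹ * (t + k)) z - waveletSeries ψ c s z) *
      dualPrimitive ψ z t =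
      (2 : ℂ) ^ (-(j : ℂ) * z) * c (j, k) * Complex.betaIntegral (z + 1 / 2) (3 / 2 - z) := by
  set τ : ℝ → ℝ := fun t => ((2 : ℝ) ^ j)⁻¹ * (t + k) with hτ
  have hτc : Continuous τ := by fun_prop
  set G := dualPrimitive ψ z with hG
  have hGc : Continuous G := continuous_dualPrimitive ψ hz.2.1.le
  obtain ⟨D, hD, hGD⟩ := exists_dualPrimitive_bound hψ hz 4
  obtain ⟨C, hC, hsum⟩ := exists_integrable_tsum_bound hψ hc hz s
  have hPc : ∀ JK : ℤ × ℤ, Continuous fun t =>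
      complexPrimitive ψ ((2 : ℝ) ^ JK.1 * τ t - JK.2) z := fun JK =>
    (continuous_iff_continuousAt.2 fun y =>
      (hasDerivAt_complexPrimitive ψ y hz.1.le).continuousAt).comp (by fun_prop)
  have hFc : ∀ JK : ℤ × ℤ, Continuous fun t => incrementTerm ψ c (τ t) s z JK * G t := fun JK => by
    unfold incrementTerm
    exact (continuous_const.mul ((hPc JK).sub continuous_const)).mul hGc
  have hGi : Integrable G := integrable_of_decay hGc fun t =>
    (hGD t).trans (mul_le_mul_of_nonneg_left (inv_one_add_abs_pow_anti t (by norm_num)) hD.le)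
  have hPi : ∀ JK : ℤ × ℤ, Integrable fun t =>
      complexPrimitive ψ ((2 : ℝ) ^ JK.1 * τ t - JK.2) z * G t := fun JK => by
    obtain ⟨C', -, h'⟩ := hψ.exists_bound 0
    refine hGi.bdd_mul (c := C') (hPc JK).aestronglyMeasurable (Eventually.of_forall fun t => ?_)
    simpa using h' z hz.1.le hz.2.1.le hz.2.2.le ((2 : ℝ) ^ JK.1 * τ t - JK.2)
  have hterm : ∀ JK : ℤ × ℤ, ∫ t, incrementTerm ψ c (τ t) s z JK * G t =
      if JK = (j, k) then (2 : ℂ) ^ (-(j : ℂ) * z) * c (j, k) *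
        Complex.betaIntegral (z + 1 / 2) (3 / 2 - z) else 0 := fun JK => by
    simp only [incrementTerm, mul_assoc, sub_mul, mul_sub]
    rw [integral_sub (((hPi JK).const_mul _).const_mul _) ((hGi.const_mul _).const_mul _ |>.const_mul _),
      integral_const_mul, integral_const_mul, integral_const_mul, integral_const_mul,
      integral_const_mul, integral_dualPrimitive hψ hz,
      integral_complexPrimitive_mul_dualPrimitive hψ ho hz]
    split_ifs with hjk
    · have hjk : JK = (j, k) := hjk
      subst hjk
      simp
    · simp
  have hA : 0 < 1 + (((2 : ℝ) ^ j)⁻¹ * (1 + |(k : ℝ)|) + |s|) := by positivity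
  set A := 1 + (((2 : ℝ) ^ j)⁻¹ * (1 + |(k : ℝ)|) + |s|) with hAdef
  have hτA : ∀ t, 1 + |τ t - s| ≤ A * (1 + |t|) := fun t => by
    have e1 : |τ t| ≤ ((2 : ℝ) ^ j)⁻¹ * (|t| + |(k : ℝ)|) := by
      rw [hτ, abs_mul, abs_of_pos (by positivity)]
      gcongr
      exact abs_add_le _ _
    have e2 := abs_sub (τ t) s
    have e3 : ((2 : ℝ) ^ j)⁻¹ * (|t| + |(k : ℝ)|) ≤
        ((2 : ℝ) ^ j)⁻¹ * ((1 + |(k : ℝ)|) * (1 + |t|)) := by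
      gcongr
      nlinarith [mul_nonneg (abs_nonneg t) (abs_nonneg (k : ℝ))]
    rw [hAdef]
    nlinarith [mul_nonneg (abs_nonneg s) (abs_nonneg t), abs_nonneg t]
  have hfin : ∑' JK, ∫⁻ t, ‖incrementTerm ψ c (τ t) s z JK * G t‖ₑ ≠ ∞ := by
    rw [← lintegral_tsum fun JK => (hFc JK).aemeasurable.enorm]
    refine ((lintegral_mono fun t => ?_).trans_lt
      (integrable_inv_one_add_abs_sq.const_mul (C * A ^ 2 * D)).lintegral_lt_top).ne
    have hst := (hsum (τ t)).1.mul_right ‖G t‖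
    simp_rw [← ofReal_norm, norm_mul]
    rw [← ENNReal.ofReal_tsum_of_nonneg (fun _ => by positivity) hst, tsum_mul_right]
    refine ENNReal.ofReal_le_ofReal ?_
    calc _ ≤ C * (1 + |τ t - s|) ^ 2 * (D * ((1 + |t|) ^ 4)⁻¹) := by
          gcongr
          · exact (hsum (τ t)).2
          · exact hGD t
      _ ≤ C * (A * (1 + |t|)) ^ 2 * (D * ((1 + |t|) ^ 4)⁻¹) := by
          gcongr
          exact hτA t
      _ = _ := by field_simp
  have key := integral_tsum (fun JK => (hFc JK).aestronglyMeasurable) hfin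
  simp_rw [hterm] at key
  rw [tsum_ite_eq] at key
  rw [← key]
  congr 1
  ext t
  rw [waveletSeries_sub hψ hc hz, tsum_mul_right]

/-! ### Pointwise irregularity -/

theorem incrementTerm_ofReal (ψ : 𝓢(ℝ, ℝ)) (c : ℤ × ℤ → ℝ) (t s θ : ℝ) (jk : ℤ × ℤ) :
    incrementTerm ψ c t s θ jk = (((2 : ℝ) ^ (-(jk.1 : ℝ) * θ) * c jk *
      (fractionalPrimitive ψ ((2 : ℝ) ^ jk.1 * t - jk.2) θ -
        fractionalPrimitive ψ ((2 : ℝ) ^ jk.1 * s - jk.2) θ) : ℝ) : ℂ) := by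
  rw [incrementTerm, complexPrimitive_ofReal, complexPrimitive_ofReal]
  push_cast
  rw [Complex.ofReal_cpow zero_le_two]
  push_cast
  rfl

theorem ofReal_re_waveletSeries (ψ : 𝓢(ℝ, ℝ)) (c : ℤ × ℤ → ℝ) (t θ : ℝ) :
    ((waveletSeries ψ c t θ).re : ℂ) = waveletSeries ψ c t θ := by
  unfold waveletSeries
  simp_rw [incrementTerm_ofReal]
  rw [← Complex.ofReal_tsum, Complex.ofReal_re]

/-- At time `2^(-j)(t + k)` the distance to `s` is `2^(-j) |t + k - 2^j s|`, so the tested increment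
is of order `2^(-jγ) (1+|t|)^3 (1+|k - 2^j s|)^3`. Decay of order 5 of the dual function makes it
integrable, and division by `2^(-jz)` and by the nonzero beta constant gives the bound. -/
theorem exists_coeff_bound_of_pointwise {ψ : 𝓢(ℝ, ℝ)} (hψ : HasSchwartzPrimitives ψ)
    (ho : Orthonormal ℝ (waveletLp ψ)) {c : ℤ × ℤ → ℝ} (hc : IsSlowlyGrowing c) {z : ℂ}
    (hz : z ∈ parameterStrip) {s γ K : ℝ} (hγ0 : 0 ≤ γ) (hγ1 : γ ≤ 1) (hK : 0 < K)
    (h : ∀ t, ‖waveletSeries ψ c t z - waveletSeries ψ c s z‖ ≤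
      K * (|t - s| ^ γ * (1 + |t - s|) ^ 2)) :
    ∃ C > 0, ∀ (j : ℕ) (k : ℤ), |c (j, k)| ≤
      C * (((2 : ℝ) ^ (z.re - γ)) ^ j * (1 + |k - 2 ^ j * s|) ^ 3) := by
  obtain ⟨D, hD, hGD⟩ := exists_dualPrimitive_bound hψ hz 5
  set B := Complex.betaIntegral (z + 1 / 2) (3 / 2 - z) with hB
  have hB0 : 0 < ‖B‖ := norm_pos_iff.2
    (betaIntegral_ne_zero (by simp; linarith [hz.1]) (by simp; linarith [hz.2.1]))
  set I := ∫ x : ℝ, ((1 + |x|) ^ 2)⁻¹ with hI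
  have hI0 : 0 ≤ I := integral_nonneg fun x => by positivity
  refine ⟨K * D * (I + 1) / ‖B‖, by positivity, fun j k => ?_⟩
  set q := |k - 2 ^ j * s| with hq
  have hq0 : 0 ≤ q := abs_nonneg _
  set E := ((2 : ℝ) ^ (-γ)) ^ j with hE
  have hE0 : 0 < E := by positivity
  have hint := integral_waveletSeries_sub_mul_dualPrimitive hψ ho hc hz s j k
  have hbound : ∀ t : ℝ, ‖(waveletSeries ψ c (((2 : ℝ) ^ (j : ℤ))⁻¹ * (t + k)) z -
      waveletSeries ψ c s z) * dualPrimitive ψ z t‖ ≤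
        K * D * (E * (1 + q) ^ 3) * ((1 + |t|) ^ 2)⁻¹ := fun t => by
    set y := t + (k - 2 ^ j * s) with hy
    have hP : (0 : ℝ) < 2 ^ j := by positivity
    have e1 : ((2 : ℝ) ^ (j : ℤ))⁻¹ * (t + k) - s = (2 ^ j)⁻¹ * y := by
      rw [zpow_natCast, hy]
      field_simp
      ring
    have e2 : |(2 ^ j)⁻¹ * y| = (2 ^ j)⁻¹ * |y| := by rw [abs_mul, abs_of_pos (by positivity)]
    have hy1 : 1 + |y| ≤ (1 + |t|) * (1 + q) := by
      have := abs_add_le t (k - 2 ^ j * s)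
      nlinarith [mul_nonneg (abs_nonneg t) hq0]
    have e3 : ((2 ^ j)⁻¹ * |y|) ^ γ ≤ E * (1 + |y|) := by
      rw [Real.mul_rpow (by positivity) (abs_nonneg y)]
      have : ((2 ^ j)⁻¹ : ℝ) ^ γ = E := by
        rw [hE, Real.inv_rpow hP.le, ← Real.rpow_neg hP.le, ← Real.rpow_natCast,
          ← Real.rpow_natCast, ← Real.rpow_mul zero_le_two, ← Real.rpow_mul zero_le_two, mul_comm]
      rw [this]
      gcongr
      exact rpow_le_one_add (abs_nonneg y) hγ0 hγ1
    have e4 : (2 ^ j)⁻¹ * |y| ≤ |y| :=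
      mul_le_of_le_one_left (abs_nonneg y) (inv_le_one_of_one_le₀ (one_le_pow₀ one_le_two))
    rw [norm_mul]
    calc _ ≤ K * (((2 ^ j)⁻¹ * |y|) ^ γ * (1 + (2 ^ j)⁻¹ * |y|) ^ 2) * (D * ((1 + |t|) ^ 5)⁻¹) := by
          gcongr
          · have := h (((2 : ℝ) ^ (j : ℤ))⁻¹ * (t + k))
            rwa [e1, e2] at this
          · exact hGD t
      _ ≤ K * (E * (1 + |y|) * (1 + |y|) ^ 2) * (D * ((1 + |t|) ^ 5)⁻¹) := by gcongr
      _ = K * (E * (1 + |y|) ^ 3) * (D * ((1 + |t|) ^ 5)⁻¹) := by ring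
      _ ≤ K * (E * ((1 + |t|) * (1 + q)) ^ 3) * (D * ((1 + |t|) ^ 5)⁻¹) := by gcongr
      _ = _ := by field_simp
  have hle := norm_integral_le_of_norm_le
    (integrable_inv_one_add_abs_sq.const_mul (K * D * (E * (1 + q) ^ 3)))
    (Eventually.of_forall hbound)
  rw [hint, integral_const_mul, ← hI, norm_mul, norm_mul, Complex.norm_real, Real.norm_eq_abs] at hle
  have hn : ‖(2 : ℂ) ^ (-((j : ℤ) : ℂ) * z)‖ = (((2 : ℝ) ^ z.re) ^ j)⁻¹ := by
    have := Complex.norm_cpow_eq_rpow_re_of_pos (two_pos (α := ℝ)) (-((j : ℤ) : ℂ) * z)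
    rw [Complex.ofReal_ofNat] at this
    rw [this, ← Real.rpow_natCast, ← Real.rpow_mul zero_le_two, ← Real.rpow_neg zero_le_two]
    congr 1
    simp [mul_comm]
  rw [hn] at hle
  have hZ : 0 < ((2 : ℝ) ^ z.re) ^ j := by positivity
  have hfac : ((2 : ℝ) ^ (z.re - γ)) ^ j = ((2 : ℝ) ^ z.re) ^ j * E := by
    rw [hE, ← mul_pow, ← Real.rpow_add two_pos, sub_eq_add_neg]
  rw [hfac, div_mul_eq_mul_div, le_div_iff₀ hB0]
  rw [mul_assoc, inv_mul_le_iff₀ hZ] at hle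
  refine hle.trans ?_
  have : K * D * (E * (1 + q) ^ 3) * I ≤ K * D * (E * (1 + q) ^ 3) * (I + 1) := by
    gcongr
    linarith
  calc _ ≤ ((2 : ℝ) ^ z.re) ^ j * (K * D * (E * (1 + q) ^ 3) * (I + 1)) := by gcongr
    _ = _ := by ring

/-- In the window starting at `⌊2^j s⌋` some coefficient has modulus at least 1, whereas the bound
there is at most `C r^j ((2 + L) j)^3`, which tends to zero. -/
theorem not_exists_coeff_bound {c : ℤ × ℤ → ℝ} {L : ℕ}
    (hL : ∀ᶠ j : ℕ in atTop, ∀ m : ℤ, |m| ≤ 4 ^ j → ∃ i : ℕ, i < L * j ∧ 1 ≤ |c (j, m + i)|)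
    {r : ℝ} (hr0 : 0 < r) (hr1 : r < 1) (s C : ℝ)
    (h : ∀ (j : ℕ) (k : ℤ), |c (j, k)| ≤ C * (r ^ j * (1 + |k - 2 ^ j * s|) ^ 3)) : False := by
  have hC : 0 ≤ C := by
    have := (abs_nonneg _).trans (h 0 0)
    exact nonneg_of_mul_nonneg_left this (by positivity)
  have hlim : Tendsto (fun j : ℕ => C * (2 + (L : ℝ)) ^ 3 * ((j : ℝ) ^ 3 * r ^ j)) atTop (𝓝 0) := by
    have := (tendsto_pow_const_mul_const_pow_of_abs_lt_one 3
      (by rwa [abs_of_pos hr0] : |r| < 1)).const_mul (C * (2 + (L : ℝ)) ^ 3)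
    rwa [mul_zero] at this
  -- Once `2^j ≥ |s| + 1`, one has `|⌊2^j s⌋| ≤ 2^j (|s| + 1) ≤ 4^j`, so the window is among those
  -- controlled by `hL`.
  obtain ⟨N, hN⟩ := exists_nat_ge (|s| + 1)
  have hpow : ∀ᶠ j : ℕ in atTop, N ≤ 2 ^ j :=
    (tendsto_pow_atTop_atTop_of_one_lt (one_lt_two : 1 < 2)).eventually_ge_atTop N
  obtain ⟨j, hj, hlt, hNj, hj1⟩ := (hL.and ((hlim.eventually_lt_const one_pos).and
    (hpow.and (eventually_ge_atTop 1)))).exists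
  have hP1 : (1 : ℝ) ≤ 2 ^ j := one_le_pow₀ one_le_two
  have hNj' : (N : ℝ) ≤ 2 ^ j := by exact_mod_cast hNj
  set m := ⌊(2 : ℝ) ^ j * s⌋ with hm
  have hm1 := Int.floor_le ((2 : ℝ) ^ j * s)
  have hm2 := Int.lt_floor_add_one ((2 : ℝ) ^ j * s)
  rw [← hm] at hm1 hm2
  have hmd : |(m : ℝ) - 2 ^ j * s| ≤ 1 := abs_le.2 ⟨by linarith, by linarith⟩
  have hm4 : |m| ≤ 4 ^ j := by
    have h1 : |(m : ℝ)| ≤ 4 ^ j := by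
      calc |(m : ℝ)| ≤ |(m : ℝ) - 2 ^ j * s| + |2 ^ j * s| := by
            simpa using abs_add_le ((m : ℝ) - 2 ^ j * s) (2 ^ j * s)
        _ ≤ 1 + 2 ^ j * |s| := by
            rw [abs_mul, abs_of_pos (by positivity : (0 : ℝ) < 2 ^ j)]
            gcongr
        _ ≤ 2 ^ j * (|s| + 1) := by linarith
        _ ≤ 2 ^ j * 2 ^ j := by
            gcongr
            linarith
        _ = 4 ^ j := by
            rw [← mul_pow]
            norm_num
    exact_mod_cast h1
  obtain ⟨i, hi, hi1⟩ := hj m hm4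
  have hq : 1 + |((m + i : ℤ) : ℝ) - 2 ^ j * s| ≤ (2 + L) * j := by
    have h1 : ((m + i : ℤ) : ℝ) - 2 ^ j * s = ((m : ℝ) - 2 ^ j * s) + i := by
      push_cast
      ring
    have h2 := abs_add_le ((m : ℝ) - 2 ^ j * s) i
    have h3 : |(i : ℝ)| ≤ L * j := by
      rw [Nat.abs_cast]
      exact_mod_cast hi.le
    have h4 : (1 : ℝ) ≤ j := by exact_mod_cast hj1
    rw [h1]
    linarith
  have hfin : |c (j, m + i)| ≤ C * (2 + (L : ℝ)) ^ 3 * ((j : ℝ) ^ 3 * r ^ j) := by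
    calc _ ≤ _ := h j (m + i)
      _ ≤ C * (r ^ j * ((2 + L) * j) ^ 3) := by gcongr
      _ = _ := by ring
  linarith

theorem limsup_re_waveletSeries_eq_top {ψ : 𝓢(ℝ, ℝ)} (hψ : HasSchwartzPrimitives ψ)
    (ho : Orthonormal ℝ (waveletLp ψ)) {c : ℤ × ℤ → ℝ} (hc : IsSlowlyGrowing c) {L : ℕ}
    (hL : ∀ᶠ j : ℕ in atTop, ∀ m : ℤ, |m| ≤ 4 ^ j → ∃ i : ℕ, i < L * j ∧ 1 ≤ |c (j, m + i)|)
    {ε : ℝ} (hε : 0 < ε) (s : ℝ) {θ : ℝ} (hθ : θ ∈ Ioo (0 : ℝ) 1) :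
    limsup (fun h : ℝ => ((|(waveletSeries ψ c (s + h) θ).re - (waveletSeries ψ c s θ).re| /
      |h| ^ (θ + ε) : ℝ) : EReal)) (𝓝[≠] 0) = ⊤ := by
  by_contra hne
  obtain ⟨C, hC, -⟩ := EReal.lt_iff_exists_real_btwn.1 (lt_top_iff_ne_top.2 hne)
  have hev := eventually_lt_of_limsup_lt hC
  have hz := ofReal_mem_parameterStrip hθ
  rw [eventually_nhdsWithin_iff, Metric.eventually_nhds_iff] at hev
  obtain ⟨r₀, hr₀, hev⟩ := hev
  set r := min r₀ 1 with hr
  have hr0 : 0 < r := lt_min hr₀ one_pos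
  -- The coefficient bound requires `γ ≤ 1`; since `θ < 1`, the cap still leaves `γ > θ`.
  set γ := min (θ + ε) 1 with hγ
  have hγθ : θ < γ := lt_min (by linarith) hθ.2
  have hγ0 : 0 < γ := hθ.1.trans hγθ
  obtain ⟨A, hA, hsum⟩ := exists_integrable_tsum_bound hψ hc hz s
  have hnorm : ∀ t, ‖waveletSeries ψ c t θ - waveletSeries ψ c s θ‖ =
      |(waveletSeries ψ c t θ).re - (waveletSeries ψ c s θ).re| := fun t => by
    rw [← ofReal_re_waveletSeries ψ c t, ← ofReal_re_waveletSeries ψ c s, ← Complex.ofReal_sub,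
      Complex.norm_real, Real.norm_eq_abs, Complex.ofReal_re, Complex.ofReal_re]
  -- The finite limsup only controls times near `s`; at distance at least `r` the quadratic growth
  -- bound takes over, with `|t - s|^γ ≥ r^γ`.
  have hK : ∀ t, ‖waveletSeries ψ c t θ - waveletSeries ψ c s θ‖ ≤
      (|C| + A * (r ^ γ)⁻¹) * (|t - s| ^ γ * (1 + |t - s|) ^ 2) := fun t => by
    have hone : 1 ≤ (1 + |t - s|) ^ 2 := one_le_pow₀ (by linarith [abs_nonneg (t - s)])
    have hpos : 0 ≤ |t - s| ^ γ * (1 + |t - s|) ^ 2 := by positivity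
    rcases eq_or_ne t s with rfl | hts
    · rw [sub_self, norm_zero]
      positivity
    have habs : 0 < |t - s| := abs_pos.2 (sub_ne_zero.2 hts)
    rcases lt_or_ge |t - s| r with hlt | hge
    · have h1 := hev (y := t - s) (by
        rw [dist_zero_right]
        exact hlt.trans_le (min_le_left _ _)) (sub_ne_zero.2 hts)
      rw [add_sub_cancel, EReal.coe_lt_coe_iff, div_lt_iff₀ (by positivity)] at h1
      rw [hnorm]
      have h2 : |t - s| ^ (θ + ε) ≤ |t - s| ^ γ :=
        Real.rpow_le_rpow_of_exponent_ge habs (hlt.le.trans (min_le_right _ _)) (min_le_left _ _)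
      calc _ ≤ C * |t - s| ^ (θ + ε) := h1.le
        _ ≤ |C| * (|t - s| ^ γ * (1 + |t - s|) ^ 2) := by
          gcongr
          · exact le_abs_self C
          · exact h2.trans (le_mul_of_one_le_right (by positivity) hone)
        _ ≤ _ := by
          gcongr
          linarith [show 0 ≤ A * (r ^ γ)⁻¹ by positivity]
    · have h1 : ‖waveletSeries ψ c t θ - waveletSeries ψ c s θ‖ ≤ A * (1 + |t - s|) ^ 2 := by
        rw [waveletSeries_sub hψ hc hz]
        exact (norm_tsum_le_tsum_norm (hsum t).1).trans (hsum t).2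
      have h2 : 1 ≤ (r ^ γ)⁻¹ * |t - s| ^ γ := by
        rw [inv_mul_eq_div, one_le_div (by positivity)]
        exact Real.rpow_le_rpow hr0.le hge hγ0.le
      calc _ ≤ A * (1 + |t - s|) ^ 2 := h1
        _ ≤ A * ((r ^ γ)⁻¹ * |t - s| ^ γ * (1 + |t - s|) ^ 2) := by
          gcongr
          exact le_mul_of_one_le_left (by positivity) h2
        _ = A * (r ^ γ)⁻¹ * (|t - s| ^ γ * (1 + |t - s|) ^ 2) := by ring
        _ ≤ _ := by
          gcongr
          linarith [abs_nonneg C]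
  obtain ⟨D, -, hD⟩ := exists_coeff_bound_of_pointwise hψ ho hc hz hγ0.le (min_le_right _ _)
    (by positivity) hK
  rw [Complex.ofReal_re] at hD
  exact not_exists_coeff_bound hL (by positivity)
    (Real.rpow_lt_one_of_one_lt_of_neg one_lt_two (by linarith)) s D hD

/-! ### The wavelet expansion of the field -/

theorem posPow_mul {R : ℝ} (hR : 0 < R) (u a : ℝ) : posPow (R * u) a = R ^ a * posPow u a := by
  unfold posPow
  by_cases hu : 0 < u
  · rw [if_pos hu, if_pos (mul_pos hR hu), Real.mul_rpow hR.le hu.le]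
  · rw [if_neg hu, if_neg (fun h => hu (pos_of_mul_pos_right h hR.le)), mul_zero]

theorem integrable_posPow_mul_schwartz (ψ : 𝓢(ℝ, ℝ)) (y : ℝ) {a : ℝ} (ha : -1 < a) :
    Integrable fun x => posPow (y - x) a * ψ x := by
  have h := (integrableOn_cpow_mul_schwartz ψ y (a := a) (by simpa using ha)).re
  rw [← IntegrableOn, ← integrable_indicator_iff measurableSet_Ioi] at h
  refine (h.comp_sub_left y).congr (Eventually.of_forall fun x => ?_)
  simp only [indicator_apply, posPow, mem_Ioi]
  split_ifs with hx
  · rw [sub_sub_cancel, ← Complex.ofReal_cpow hx.le, ← Complex.ofReal_mul]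
    simp
  · simp

theorem posPow_mul_waveletFun (ψ : 𝓢(ℝ, ℝ)) (j k : ℤ) (t θ x : ℝ) :
    posPow (t - x) (θ - 1 / 2) * waveletFun ψ j k x =
      (2 : ℝ) ^ ((j : ℝ) / 2) * ((2 : ℝ) ^ j) ^ (-(θ - 1 / 2)) *
        (posPow ((2 : ℝ) ^ j * t - k - ((2 : ℝ) ^ j * x - k)) (θ - 1 / 2) *
          ψ ((2 : ℝ) ^ j * x - k)) := by
  have hR : (0 : ℝ) < 2 ^ j := by positivity
  rw [waveletFun, sub_sub_sub_cancel_right, ← mul_sub, posPow_mul hR, Real.rpow_neg hR.le]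
  have : ((2 : ℝ) ^ j) ^ (θ - 1 / 2) ≠ 0 := by positivity
  field_simp

theorem integrable_posPow_mul_waveletFun (ψ : 𝓢(ℝ, ℝ)) (j k : ℤ) (t : ℝ) {θ : ℝ} (hθ : 0 < θ) :
    Integrable fun x => posPow (t - x) (θ - 1 / 2) * waveletFun ψ j k x := by
  simp_rw [posPow_mul_waveletFun]
  exact (((integrable_posPow_mul_schwartz ψ ((2 : ℝ) ^ j * t - k)
    (by linarith : -1 < θ - 1 / 2)).comp_sub_right (k : ℝ)).comp_mul_left'
      (zpow_ne_zero j two_ne_zero)).const_mul _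

theorem integral_posPow_mul_waveletFun (ψ : 𝓢(ℝ, ℝ)) (j k : ℤ) (t θ : ℝ) :
    ∫ x, posPow (t - x) (θ - 1 / 2) * waveletFun ψ j k x =
      (2 : ℝ) ^ (-(j : ℝ) * θ) * fractionalPrimitive ψ ((2 : ℝ) ^ j * t - k) θ := by
  simp_rw [posPow_mul_waveletFun]
  set F : ℝ → ℝ := fun x => posPow ((2 : ℝ) ^ j * t - k - x) (θ - 1 / 2) * ψ x with hF
  have h := Measure.integral_comp_mul_left (fun y => F (y - k)) ((2 : ℝ) ^ j)
  rw [integral_sub_right_eq_self F (k : ℝ), abs_of_pos (by positivity), smul_eq_mul] at h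
  rw [integral_const_mul]
  change _ * (∫ x, F (2 ^ j * x - k)) = _ * ∫ x, F x
  rw [h, ← mul_assoc]
  congr 1
  rw [← Real.rpow_intCast, ← Real.rpow_mul zero_le_two, ← Real.rpow_neg zero_le_two,
    ← Real.rpow_add two_pos, ← Real.rpow_add two_pos]
  congr 1
  ring

/-- Neither power in the kernel is square integrable by itself, but each is integrable against a
wavelet, so the inner product splits. -/
theorem inner_waveletLp_fieldKernel (ψ : 𝓢(ℝ, ℝ)) (jk : ℤ × ℤ) (t : ℝ) {θ : ℝ}
    (hθ : θ ∈ Ioo (0 : ℝ) 1) :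
    inner ℝ (waveletLp ψ jk) ((memLp_fieldKernel t hθ).toLp (fieldKernel t θ)) =
      (2 : ℝ) ^ (-(jk.1 : ℝ) * θ) * (fractionalPrimitive ψ ((2 : ℝ) ^ jk.1 * t - jk.2) θ -
        fractionalPrimitive ψ (-jk.2) θ) := by
  have h1 := integral_posPow_mul_waveletFun ψ jk.1 jk.2 t θ
  have h2 := integral_posPow_mul_waveletFun ψ jk.1 jk.2 0 θ
  rw [mul_zero, zero_sub] at h2
  rw [mul_sub, ← h1, ← h2, ← integral_sub (integrable_posPow_mul_waveletFun ψ _ _ t hθ.1)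
    (integrable_posPow_mul_waveletFun ψ _ _ 0 hθ.1), L2.inner_def]
  refine integral_congr_ae ?_
  filter_upwards [(memLp_waveletFun ψ jk.1 jk.2).coeFn_toLp, (memLp_fieldKernel t hθ).coeFn_toLp]
    with x e1 e2
  simp only [waveletLp]
  rw [e1, e2, fieldKernel]
  simp only [zero_sub, RCLike.inner_apply, conj_trivial]
  ring

/-- Along one enumeration, convergence in `L²` and almost sure convergence both imply convergence in
measure, whose limit is unique. -/
theorem ae_eq_of_hasSum_Lp {Ω : Type*} [MeasurableSpace Ω] {P : Measure Ω} [IsFiniteMeasure P]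
    {ι : Type*} [Denumerable ι] {g : ι → Lp ℝ 2 P} {G : Lp ℝ 2 P} (hg : HasSum g G) {X : Ω → ℝ}
    (hX : ∀ᵐ ω ∂P, HasSum (fun i => g i ω) (X ω)) : X =ᵐ[P] G := by
  set e := (Denumerable.eqv ι).symm
  set S : ℕ → Ω → ℝ := fun n ω => ∑ i ∈ Finset.range n, g (e i) ω with hS
  have h1 : Tendsto (fun n => ∑ i ∈ Finset.range n, g (e i)) atTop (𝓝 G) :=
    ((e.hasSum_iff).2 hg).tendsto_sum_nat
  have hcoe : ∀ n, (∑ i ∈ Finset.range n, g (e i) : Lp ℝ 2 P) =ᵐ[P] S n := fun n => by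
    have := Lp.coeFn_finsetSum (Finset.range n) fun i => g (e i)
    filter_upwards [this] with ω hω
    rw [hω]
    simp [hS]
  have h2 : TendstoInMeasure P S atTop G :=
    (tendstoInMeasure_of_tendsto_Lp h1).congr_left hcoe
  have h3 : TendstoInMeasure P S atTop X := by
    refine tendstoInMeasure_of_tendsto_ae (fun n => ?_) ?_
    · exact (Lp.aestronglyMeasurable _).congr (hcoe n)
    · filter_upwards [hX] with ω hω
      exact ((e.hasSum_iff).2 hω).tendsto_sum_nat
  exact tendstoInMeasure_ae_unique h3 h2

theorem hasSum_waveletTerm {Ω : Type*} [MeasurableSpace Ω] {W : ℝ → Ω → ℝ} {P : Measure Ω}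
    (hW : IsBrownianOnLine W P) {ψ : 𝓢(ℝ, ℝ)} (hψ : HasSchwartzPrimitives ψ) {ω : Ω}
    (hc : IsSlowlyGrowing fun jk => waveletCoeff hW ψ jk ω) (t : ℝ) {θ : ℝ}
    (hθ : θ ∈ Ioo (0 : ℝ) 1) : HasSum (waveletTerm hW ψ t θ ω)
      (waveletSeries ψ (fun jk => waveletCoeff hW ψ jk ω) t θ).re := by
  have h := Complex.hasSum_re
    (summable_incrementTerm hψ hc (ofReal_mem_parameterStrip hθ) t 0).hasSum
  refine h.congr_fun fun jk => ?_
  rw [incrementTerm_ofReal, Complex.ofReal_re, mul_zero, zero_sub]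
  rfl

theorem ae_hasSum_waveletTerm_fieldB {Ω : Type*} [MeasurableSpace Ω] {W : ℝ → Ω → ℝ}
    {P : Measure Ω} [IsFiniteMeasure P] (hW : IsBrownianOnLine W P) {ψ : 𝓢(ℝ, ℝ)}
    (hwav : IsLemarieMeyerWavelet ψ) (t : ℝ) {θ : ℝ} (hθ : θ ∈ Ioo (0 : ℝ) 1) {X : Ω → ℝ}
    (hX : ∀ᵐ ω ∂P, HasSum (waveletTerm hW ψ t θ ω) (X ω)) : X =ᵐ[P] fieldB hW t θ hθ := by
  set f := (memLp_fieldKernel t hθ).toLp (fieldKernel t θ) with hf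
  set b := HilbertBasis.mk hwav.orthonormal hwav.complete.ge with hb
  have hs := (b.hasSum_repr f).mapL hW.wienerIntegral
  refine ae_eq_of_hasSum_Lp hs ?_
  have hcoe : ∀ᵐ ω ∂P, ∀ jk : ℤ × ℤ, hW.wienerIntegral (b.repr f jk • b jk) ω =
      waveletTerm hW ψ t θ ω jk := by
    rw [ae_all_iff]
    intro jk
    rw [map_smul, b.repr_apply_apply, hb, HilbertBasis.coe_mk, hf,
      inner_waveletLp_fieldKernel ψ jk t hθ]
    filter_upwards [Lp.coeFn_smul ((2 : ℝ) ^ (-(jk.1 : ℝ) * θ) *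
      (fractionalPrimitive ψ ((2 : ℝ) ^ jk.1 * t - jk.2) θ - fractionalPrimitive ψ (-jk.2) θ))
      (hW.wienerIntegral (waveletLp ψ jk))] with ω hω
    rw [hω, Pi.smul_apply, smul_eq_mul, waveletTerm, waveletCoeff]
    ring
  filter_upwards [hX, hcoe] with ω h1 h2
  exact h1.congr_fun h2

theorem measurable_waveletTerm {Ω : Type*} [MeasurableSpace Ω] {W : ℝ → Ω → ℝ}
    {P : Measure Ω} (hW : IsBrownianOnLine W P) (ψ : 𝓢(ℝ, ℝ)) (t θ : ℝ) (jk : ℤ × ℤ) :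
    Measurable fun ω => waveletTerm hW ψ t θ ω jk :=
  ((hW.measurable_wienerIntegral (waveletLp ψ jk)).const_mul _).mul_const _

theorem hasSchwartzPrimitives_meyerPrimitive : HasSchwartzPrimitives (meyerPrimitive 0) := by
  have h : ∀ m n : ℕ, (SchwartzMap.derivCLM ℝ ℝ)^[m] (meyerPrimitive (n + m)) = meyerPrimitive n := by
    intro m
    induction m with
    | zero => exact fun n => rfl
    | succ m ih =>
      intro n
      rw [Function.iterate_succ_apply, ← add_assoc, deriv_meyerPrimitive, ih]
  exact fun m => ⟨_, h m 0⟩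

theorem mainTheorem2 {Ω : Type*} [MeasurableSpace Ω] {P : Measure Ω} [IsProbabilityMeasure P]
    {W : ℝ → Ω → ℝ} (hW : IsBrownianOnLine W P) :
    ∃ (ψ : 𝓢(ℝ, ℝ)) (Ωstar : Set Ω) (Bt : ℝ → ℝ → Ω → ℝ),
      IsLemarieMeyerWavelet ψ ∧
      -- `Ωstar` is an event of probability one
      MeasurableSet Ωstar ∧ P Ωstar = 1 ∧
      -- `Bt` is a modification of the field `B`
      (∀ (t θ : ℝ) (hθ : θ ∈ Ioo (0 : ℝ) 1),
        Measurable (Bt t θ) ∧ Bt t θ =ᵐ[P] fieldB hW t θ hθ) ∧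
      ∀ ω ∈ Ωstar,
        -- `Bt` is the sum of the wavelet series
        (∀ t : ℝ, ∀ θ ∈ Ioo (0 : ℝ) 1, HasSum (waveletTerm hW ψ t θ ω) (Bt t θ ω)) ∧
        -- joint continuity
        ContinuousOn (fun p : ℝ × ℝ => Bt p.1 p.2 ω) (univ ×ˢ Ioo (0 : ℝ) 1) ∧
        -- local behaviour of the increments in `t` at every point
        (∀ ε > (0 : ℝ), ∀ s : ℝ, ∀ θ ∈ Ioo (0 : ℝ) 1,
          limsup (fun h : ℝ => ((|Bt (s + h) θ ω - Bt s θ ω| / |h| ^ (θ - ε) : ℝ) : EReal))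
            (𝓝[≠] 0) = 0 ∧
          limsup (fun h : ℝ => ((|Bt (s + h) θ ω - Bt s θ ω| / |h| ^ (θ + ε) : ℝ) : EReal))
            (𝓝[≠] 0) = ⊤) ∧
        -- smoothness in `θ`
        (∀ t : ℝ, ContDiffOn ℝ (⊤ : ℕ∞) (fun θ => Bt t θ ω) (Ioo (0 : ℝ) 1)) ∧
        -- modulus of continuity of the `θ`-derivatives
        (∀ (n : ℕ) (ε M a b : ℝ), 0 < ε → 0 < M → 0 < a → a < b → b < 1 →
          ∃ C > (0 : ℝ), ∀ t₁ ∈ Icc (-M) M, ∀ θ₁ ∈ Icc a b, ∀ t₂ ∈ Icc (-M) M, ∀ θ₂ ∈ Icc a b,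
            |iteratedDeriv n (fun θ => Bt t₁ θ ω) θ₁ - iteratedDeriv n (fun θ => Bt t₂ θ ω) θ₂| ≤
              C * (|t₁ - t₂| ^ (max θ₁ θ₂ - ε) + |θ₁ - θ₂|)) := by
  set ψ := meyerPrimitive 0 with hψdef
  have hwav : IsLemarieMeyerWavelet ψ := isLemarieMeyerWavelet_meyerPrimitive
  have hψ : HasSchwartzPrimitives ψ := hasSchwartzPrimitives_meyerPrimitive
  obtain ⟨L, hL⟩ := hW.ae_exists_one_le hwav.orthonormal
  -- Both conditions bear on the coefficients alone, so one event works for all `(t, θ)`. A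
  -- measurable superset of the exceptional null set is removed to make it measurable.
  obtain ⟨Ωstar, hsub, hmeas, hnull⟩ : ∃ S : Set Ω, (∀ ω ∈ S,
      IsSlowlyGrowing (fun jk => waveletCoeff hW ψ jk ω) ∧
      ∀ᶠ j : ℕ in atTop, ∀ m : ℤ, |m| ≤ 4 ^ j →
        ∃ i : ℕ, i < L * j ∧ 1 ≤ |waveletCoeff hW ψ (j, m + i) ω|) ∧
      MeasurableSet S ∧ P Sᶜ = 0 := by
    obtain ⟨T, hT, hTm, hT0⟩ := exists_measurable_superset_of_null
      (ae_iff.1 ((hW.ae_growth hwav.orthonormal).and hL))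
    refine ⟨Tᶜ, fun ω hω => ?_, hTm.compl, by rwa [compl_compl]⟩
    by_contra h
    exact hω (hT h)
  have hone : P Ωstar = 1 := (prob_compl_eq_zero_iff hmeas).1 hnull
  set X : ℝ → ℝ → Ω → ℝ := fun t θ ω =>
    (waveletSeries ψ (fun jk => waveletCoeff hW ψ jk ω) t θ).re with hX
  -- Setting the field to zero off `Ωstar`, where the series may diverge, makes it an everywhere
  -- pointwise limit of measurable partial sums.
  set Bt : ℝ → ℝ → Ω → ℝ := fun t θ => Ωstar.indicator (X t θ) with hBt
  have hBtX : ∀ ω ∈ Ωstar, ∀ t θ, Bt t θ ω = X t θ ω := fun ω hω t θ => indicator_of_mem hω _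
  have hsum : ∀ ω ∈ Ωstar, ∀ t : ℝ, ∀ θ ∈ Ioo (0 : ℝ) 1,
      HasSum (waveletTerm hW ψ t θ ω) (Bt t θ ω) := fun ω hω t θ hθ => by
    rw [hBtX ω hω]
    exact hasSum_waveletTerm hW hψ (hsub ω hω).1 t hθ
  refine ⟨ψ, Ωstar, Bt, hwav, hmeas, hone, fun t θ hθ => ⟨?_, ?_⟩, fun ω hω => ?_⟩
  · refine measurable_of_tendsto_metrizable' atTop
      (f := fun (s : Finset (ℤ × ℤ)) =>
        Ωstar.indicator fun ω => ∑ jk ∈ s, waveletTerm hW ψ t θ ω jk)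
      (fun s => (Finset.measurable_sum s fun jk _ =>
        measurable_waveletTerm hW ψ t θ jk).indicator hmeas) ?_
    rw [tendsto_pi_nhds]
    intro ω
    by_cases hω : ω ∈ Ωstar
    · simp only [indicator_of_mem hω]
      exact hsum ω hω t θ hθ
    · simp [hBt, indicator_of_notMem hω]
  · refine ae_hasSum_waveletTerm_fieldB hW hwav t hθ ?_
    filter_upwards [mem_ae_iff.2 hnull] with ω hω
    exact hsum ω hω t θ hθ
  · obtain ⟨hc, hwin⟩ := hsub ω hω
    refine ⟨hsum ω hω, ?_, ?_, ?_, ?_⟩ <;> simp only [hBtX ω hω, hX]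
    · exact continuousOn_re_waveletSeries hψ hc
    · exact fun ε hε s θ hθ => ⟨limsup_re_waveletSeries_eq_zero hψ hc hε s hθ,
        limsup_re_waveletSeries_eq_top hψ hwav.orthonormal hc hwin hε s hθ⟩
    · exact fun t => contDiffOn_re_ofReal isOpen_parameterStrip
        (differentiableOn_waveletSeries hψ hc t) (fun θ hθ => ofReal_mem_parameterStrip hθ) ⊤
    · exact fun n ε M a b hε hM ha _ hb =>
        exists_iteratedDeriv_waveletSeries_modulus hψ hc n hε hM ha hb

end
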